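/- Let $r\ge 2$ be an integer, $\alpha,\beta>0$, $0<\alpha_0<r$, $0\le\lambda\le1$, and put $w(x)=x^\alpha(1-x)^\beta$, $\varphi(x)=\sqrt{x(1-x)}$, $\delta_n(x)=\varphi(x)+1/\sqrt n$. Let $C_w$ be the set of $f\in C((0,1))$ with $\lim_{x\to0}(wf)(x)=\lim_{x\to1}(wf)(x)=0$. *The operators.* For every $n\ge1$ let integers $n=n_0<n_1<\dots<n_{r-2}\le Kn$ and reals $C_0(n),\dots,C_{r-2}(n)$ be given with $\sum_i|C_i(n)|\le K$, $\sum_iC_i(n)=1$ and $\sum_iC_i(n)n_i^{-k}=0$ for $1\le k\le r-2$, where $K$ does not depend on $n$. Let $\psi\in C^r(\mathbb R)$ satisfy $0\le\psi\le1$, $\psi=0$ on $(-\infty,0]$ and $\psi=1$ on $[1,\infty)$. For $f\in C_w$ let $L_r(f,\cdot)$ and $R_r(f,\cdot)$ be the polynomials of degree less than $r$ that interpolate $f$ at $i/n$ and at $1-i/n$ $(1\le i\le r)$, respectively, and let $F_n$ be equal to $L_r(f,x)$ on $[0,\frac1n]$, to $(1-\psi(nx-1))L_r(f,x)+\psi(nx-1)f(x)$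 on $[\frac1n,\frac2n]$, to $f(x)$ on $[\frac2n,1-\frac2n]$, to $(1-\psi(n(1-x)-1))R_r(f,x)+\psi(n(1-x)-1)f(x)$ on $[1-\frac2n,1-\frac1n]$, and to $R_r(f,x)$ on $[1-\frac1n,1]$ (for $n$ large). Put $$B^*_{n,r-1}(f,x)=\sum_{i=0}^{r-2}C_i(n)B_{n_i}(F_n,x),\qquad B_m(g,x)=\sum_{k=0}^mg\big(\tfrac km\big)\binom mkx^k(1-x)^{m-k}.$$ *The modulus.* With $\Delta^r_sf(x)=\sum_{k=0}^r(-1)^k\binom rkf(x+(\frac r2-k)s)$, $\overrightarrow\Delta{}^r_hf(x)=\sum_{k=0}^r(-1)^k\binom rkf(x+(r-k)h)$, $\overleftarrow\Delta{}^r_hf(x)=\sum_{k=0}^r(-1)^k\binom rkf(x-kh)$ and $t^*=(rt)^{1/(1-\lambda/2)}$, let, for small $t>0$, $$\omega^r_{\varphi^\lambda}(f,t)_w=\sup_{0<h\le t}\|w\Delta^r_{h\varphi^\lambda}f\|_{[t^*,1-t^*]}+\sup_{0<h\le t^*}\|w\overrightarrow\Delta{}^r_hf\|_{[0,12t^*]}+\sup_{0<h\le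 t^*}\|w\overleftarrow\Delta{}^r_hf\|_{[1-12t^*,1]},$$ where $\|\cdot\|_I$ is the supremum norm on $I$ and the differences multiplied by $w$ are read as $0$ at $x=0$ and $x=1$. *Claim.* For every $f\in C_w$, $$w(x)\,|f(x)-B^*_{n,r-1}(f,x)|=O\big((n^{-1/2}\varphi^{-\lambda}(x)\delta_n(x))^{\alpha_0}\big)\quad(n\to\infty,\ \text{uniformly in }x\in(0,1))$$ if and only if $$\omega^r_{\varphi^\lambda}(f,t)_w=O(t^{\alpha_0})\quad(t\to0^+).$$ -/

import Mathlib

open Filter Topology Set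
open scoped ENNReal

noncomputable section

namespace WeightedBernstein

/-- The Jacobi weight `w(x) = x^α (1-x)^β`. -/
def weight (α β x : ℝ) : ℝ := x ^ α * (1 - x) ^ β

/-- The step-weight `φ(x) = √(x(1-x))`. -/
def phi (x : ℝ) : ℝ := Real.sqrt (x * (1 - x))

/-- `δ_n(x) = φ(x) + 1/√n`. -/
def delta (n : ℕ) (x : ℝ) : ℝ := phi x + 1 / Real.sqrt n

/-- The space `C_w`: `f` is continuous on `(0,1)` and `w f → 0` at both endpoints.
The values of `f` outside `(0,1)` play no role. -/
structure MemCw (α β : ℝ) (f : ℝ → ℝ) : Prop where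
  continuousOn : ContinuousOn f (Ioo 0 1)
  tendsto_zero : Tendsto (fun x => weight α β x * f x) (𝓝[>] 0) (𝓝 0)
  tendsto_one : Tendsto (fun x => weight α β x * f x) (𝓝[<] 1) (𝓝 0)

/-! ### Differences and the weighted modulus of smoothness -/

/-- The symmetric difference of order `r` with step `s`. -/
def centralDiff (r : ℕ) (f : ℝ → ℝ) (s x : ℝ) : ℝ :=
  ∑ k ∈ Finset.range (r + 1), (-1 : ℝ) ^ k * (r.choose k : ℝ) * f (x + ((r : ℝ) / 2 - k) * s)

/-- The forward difference of order `r` with step `h`. -/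
def forwardDiff (r : ℕ) (f : ℝ → ℝ) (h x : ℝ) : ℝ :=
  ∑ k ∈ Finset.range (r + 1), (-1 : ℝ) ^ k * (r.choose k : ℝ) * f (x + ((r : ℝ) - k) * h)

/-- The backward difference of order `r` with step `h`. -/
def backwardDiff (r : ℕ) (f : ℝ → ℝ) (h x : ℝ) : ℝ :=
  ∑ k ∈ Finset.range (r + 1), (-1 : ℝ) ^ k * (r.choose k : ℝ) * f (x - k * h)

/-- The endpoint scale `t* = (r t)^{1/(1-λ/2)}`. It is chosen so that, for `0 < h ≤ t` and
`t* ≤ x ≤ 1 - t*`, all the points `x ± (r/2) h φ^λ(x)` lie in `(0,1)`. -/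
def endScale (r : ℕ) (lam t : ℝ) : ℝ := ((r : ℝ) * t) ^ (1 / (1 - lam / 2))

/-- The weighted Ditzian–Totik modulus of smoothness of order `r` with step-weight `φ^λ`,
as an extended nonnegative real. -/
def modulus (α β : ℝ) (r : ℕ) (lam : ℝ) (f : ℝ → ℝ) (t : ℝ) : ℝ≥0∞ :=
  (⨆ h ∈ Ioc 0 t, ⨆ x ∈ Icc (endScale r lam t) (1 - endScale r lam t),
      ENNReal.ofReal |weight α β x * centralDiff r f (h * phi x ^ lam) x|) +
  (⨆ h ∈ Ioc 0 (endScale r lam t), ⨆ x ∈ Icc 0 (12 * endScale r lam t),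
      ENNReal.ofReal |weight α β x * forwardDiff r f h x|) +
  (⨆ h ∈ Ioc 0 (endScale r lam t), ⨆ x ∈ Icc (1 - 12 * endScale r lam t) 1,
      ENNReal.ofReal |weight α β x * backwardDiff r f h x|)

/-! ### Bernstein operators, their combinations, and the modification at the endpoints -/

/-- The Bernstein operator `B_n(g,x) = ∑_{k=0}^n g(k/n) C(n,k) x^k (1-x)^{n-k}`. -/
def bernsteinOp (n : ℕ) (g : ℝ → ℝ) (x : ℝ) : ℝ :=
  ∑ k ∈ Finset.range (n + 1), g ((k : ℝ) / n) * ((n.choose k : ℝ) * x ^ k * (1 - x) ^ (n - k))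

/-- Admissible nodes `n_i = d n i` and coefficients `C_i(n) = c n i` (`0 ≤ i < m`) of an
`m`-term combination of Bernstein operators, with a bound `K` independent of `n`. -/
structure IsCombination (m : ℕ) (d : ℕ → ℕ → ℕ) (c : ℕ → ℕ → ℝ) : Prop where
  node_zero : ∀ n, 1 ≤ n → d n 0 = n
  node_lt : ∀ n, 1 ≤ n → ∀ i j, i < j → j < m → d n i < d n j
  bounded : ∃ K : ℝ, ∀ n, 1 ≤ n →
    (∀ i, i < m → (d n i : ℝ) ≤ K * n) ∧ ∑ i ∈ Finset.range m, |c n i| ≤ K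
  sum_one : ∀ n, 1 ≤ n → ∑ i ∈ Finset.range m, c n i = 1
  sum_zero : ∀ n, 1 ≤ n → ∀ k, 1 ≤ k → k ≤ m - 1 →
    ∑ i ∈ Finset.range m, c n i * ((d n i : ℝ) ^ k)⁻¹ = 0

/-- The combination `B_{n,m}(g,x) = ∑_{i=0}^{m-1} C_i(n) B_{n_i}(g,x)`. -/
def combination (m : ℕ) (d : ℕ → ℕ → ℕ) (c : ℕ → ℕ → ℝ) (n : ℕ) (g : ℝ → ℝ) (x : ℝ) : ℝ :=
  ∑ i ∈ Finset.range m, c n i * bernsteinOp (d n i) g x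

/-- A cutoff of class `C^r`, rising from `0` to `1` on `[0,1]`. -/
structure IsCutoff (r : ℕ) (ψ : ℝ → ℝ) : Prop where
  contDiff : ContDiff ℝ r ψ
  eq_zero : ∀ x, x ≤ 0 → ψ x = 0
  eq_one : ∀ x, 1 ≤ x → ψ x = 1
  mem_Icc : ∀ x, ψ x ∈ Icc (0 : ℝ) 1

/-- `L_r(f,·)`: the polynomial of degree `< r` interpolating `f` at `i/n`, `1 ≤ i ≤ r`. -/
def leftInterp (r n : ℕ) (f : ℝ → ℝ) (x : ℝ) : ℝ :=
  (Lagrange.interpolate (Finset.Icc 1 r) (fun i : ℕ => (i : ℝ) / n)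
    (fun i : ℕ => f ((i : ℝ) / n))).eval x

/-- `R_r(f,·)`: the polynomial of degree `< r` interpolating `f` at `1 - i/n`, `1 ≤ i ≤ r`. -/
def rightInterp (r n : ℕ) (f : ℝ → ℝ) (x : ℝ) : ℝ :=
  (Lagrange.interpolate (Finset.Icc 1 r) (fun i : ℕ => 1 - (i : ℝ) / n)
    (fun i : ℕ => f (1 - (i : ℝ) / n))).eval x

/-- The modified function `F_n`: it is `L_r(f,·)` on `[0,1/n]`, `f` on `[2/n,1-2/n]`,
`R_r(f,·)` on `[1-1/n,1]`, blended by the cutoff `ψ` in between. -/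
def modified (ψ : ℝ → ℝ) (r n : ℕ) (f : ℝ → ℝ) (x : ℝ) : ℝ :=
  if x ≤ 1 / (n : ℝ) then leftInterp r n f x
  else if x < 2 / (n : ℝ) then
    (1 - ψ (n * x - 1)) * leftInterp r n f x + ψ (n * x - 1) * f x
  else if x ≤ 1 - 2 / (n : ℝ) then f x
  else if x < 1 - 1 / (n : ℝ) then
    (1 - ψ (n * (1 - x) - 1)) * rightInterp r n f x + ψ (n * (1 - x) - 1) * f x
  else rightInterp r n f x

/-- `B*_{n,r-1}(f,x) = B_{n,r-1}(F_n,x)`. -/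
def starOp (ψ : ℝ → ℝ) (r : ℕ) (d : ℕ → ℕ → ℕ) (c : ℕ → ℕ → ℝ) (n : ℕ) (f : ℝ → ℝ)
    (x : ℝ) : ℝ :=
  combination (r - 1) d c n (modified ψ r n f) x

end WeightedBernstein

end

/-!
Both the rate of approximation and the order of the modulus of smoothness are equivalent to one
and the same condition, `HalfSmooth`, on ordinary forward differences near an endpoint:
`|Δ_h^r f(y)| ≤ C h ^ a₀ max(h, y) ^ (-lam a₀ / 2) y ^ (-α)` for `0 < y ≤ 3/4` and small `h`, imposed
on `f` with exponent `α` and on `t ↦ f (1 - t)` with exponent `β` (`starRate_iff`, `modulus_iff`).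
All notions are compatible with the reflection `t ↦ 1 - t`, so only the left half is argued.

*Modulus.* For `y` large against `h`, the forward difference at `y` is the central difference at the
midpoint `z` with the variable step `t φ(z) ^ lam = h`; for the remaining `y`, it is one of those in
the forward part of the modulus, with `t` chosen so that `t* = r h`.

*From the rate to smoothness.* Writing `B*_n` for the modified combination, the key is the bound
`|(B*_n f)^{(r)}| ≤ Γ n ^ ((r - a₀)/2) v` with the Jacobi weight `v` that matches the hypothesis
(`StarRate.exists_abs_derivative_le`). It comes from comparing the levels `m ≈ n / A` and `n` through
`f = (f - B*_m f) + B*_m f`: the first part is controlled by a weighted Bernstein inequality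
(`exists_derivative_star_le`), the second by the fact that `B*_n` preserves weighted bounds for
`r`-th derivatives (`exists_derivative_star_le_of_derivative`), and the constant of the latter does
not depend on `A`, so that a large `A` makes the recursion contract. At a point `y` and a step
`h ≤ y` one then takes `n ≈ y / h²` and splits `Δ_h^r f = Δ_h^r (f - B*_n f) + Δ_h^r B*_n f`; steps
`h > y` follow by repeated halving (`halfSmooth_of_small_steps`).

*From smoothness to the rate.* At `x ≤ 1/2` and level `n` let `ρ = √(x/n) + 1/n`. A smoothing of `f`
by iterated averages with constant step `ρ` has a Taylor polynomial `P` at `x`, of degree `< r`, with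
`f - P` small on the scale `ρ` and growing only polynomially away from `x`
(`HalfSmooth.exists_local_poly`). As `B*_n` reproduces `P`, the error at `x` is that of `f - P`, which
is estimated node by node; the deviation of the node from `x`, in units of `ρ`, has bounded moments of
all orders, also against Jacobi weights (`exists_sum_bern_scaled_le`).
-/

namespace WeightedBernstein

/-! ### Moments of the Bernstein basis -/

/-- The Bernstein basis function `b_{N,k}(x) = C(N,k) x^k (1-x)^{N-k}`. -/
noncomputable def bern (N k : ℕ) (x : ℝ) : ℝ := (N.choose k : ℝ) * x ^ k * (1 - x) ^ (N - k)

/-- The natural scale `√(N x (1-x)) + 1` of the deviation `k - N x` under the binomial weights. -/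
noncomputable def sig (N : ℕ) (x : ℝ) : ℝ := Real.sqrt (N * (x * (1 - x))) + 1

/-- The normalised deviation `|k - N x| / sig N x`. -/
noncomputable def dev (N k : ℕ) (x : ℝ) : ℝ := |(k : ℝ) - N * x| / sig N x

lemma bern_nonneg {N k : ℕ} {x : ℝ} (hx : x ∈ Icc (0 : ℝ) 1) : 0 ≤ bern N k x := by
  have h1 := hx.1
  have h2 : 0 ≤ 1 - x := by linarith [hx.2]
  unfold bern
  positivity

lemma one_le_sig (N : ℕ) (x : ℝ) : 1 ≤ sig N x := by
  unfold sig
  linarith [Real.sqrt_nonneg (N * (x * (1 - x)))]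

lemma sig_pos (N : ℕ) (x : ℝ) : 0 < sig N x := lt_of_lt_of_le one_pos (one_le_sig N x)

lemma dev_nonneg (N k : ℕ) (x : ℝ) : 0 ≤ dev N k x :=
  div_nonneg (abs_nonneg _) (sig_pos N x).le

lemma abs_eq_dev_mul_sig (N k : ℕ) (x : ℝ) : |(k : ℝ) - N * x| = dev N k x * sig N x := by
  unfold dev
  field_simp [(sig_pos N x).ne']

/-- The centred moment generating function of the binomial distribution is sub-Gaussian near `0`. -/
lemma sum_bern_exp_le (N : ℕ) {x s : ℝ} (hx : x ∈ Icc (0 : ℝ) 1) (hs : |s| ≤ 1) :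
    ∑ k ∈ Finset.range (N + 1), bern N k x * Real.exp (s * (k - N * x)) ≤
      Real.exp (s ^ 2 * (N * (x * (1 - x)))) := by
  have h0 := hx.1
  have h1 : 0 ≤ 1 - x := by linarith [hx.2]
  have hsum : ∑ k ∈ Finset.range (N + 1), bern N k x * Real.exp (s * (k - N * x)) =
      (x * Real.exp (s * (1 - x)) + (1 - x) * Real.exp (s * (-x))) ^ N := by
    rw [add_pow]
    refine Finset.sum_congr rfl fun k hk => ?_
    have hk' : k ≤ N := by simpa [Nat.lt_succ_iff] using hk
    rw [mul_pow, mul_pow, ← Real.exp_nat_mul, ← Real.exp_nat_mul, bern]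
    have : Real.exp (s * (k - N * x)) =
        Real.exp (k * (s * (1 - x))) * Real.exp (((N - k : ℕ) : ℝ) * (s * (-x))) := by
      rw [← Real.exp_add, Nat.cast_sub hk']
      congr 1
      ring
    rw [this]
    ring
  have hb : ∀ u : ℝ, |u| ≤ 1 → Real.exp u ≤ 1 + u + u ^ 2 := fun u hu => by
    have := (abs_le.1 (Real.abs_exp_sub_one_sub_id_le hu)).2
    linarith
  have hu1 : |s * (1 - x)| ≤ 1 := by
    rw [abs_mul]
    exact mul_le_one₀ hs (abs_nonneg _) (abs_le.2 ⟨by linarith, by linarith⟩)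
  have hu2 : |s * (-x)| ≤ 1 := by
    rw [abs_mul]
    exact mul_le_one₀ hs (abs_nonneg _) (abs_le.2 ⟨by linarith, by linarith⟩)
  have hbase : x * Real.exp (s * (1 - x)) + (1 - x) * Real.exp (s * (-x)) ≤
      Real.exp (s ^ 2 * (x * (1 - x))) := by
    have e1 := mul_le_mul_of_nonneg_left (hb _ hu1) h0
    have e2 := mul_le_mul_of_nonneg_left (hb _ hu2) h1
    have e3 := Real.add_one_le_exp (s ^ 2 * (x * (1 - x)))
    nlinarith
  calc _ = (x * Real.exp (s * (1 - x)) + (1 - x) * Real.exp (s * (-x))) ^ N := hsum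
    _ ≤ Real.exp (s ^ 2 * (x * (1 - x))) ^ N := pow_le_pow_left₀ (by positivity) hbase N
    _ = _ := by
      rw [← Real.exp_nat_mul]
      congr 1
      ring

/-- All moments of the normalised deviation are bounded uniformly in `N` and `x`. -/
lemma exists_sum_bern_dev_le (j : ℕ) : ∃ C : ℝ, 0 < C ∧ ∀ (N : ℕ) (x : ℝ), x ∈ Icc (0 : ℝ) 1 →
    ∑ k ∈ Finset.range (N + 1), bern N k x * (1 + dev N k x) ^ j ≤ C := by
  refine ⟨j.factorial * Real.exp 1 * (2 * Real.exp 1), by positivity, fun N x hx => ?_⟩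
  have hφ : 0 ≤ (N : ℝ) * (x * (1 - x)) := by
    have := hx.1
    have : 0 ≤ 1 - x := by linarith [hx.2]
    positivity
  set σ := sig N x with hσ
  have hσ1 : 1 ≤ σ := one_le_sig N x
  have hσ0 : 0 < σ := sig_pos N x
  have hmgf : ∀ s : ℝ, |s| = 1 / σ →
      ∑ k ∈ Finset.range (N + 1), bern N k x * Real.exp (s * (k - N * x)) ≤ Real.exp 1 := by
    intro s hs
    refine (sum_bern_exp_le N hx ?_).trans (Real.exp_le_exp.2 ?_)
    · rw [hs, div_le_one hσ0]; exact hσ1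
    · rw [← sq_abs, hs, div_pow, one_pow, div_mul_eq_mul_div, one_mul, div_le_one (by positivity)]
      have h1 := Real.sq_sqrt hφ
      have h2 : Real.sqrt (N * (x * (1 - x))) ≤ σ := by rw [hσ, sig]; linarith
      nlinarith [Real.sqrt_nonneg (N * (x * (1 - x)))]
  have hpt : ∀ k ∈ Finset.range (N + 1), bern N k x * (1 + dev N k x) ^ j ≤
      j.factorial * Real.exp 1 * (bern N k x * Real.exp (1 / σ * (k - N * x)) +
        bern N k x * Real.exp (-(1 / σ) * (k - N * x))) := by
    intro k _
    have hd := dev_nonneg N k x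
    have h1 : (1 + dev N k x) ^ j ≤ j.factorial * Real.exp (1 + dev N k x) := by
      have := Real.pow_div_factorial_le_exp (1 + dev N k x) (by linarith) j
      rwa [div_le_iff₀ (by positivity), mul_comm] at this
    have h2 : Real.exp (dev N k x) ≤
        Real.exp (1 / σ * (k - N * x)) + Real.exp (-(1 / σ) * (k - N * x)) := by
      unfold dev
      rcases abs_cases ((k : ℝ) - N * x) with h | h
      · rw [h.1, div_eq_mul_one_div, mul_comm]
        linarith [Real.exp_pos (-(1 / σ) * (k - N * x))]
      · rw [h.1, div_eq_mul_one_div, mul_comm, mul_neg, ← neg_mul]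
        linarith [Real.exp_pos ((1 / σ) * (k - N * x))]
    rw [Real.exp_add] at h1
    have h3 : (1 + dev N k x) ^ j ≤ j.factorial * Real.exp 1 *
        (Real.exp (1 / σ * (k - N * x)) + Real.exp (-(1 / σ) * (k - N * x))) := by
      rw [← mul_assoc] at h1
      exact h1.trans (mul_le_mul_of_nonneg_left h2 (by positivity))
    have := mul_le_mul_of_nonneg_left h3 (bern_nonneg (k := k) (N := N) hx)
    linarith
  calc _ ≤ _ := Finset.sum_le_sum hpt
    _ = j.factorial * Real.exp 1 * (
        ∑ k ∈ Finset.range (N + 1), bern N k x * Real.exp (1 / σ * (k - N * x)) +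
        ∑ k ∈ Finset.range (N + 1), bern N k x * Real.exp (-(1 / σ) * (k - N * x))) := by
      rw [← Finset.mul_sum, Finset.sum_add_distrib]
    _ ≤ _ := by
      gcongr
      have h1 := hmgf (1 / σ) (abs_of_pos (by positivity))
      have h2 := hmgf (-(1 / σ)) (by rw [abs_neg]; exact abs_of_pos (by positivity))
      linarith

/-- If two positive numbers agree up to the factor `R`, so do their real powers,
up to `R ^ |p|`. -/
lemma rpow_le_of_ratio {A B R : ℝ} (hA : 0 < A) (hB : 0 < B) (hR : 1 ≤ R) (h1 : A ≤ R * B)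
    (h2 : B ≤ R * A) (p : ℝ) : A ^ p ≤ R ^ |p| * B ^ p := by
  have hR0 : 0 < R := by linarith
  rcases le_total 0 p with hp | hp
  · rw [abs_of_nonneg hp, ← Real.mul_rpow hR0.le hB.le]
    exact Real.rpow_le_rpow hA.le h1 hp
  · rw [abs_of_nonpos hp]
    have h3 : B / R ≤ A := by rw [div_le_iff₀ hR0]; linarith
    calc A ^ p ≤ (B / R) ^ p := Real.rpow_le_rpow_of_nonpos (by positivity) h3 hp
      _ = R ^ (-p) * B ^ p := by
        rw [Real.div_rpow hB.le hR0.le, Real.rpow_neg hR0.le]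
        field_simp

lemma sig_sq_le {N : ℕ} {x : ℝ} (hx : x ∈ Icc (0 : ℝ) 1) : sig N x ^ 2 ≤ 2 * (N * x + 1) := by
  have h0 := hx.1
  have h1 : 0 ≤ 1 - x := by linarith [hx.2]
  have h2 := Real.sq_sqrt (show 0 ≤ (N : ℝ) * (x * (1 - x)) by positivity)
  have h3 : (N : ℝ) * (x * (1 - x)) ≤ N * x :=
    mul_le_mul_of_nonneg_left (by nlinarith) (Nat.cast_nonneg N)
  unfold sig
  nlinarith [sq_nonneg (Real.sqrt (N * (x * (1 - x))) - 1)]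

/-- The index `k + 1` and its mean `N x + 1` agree up to a polynomial factor in the deviation. -/
lemma index_ratio {N k : ℕ} {x : ℝ} (hx : x ∈ Icc (0 : ℝ) 1) :
    (k : ℝ) + 1 ≤ 8 * (1 + dev N k x) ^ 2 * (N * x + 1) ∧
      (N : ℝ) * x + 1 ≤ 8 * (1 + dev N k x) ^ 2 * ((k : ℝ) + 1) := by
  have hs := sig_sq_le (N := N) hx
  have hs0 := sig_pos N x
  have hd := dev_nonneg N k x
  have hX : 0 ≤ (N : ℝ) * x := mul_nonneg (Nat.cast_nonneg N) hx.1
  have hk : (0 : ℝ) ≤ k := Nat.cast_nonneg k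
  have he := abs_eq_dev_mul_sig N k x
  set D := dev N k x
  set σ := sig N x
  set X := (N : ℝ) * x
  have hsX : σ ≤ 2 * (X + 1) := by nlinarith
  constructor
  · have h1 : (k : ℝ) - X ≤ D * σ := he ▸ le_abs_self _
    have h2 : D * σ ≤ D * (2 * (X + 1)) := by gcongr
    nlinarith [mul_nonneg hd hX, mul_nonneg (mul_nonneg hd hX) hd]
  · by_cases hc : X + 1 ≤ 2 * ((k : ℝ) + 1)
    · nlinarith [mul_nonneg hd hk, mul_nonneg (mul_nonneg hd hk) hd]
    · push Not at hc
      have h1 : X - k ≤ D * σ := by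
        rw [← he, abs_sub_comm]; exact le_abs_self _
      have h2 : (X + 1) / 2 ≤ D * σ := by linarith
      have h3 : ((X + 1) / 2) ^ 2 ≤ D ^ 2 * (2 * (X + 1)) := by
        calc _ ≤ (D * σ) ^ 2 := pow_le_pow_left₀ (by linarith) h2 2
          _ = D ^ 2 * σ ^ 2 := by ring
          _ ≤ _ := by gcongr
      have h4 : X + 1 ≤ 8 * D ^ 2 := by
        have : (X + 1) * (X + 1) ≤ (8 * D ^ 2) * (X + 1) := by nlinarith
        exact le_of_mul_le_mul_right this (by linarith)
      nlinarith [mul_nonneg hd hk, mul_nonneg (mul_nonneg hd hk) hd]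

lemma dev_symm {N k : ℕ} (hk : k ≤ N) (x : ℝ) : dev N (N - k) (1 - x) = dev N k x := by
  unfold dev sig
  rw [Nat.cast_sub hk]
  congr 1
  · rw [abs_sub_comm]
    congr 1
    ring
  · congr 3
    ring

lemma index_rpow_le {N k : ℕ} {x : ℝ} (hx : x ∈ Icc (0 : ℝ) 1) (p : ℝ) :
    ((k : ℝ) + 1) ^ p ≤ 8 ^ |p| * (1 + dev N k x) ^ (2 * ⌈|p|⌉₊) * (N * x + 1) ^ p := by
  have hd := dev_nonneg N k x
  have hX : 0 ≤ (N : ℝ) * x := mul_nonneg (Nat.cast_nonneg N) hx.1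
  obtain ⟨h1, h2⟩ := index_ratio (N := N) (k := k) hx
  refine (rpow_le_of_ratio (by positivity) (by positivity) ?_ h1 h2 p).trans ?_
  · nlinarith
  · rw [Real.mul_rpow (by norm_num) (by positivity)]
    have h3 : ((1 + dev N k x) ^ 2) ^ |p| ≤ (1 + dev N k x) ^ (2 * ⌈|p|⌉₊) := by
      rw [pow_mul, ← Real.rpow_natCast _ ⌈|p|⌉₊]
      exact Real.rpow_le_rpow_of_exponent_le (by nlinarith) (Nat.le_ceil _)
    gcongr

/-- Jacobi-type weights are stable under averaging against the Bernstein basis,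
for exponents of either sign. -/
lemma exists_sum_bern_weight_le (p q : ℝ) (j : ℕ) : ∃ C : ℝ, 0 < C ∧ ∀ (N : ℕ) (x : ℝ),
    x ∈ Icc (0 : ℝ) 1 →
    ∑ k ∈ Finset.range (N + 1), bern N k x *
        (((k : ℝ) + 1) ^ p * (((N - k : ℕ) : ℝ) + 1) ^ q * (1 + dev N k x) ^ j) ≤
      C * ((N * x + 1) ^ p * (N * (1 - x) + 1) ^ q) := by
  obtain ⟨C, hC, hsum⟩ := exists_sum_bern_dev_le (2 * ⌈|p|⌉₊ + 2 * ⌈|q|⌉₊ + j)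
  refine ⟨8 ^ |p| * 8 ^ |q| * C, by positivity, fun N x hx => ?_⟩
  have hx' : 1 - x ∈ Icc (0 : ℝ) 1 := ⟨by linarith [hx.2], by linarith [hx.1]⟩
  have h1 : 0 ≤ (N : ℝ) * x := mul_nonneg (Nat.cast_nonneg N) hx.1
  have h2 : 0 ≤ (N : ℝ) * (1 - x) := mul_nonneg (Nat.cast_nonneg N) hx'.1
  have hpt : ∀ k ∈ Finset.range (N + 1), bern N k x *
        (((k : ℝ) + 1) ^ p * (((N - k : ℕ) : ℝ) + 1) ^ q * (1 + dev N k x) ^ j) ≤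
      8 ^ |p| * 8 ^ |q| * ((N * x + 1) ^ p * (N * (1 - x) + 1) ^ q) *
        (bern N k x * (1 + dev N k x) ^ (2 * ⌈|p|⌉₊ + 2 * ⌈|q|⌉₊ + j)) := by
    intro k hk
    have hk' : k ≤ N := by simpa [Nat.lt_succ_iff] using hk
    have e1 := index_rpow_le (N := N) (k := k) hx p
    have e2 := index_rpow_le (N := N) (k := N - k) hx' q
    rw [dev_symm hk'] at e2
    have hd := dev_nonneg N k x
    calc _ ≤ bern N k x * ((8 ^ |p| * (1 + dev N k x) ^ (2 * ⌈|p|⌉₊) * (N * x + 1) ^ p) *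
          (8 ^ |q| * (1 + dev N k x) ^ (2 * ⌈|q|⌉₊) * (N * (1 - x) + 1) ^ q) *
            (1 + dev N k x) ^ j) := by
          have := bern_nonneg (N := N) (k := k) hx
          gcongr
      _ = _ := by rw [pow_add, pow_add]; ring
  refine (Finset.sum_le_sum hpt).trans ?_
  rw [← Finset.mul_sum]
  have := mul_le_mul_of_nonneg_left (hsum N x hx)
    (show 0 ≤ 8 ^ |p| * 8 ^ |q| * (((N : ℝ) * x + 1) ^ p * (N * (1 - x) + 1) ^ q) by positivity)
  linarith

open Polynomial in
/-- The Bernstein polynomial `∑ a_k b_{N,k}` with prescribed coefficients, as a polynomial. -/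
noncomputable def bernPoly (N : ℕ) (a : ℕ → ℝ) : ℝ[X] :=
  ∑ k ∈ Finset.range (N + 1), C (a k) * bernsteinPolynomial ℝ N k

/-! ### Derivatives of Bernstein polynomials -/

section Derivatives

open Polynomial

lemma eval_bernsteinPolynomial (N k : ℕ) (x : ℝ) :
    (bernsteinPolynomial ℝ N k).eval x = bern N k x := by
  simp [bernsteinPolynomial, bern]

lemma eval_bernPoly (N : ℕ) (a : ℕ → ℝ) (x : ℝ) :
    (bernPoly N a).eval x = ∑ k ∈ Finset.range (N + 1), a k * bern N k x := by
  simp [bernPoly, eval_finsetSum, eval_bernsteinPolynomial]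

lemma eval_bernPoly_node (N : ℕ) (g : ℝ → ℝ) (x : ℝ) :
    (bernPoly N (fun k => g ((k : ℝ) / N))).eval x = bernsteinOp N g x := by
  rw [eval_bernPoly]
  rfl

lemma X_mul_derivative_bernsteinPolynomial {N k : ℕ} (hk : k ≤ N) :
    X * (1 - X) * derivative (bernsteinPolynomial ℝ N k) =
      (C (k : ℝ) - C (N : ℝ) * X) * bernsteinPolynomial ℝ N k := by
  obtain ⟨m, rfl⟩ := Nat.exists_eq_add_of_le hk
  have h1 : X * derivative ((X : ℝ[X]) ^ k) = C (k : ℝ) * X ^ k := by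
    cases k with
    | zero => simp
    | succ k => rw [derivative_X_pow]; simp; ring
  have h2 : (1 - X) * derivative ((1 - X : ℝ[X]) ^ m) = -C (m : ℝ) * (1 - X) ^ m := by
    cases m with
    | zero => simp
    | succ m => rw [derivative_pow]; simp; ring
  rw [bernsteinPolynomial, Nat.add_sub_cancel_left, derivative_mul, derivative_mul,
    derivative_natCast]
  push_cast
  calc _ = ((k + m).choose k : ℝ[X]) * ((X * derivative ((X : ℝ[X]) ^ k)) * (1 - X) * (1 - X) ^ m +
        X ^ k * X * ((1 - X) * derivative ((1 - X : ℝ[X]) ^ m))) := by ring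
    _ = _ := by
      rw [h1, h2]
      simp only [map_add, map_natCast]
      ring

/-- The first-order differential equation of the Bernstein basis, differentiated `r + 1` times. -/
lemma derivative_recurrence {P : ℝ[X]} {k N : ℝ}
    (hP : X * (1 - X) * derivative P = (C k - C N * X) * P) (r : ℕ) :
    X * (1 - X) * derivative^[r + 2] P + C ((r : ℝ) + 1) * (1 - 2 * X) * derivative^[r + 1] P -
        C (((r : ℝ) + 1) * r) * derivative^[r] P =
      (C k - C N * X) * derivative^[r + 1] P - C (((r : ℝ) + 1) * N) * derivative^[r] P := by
  induction r with
  | zero =>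
    have h := congrArg derivative hP
    simp only [derivative_mul, derivative_sub, derivative_X, derivative_one, derivative_C] at h
    simp only [Function.iterate_succ_apply', Function.iterate_zero_apply, Nat.cast_zero, zero_add,
      one_mul, mul_zero, map_zero, zero_mul, map_one]
    linear_combination h
  | succ r ih =>
    have h := congrArg derivative ih
    simp only [derivative_mul, derivative_sub, derivative_add, derivative_X, derivative_one,
      derivative_C, derivative_ofNat, ← Function.iterate_succ_apply' derivative] at h
    simp only [map_mul, map_add, map_one, Nat.cast_add, Nat.cast_one] at h ⊢
    linear_combination h

/-- Pointwise bound for the derivatives of the Bernstein basis on the scale `σ / (x (1 - x))`. -/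
lemma exists_abs_derivative_bernstein_le (r : ℕ) : ∃ c : ℝ, 0 < c ∧ ∀ (N k : ℕ) (x : ℝ), k ≤ N →
    x ∈ Ioo (0 : ℝ) 1 → |(derivative^[r] (bernsteinPolynomial ℝ N k)).eval x| ≤
      c * (sig N x / (x * (1 - x)) * (1 + dev N k x)) ^ r * bern N k x := by
  suffices H : ∃ c : ℝ, 0 < c ∧ ∀ (N k : ℕ) (x : ℝ), k ≤ N → x ∈ Ioo (0 : ℝ) 1 →
      |(derivative^[r] (bernsteinPolynomial ℝ N k)).eval x| ≤
        c * (sig N x / (x * (1 - x)) * (1 + dev N k x)) ^ r * bern N k x ∧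
      |(derivative^[r + 1] (bernsteinPolynomial ℝ N k)).eval x| ≤
        c * (sig N x / (x * (1 - x)) * (1 + dev N k x)) ^ (r + 1) * bern N k x by
    obtain ⟨c, hc, h⟩ := H
    exact ⟨c, hc, fun N k x hk hx => (h N k x hk hx).1⟩
  induction r with
  | zero =>
    refine ⟨1, one_pos, fun N k x hk hx => ?_⟩
    have hx' : x ∈ Icc (0 : ℝ) 1 := ⟨hx.1.le, hx.2.le⟩
    have hb := bern_nonneg (N := N) (k := k) hx'
    have hq : 0 < x * (1 - x) := mul_pos hx.1 (by linarith [hx.2])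
    have hσ := one_le_sig N x
    have hd := dev_nonneg N k x
    constructor
    · simp [eval_bernsteinPolynomial, abs_of_nonneg hb]
    · have h := congrArg (eval x) (X_mul_derivative_bernsteinPolynomial hk)
      simp only [eval_mul, eval_sub, eval_X, eval_one, eval_C, eval_bernsteinPolynomial] at h
      have h2 : |(derivative (bernsteinPolynomial ℝ N k)).eval x| * (x * (1 - x)) =
          dev N k x * sig N x * bern N k x := by
        have h3 := congrArg abs h
        rw [abs_mul (x * (1 - x)), abs_mul ((k : ℝ) - N * x), abs_of_pos hq, abs_of_nonneg hb,
          abs_eq_dev_mul_sig] at h3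
        linarith
      simp only [zero_add, Function.iterate_one, pow_one, one_mul]
      rw [← mul_le_mul_iff_left₀ hq, h2]
      have h3 : sig N x / (x * (1 - x)) * (1 + dev N k x) * bern N k x * (x * (1 - x)) =
          sig N x * (1 + dev N k x) * bern N k x := by
        rw [div_mul_eq_mul_div, div_mul_eq_mul_div, div_mul_cancel₀ _ hq.ne']
      rw [h3]
      have : 0 ≤ sig N x * bern N k x := by positivity
      nlinarith
  | succ r ih =>
    obtain ⟨c, hc, h⟩ := ih
    refine ⟨c + ((r + 1) * c + (r + 1) ^ 2 * c), by positivity, fun N k x hk hx => ?_⟩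
    obtain ⟨h0, h1⟩ := h N k x hk hx
    have hx' : x ∈ Icc (0 : ℝ) 1 := ⟨hx.1.le, hx.2.le⟩
    have hb := bern_nonneg (N := N) (k := k) hx'
    have h1x : 0 < 1 - x := by linarith [hx.2]
    have hq : 0 < x * (1 - x) := mul_pos hx.1 h1x
    have hq1 : x * (1 - x) ≤ 1 := by nlinarith [hx.1]
    have hσ := one_le_sig N x
    have hd := dev_nonneg N k x
    have hrec := congrArg (eval x) (derivative_recurrence
      (X_mul_derivative_bernsteinPolynomial hk) r)
    simp only [eval_mul, eval_sub, eval_add, eval_X, eval_one, eval_C, eval_ofNat] at hrec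
    have hu := abs_eq_dev_mul_sig N k x
    set p0 := (derivative^[r] (bernsteinPolynomial ℝ N k)).eval x
    set p1 := (derivative^[r + 1] (bernsteinPolynomial ℝ N k)).eval x
    set p2 := (derivative^[r + 1 + 1] (bernsteinPolynomial ℝ N k)).eval x
    set b := bern N k x
    set D := dev N k x
    set σ := sig N x with hσdef
    set T := σ / (x * (1 - x)) * (1 + D) with hT
    have hTq : T * (x * (1 - x)) = σ * (1 + D) := by
      rw [hT, div_mul_eq_mul_div, div_mul_cancel₀ _ hq.ne']
    have hT0 : 0 ≤ T := by positivity
    have hN : (N : ℝ) * (x * (1 - x)) + 1 ≤ σ ^ 2 := by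
      have := Real.sq_sqrt (show 0 ≤ (N : ℝ) * (x * (1 - x)) by positivity)
      rw [hσdef, sig]
      nlinarith [Real.sqrt_nonneg (N * (x * (1 - x)))]
    have e1 : |((k : ℝ) - N * x) - (r + 1) * (1 - 2 * x)| ≤ (r + 1) * (T * (x * (1 - x))) := by
      rw [hTq]
      have e3 : |(r + 1 : ℝ) * (1 - 2 * x)| ≤ r + 1 := by
        rw [abs_mul, abs_of_pos (by positivity : (0 : ℝ) < r + 1)]
        have : |1 - 2 * x| ≤ 1 := abs_le.2 ⟨by linarith [hx.2], by linarith [hx.1]⟩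
        nlinarith [(Nat.cast_nonneg r : (0 : ℝ) ≤ r)]
      have e4 := abs_sub ((k : ℝ) - N * x) ((r + 1) * (1 - 2 * x))
      rw [hu] at e4
      have : (0 : ℝ) ≤ r * (σ * (1 + D) - 1) := by
        have : 0 ≤ σ * (1 + D) - 1 := by nlinarith
        positivity
      nlinarith
    have e2 : |(r + 1 : ℝ) * r - (r + 1) * N| * (x * (1 - x)) ≤
        (r + 1) ^ 2 * (T * (x * (1 - x))) ^ 2 := by
      rw [hTq]
      have e5 : |(r + 1 : ℝ) * r - (r + 1) * N| ≤ (r + 1) * r + (r + 1) * N := by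
        refine (abs_sub _ _).trans (le_of_eq ?_)
        rw [abs_of_nonneg (by positivity), abs_of_nonneg (by positivity)]
      have e6 : σ ^ 2 ≤ (σ * (1 + D)) ^ 2 := by
        apply pow_le_pow_left₀ (by linarith)
        nlinarith
      have hr0 : (0 : ℝ) ≤ r := Nat.cast_nonneg r
      have hN0 : (0 : ℝ) ≤ N := Nat.cast_nonneg N
      calc _ ≤ ((r + 1) * r + (r + 1) * N) * (x * (1 - x)) := by gcongr
        _ = (r + 1) * (r * (x * (1 - x)) + N * (x * (1 - x))) := by ring
        _ ≤ (r + 1) * (r * σ ^ 2 + σ ^ 2) := by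
          have f0 : 1 ≤ σ ^ 2 := one_le_pow₀ hσ
          gcongr
          · exact hq1.trans f0
          · linarith
        _ = (r + 1) ^ 2 * σ ^ 2 := by ring
        _ ≤ _ := by gcongr
    refine ⟨h1.trans ?_, ?_⟩
    · have : 0 ≤ ((r + 1) * c + (r + 1) ^ 2 * c) * T ^ (r + 1) * b := by positivity
      nlinarith
    · have hp2 : (x * (1 - x)) * p2 = (((k : ℝ) - N * x) - (r + 1) * (1 - 2 * x)) * p1 +
          ((r + 1 : ℝ) * r - (r + 1) * N) * p0 := by linear_combination hrec
      have hfin : (x * (1 - x)) ^ 2 * |p2| ≤ (x * (1 - x)) ^ 2 *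
          (((r + 1) * c + (r + 1) ^ 2 * c) * T ^ (r + 1 + 1) * b) := by
        have g1 : (x * (1 - x)) * |p2| ≤
            |((k : ℝ) - N * x) - (r + 1) * (1 - 2 * x)| * |p1| +
              |(r + 1 : ℝ) * r - (r + 1) * N| * |p0| := by
          have g2 := congrArg abs hp2
          rw [abs_mul (x * (1 - x)), abs_of_pos hq] at g2
          rw [g2, ← abs_mul, ← abs_mul]
          exact abs_add_le _ _
        calc (x * (1 - x)) ^ 2 * |p2| = (x * (1 - x)) * ((x * (1 - x)) * |p2|) := by ring
          _ ≤ (x * (1 - x)) * (|((k : ℝ) - N * x) - (r + 1) * (1 - 2 * x)| * |p1| +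
              |(r + 1 : ℝ) * r - (r + 1) * N| * |p0|) := by gcongr
          _ = |((k : ℝ) - N * x) - (r + 1) * (1 - 2 * x)| * ((x * (1 - x)) * |p1|) +
              (|(r + 1 : ℝ) * r - (r + 1) * N| * (x * (1 - x))) * |p0| := by ring
          _ ≤ ((r + 1) * (T * (x * (1 - x)))) * ((x * (1 - x)) * (c * T ^ (r + 1) * b)) +
              ((r + 1) ^ 2 * (T * (x * (1 - x))) ^ 2) * (c * T ^ r * b) := by gcongr
          _ = _ := by ring
      have hfin' := le_of_mul_le_mul_left hfin (by positivity)
      have hcT : 0 ≤ c * T ^ (r + 1 + 1) * b := by positivity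
      calc |p2| ≤ _ := hfin'
        _ ≤ c * T ^ (r + 1 + 1) * b + ((r + 1) * c + (r + 1) ^ 2 * c) * T ^ (r + 1 + 1) * b :=
          le_add_of_nonneg_left hcT
        _ = _ := by ring

lemma exists_abs_derivative_bernPoly_le (r : ℕ) : ∃ c : ℝ, 0 < c ∧ ∀ (N : ℕ) (a : ℕ → ℝ) (x : ℝ),
    x ∈ Ioo (0 : ℝ) 1 → |(derivative^[r] (bernPoly N a)).eval x| ≤
      c * (sig N x / (x * (1 - x))) ^ r *
        ∑ k ∈ Finset.range (N + 1), bern N k x * (|a k| * (1 + dev N k x) ^ r) := by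
  obtain ⟨c, hc, h⟩ := exists_abs_derivative_bernstein_le r
  refine ⟨c, hc, fun N a x hx => ?_⟩
  rw [bernPoly, iterate_derivative_sum, eval_finsetSum, Finset.mul_sum]
  refine (Finset.abs_sum_le_sum_abs _ _).trans (Finset.sum_le_sum fun k hk => ?_)
  have hk' : k ≤ N := by simpa [Nat.lt_succ_iff] using hk
  rw [iterate_derivative_C_mul, eval_mul, eval_C, abs_mul]
  refine (mul_le_mul_of_nonneg_left (h N k x hk' hx) (abs_nonneg _)).trans (le_of_eq ?_)
  rw [mul_pow]
  ring

lemma derivative_bernPoly (N : ℕ) (a : ℕ → ℝ) :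
    derivative (bernPoly (N + 1) a) = C ((N : ℝ) + 1) * bernPoly N (fwdDiff 1 a) := by
  have h0 : ∑ k ∈ Finset.range (N + 1), C (a (k + 1)) * bernsteinPolynomial ℝ N (k + 1) +
      C (a 0) * bernsteinPolynomial ℝ N 0 =
      ∑ k ∈ Finset.range (N + 1), C (a k) * bernsteinPolynomial ℝ N k := by
    rw [← Finset.sum_range_succ' (fun k => C (a k) * bernsteinPolynomial ℝ N k),
      Finset.sum_range_succ _ (N + 1), bernsteinPolynomial.eq_zero_of_lt ℝ (Nat.lt_succ_self N),
      mul_zero, add_zero]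
  have h1 : derivative (bernPoly (N + 1) a) = C ((N : ℝ) + 1) *
      (∑ k ∈ Finset.range (N + 1), C (a (k + 1)) * bernsteinPolynomial ℝ N k -
        (∑ k ∈ Finset.range (N + 1), C (a (k + 1)) * bernsteinPolynomial ℝ N (k + 1) +
          C (a 0) * bernsteinPolynomial ℝ N 0)) := by
    rw [bernPoly, Finset.sum_range_succ', derivative_add, derivative_sum, mul_sub, mul_add,
      Finset.mul_sum, Finset.mul_sum, ← sub_sub, ← Finset.sum_sub_distrib, sub_eq_add_neg]
    congr 1
    · refine Finset.sum_congr rfl fun k _ => ?_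
      rw [derivative_C_mul, bernsteinPolynomial.derivative_succ]
      simp only [Nat.add_sub_cancel, Nat.cast_add, Nat.cast_one, map_add, map_natCast, map_one]
      ring
    · rw [derivative_C_mul, bernsteinPolynomial.derivative_zero]
      simp only [Nat.add_sub_cancel, Nat.cast_add, Nat.cast_one, map_add, map_natCast, map_one]
      ring
  rw [h1, h0, bernPoly, ← Finset.sum_sub_distrib]
  congr 1
  refine Finset.sum_congr rfl fun k _ => ?_
  rw [fwdDiff, C_sub, sub_mul]

/-- The `r`-th derivative of a Bernstein polynomial through differences of its coefficients. -/
lemma iterate_derivative_bernPoly (r N : ℕ) (a : ℕ → ℝ) :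
    derivative^[r] (bernPoly (N + r) a) =
      C ((N + r).descFactorial r : ℝ) * bernPoly N ((fwdDiff 1)^[r] a) := by
  induction r generalizing a with
  | zero => simp
  | succ r ih =>
    rw [Function.iterate_succ_apply, ← add_assoc, derivative_bernPoly, iterate_derivative_C_mul, ih,
      ← mul_assoc, ← C_mul, Nat.succ_descFactorial_succ, Function.iterate_succ_apply]
    push_cast
    rfl

lemma abs_derivative_bernPoly_le {r N : ℕ} (hrN : r ≤ N) (a : ℕ → ℝ) {x : ℝ}
    (hx : x ∈ Icc (0 : ℝ) 1) : |(derivative^[r] (bernPoly N a)).eval x| ≤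
      (N : ℝ) ^ r * ∑ k ∈ Finset.range (N - r + 1), bern (N - r) k x * |((fwdDiff 1)^[r] a) k| := by
  obtain ⟨M, rfl⟩ := Nat.exists_eq_add_of_le' hrN
  rw [iterate_derivative_bernPoly, eval_mul, eval_C, abs_mul, Nat.add_sub_cancel, eval_bernPoly,
    abs_of_nonneg (Nat.cast_nonneg _)]
  gcongr
  · exact_mod_cast Nat.descFactorial_le_pow _ _
  · refine (Finset.abs_sum_le_sum_abs _ _).trans (Finset.sum_le_sum fun k _ => ?_)
    rw [abs_mul, abs_of_nonneg (bern_nonneg hx), mul_comm]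

/-! ### Reproduction of polynomials -/

/-- The recursion for Bernstein polynomials of monomials. -/
lemma bernPoly_monomial_succ {N : ℕ} (hN : 1 ≤ N) (j : ℕ) :
    bernPoly N (fun k => ((k : ℝ) / N) ^ (j + 1)) =
      X * bernPoly N (fun k => ((k : ℝ) / N) ^ j) +
        C ((N : ℝ)⁻¹) * (X * (1 - X) * derivative (bernPoly N (fun k => ((k : ℝ) / N) ^ j))) := by
  have hN0 : (N : ℝ) ≠ 0 := by positivity
  simp only [bernPoly]
  rw [derivative_sum, Finset.mul_sum, Finset.mul_sum, Finset.mul_sum, ← Finset.sum_add_distrib]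
  refine Finset.sum_congr rfl fun k hk => ?_
  have hk' : k ≤ N := by simpa [Nat.lt_succ_iff] using hk
  have h := X_mul_derivative_bernsteinPolynomial hk'
  have e : (C ((N : ℝ)⁻¹) : ℝ[X]) * C (N : ℝ) = 1 := by rw [← C_mul, inv_mul_cancel₀ hN0, C_1]
  rw [derivative_C_mul, pow_succ, C_mul, div_eq_mul_inv (k : ℝ), C_mul (a := (k : ℝ))]
  linear_combination (-C ((N : ℝ)⁻¹) * C (((k : ℝ) * (N : ℝ)⁻¹) ^ j)) * h +
    X * C (((k : ℝ) * (N : ℝ)⁻¹) ^ j) * bernsteinPolynomial ℝ N k * e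

/-- `B_N(t^{j+1})` is a polynomial of degree at most `j` in `1/N` with constant term `x^{j+1}`. -/
lemma exists_bernPoly_monomial (j : ℕ) : ∃ Q : ℕ → ℝ[X], Q 0 = X ^ (j + 1) ∧ ∀ N : ℕ, 1 ≤ N →
    bernPoly N (fun k => ((k : ℝ) / N) ^ (j + 1)) =
      ∑ l ∈ Finset.range (j + 1), C (((N : ℝ) ^ l)⁻¹) * Q l := by
  induction j with
  | zero =>
    refine ⟨fun _ => X, by simp, fun N hN => ?_⟩
    have h1 : bernPoly N (fun k => ((k : ℝ) / N) ^ 0) = 1 := by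
      simp [bernPoly, bernsteinPolynomial.sum]
    rw [bernPoly_monomial_succ hN, h1]
    simp
  | succ j ih =>
    obtain ⟨Q, hQ0, hQ⟩ := ih
    refine ⟨fun l => X * (if l ≤ j then Q l else 0) +
      (if l = 0 then 0 else X * (1 - X) * derivative (Q (l - 1))), by simp [hQ0]; ring,
      fun N hN => ?_⟩
    rw [bernPoly_monomial_succ hN, hQ N hN]
    simp only [mul_add, Finset.sum_add_distrib]
    congr 1
    · rw [Finset.sum_range_succ _ (j + 1), Finset.mul_sum]
      simp only [show ¬ (j + 1 ≤ j) by omega, if_false, mul_zero, add_zero]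
      refine Finset.sum_congr rfl fun l hl => ?_
      rw [if_pos (by simpa [Nat.lt_succ_iff] using hl)]
      ring
    · rw [Finset.sum_range_succ' _ (j + 1), derivative_sum, Finset.mul_sum, Finset.mul_sum]
      simp only [if_true, mul_zero, add_zero, Nat.add_sub_cancel, Nat.succ_ne_zero, if_false]
      refine Finset.sum_congr rfl fun l _ => ?_
      rw [derivative_C_mul, pow_succ, mul_inv, C_mul]
      ring

/-- `combination m d c n g` as a polynomial. -/
noncomputable def combPoly (m : ℕ) (d : ℕ → ℕ → ℕ) (c : ℕ → ℕ → ℝ) (n : ℕ) (g : ℝ → ℝ) : ℝ[X] :=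
  ∑ i ∈ Finset.range m, C (c n i) * bernPoly (d n i) (fun k => g ((k : ℝ) / d n i))

lemma eval_combPoly (m : ℕ) (d : ℕ → ℕ → ℕ) (c : ℕ → ℕ → ℝ) (n : ℕ) (g : ℝ → ℝ) (x : ℝ) :
    (combPoly m d c n g).eval x = combination m d c n g x := by
  simp [combPoly, combination, eval_finsetSum, eval_bernPoly_node]

lemma IsCombination.le_node {m : ℕ} {d : ℕ → ℕ → ℕ} {c : ℕ → ℕ → ℝ} (h : IsCombination m d c)
    {n i : ℕ} (hn : 1 ≤ n) (hi : i < m) : n ≤ d n i := by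
  rcases Nat.eq_zero_or_pos i with rfl | hi0
  · rw [h.node_zero n hn]
  · have := h.node_lt n hn 0 i hi0 hi
    rw [h.node_zero n hn] at this
    exact this.le

/-- An `m`-term combination reproduces polynomials of degree at most `m`. -/
lemma IsCombination.combPoly_eval {m : ℕ} {d : ℕ → ℕ → ℕ} {c : ℕ → ℕ → ℝ}
    (h : IsCombination m d c) {n : ℕ} (hn : 1 ≤ n) {P : ℝ[X]} (hP : P.natDegree ≤ m) :
    combPoly m d c n (fun t => P.eval t) = P := by
  have hmono : ∀ j ≤ m, combPoly m d c n (fun t => t ^ j) = X ^ j := by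
    intro j hj
    unfold combPoly
    have hsum1 := congrArg (C : ℝ → ℝ[X]) (h.sum_one n hn)
    rw [map_sum, C_1] at hsum1
    rcases j with _ | j
    · have h1 : ∀ N : ℕ, bernPoly N (fun k => ((k : ℝ) / N) ^ 0) = 1 := fun N => by
        simp [bernPoly, bernsteinPolynomial.sum]
      simp only [h1]
      simp only [mul_one, hsum1, pow_zero]
    · obtain ⟨Q, hQ0, hQ⟩ := exists_bernPoly_monomial j
      have h1 : ∀ i ∈ Finset.range m, C (c n i) *
          bernPoly (d n i) (fun k => ((k : ℝ) / d n i) ^ (j + 1)) =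
          ∑ l ∈ Finset.range (j + 1), C (c n i * ((d n i : ℝ) ^ l)⁻¹) * Q l := by
        intro i hi
        rw [hQ _ (hn.trans (h.le_node hn (Finset.mem_range.1 hi))), Finset.mul_sum]
        refine Finset.sum_congr rfl fun l _ => ?_
        rw [C_mul]
        ring
      rw [Finset.sum_congr rfl h1, Finset.sum_comm, Finset.sum_range_succ']
      simp only [← Finset.sum_mul, ← map_sum]
      rw [Finset.sum_eq_zero, zero_add]
      · simp [h.sum_one n hn, hQ0]
      · intro l hl
        have hl' := Finset.mem_range.1 hl
        rw [h.sum_zero n hn (l + 1) (by omega) (by omega), C_0, zero_mul]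
  have hP' := P.as_sum_range' (m + 1) (by omega)
  have hlin : combPoly m d c n (fun t => P.eval t) =
      ∑ j ∈ Finset.range (m + 1), C (P.coeff j) * combPoly m d c n (fun t => t ^ j) := by
    simp only [combPoly, bernPoly, Finset.mul_sum]
    rw [Finset.sum_comm]
    refine Finset.sum_congr rfl fun i _ => ?_
    rw [Finset.sum_comm]
    refine Finset.sum_congr rfl fun k _ => ?_
    rw [eval_eq_sum_range' (show P.natDegree < m + 1 by omega), map_sum, Finset.sum_mul,
      Finset.mul_sum]
    refine Finset.sum_congr rfl fun j _ => ?_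
    rw [C_mul]
    ring
  rw [hlin]
  conv_rhs => rw [hP']
  refine Finset.sum_congr rfl fun j hj => ?_
  rw [hmono j (by simpa [Nat.lt_succ_iff] using hj), C_mul_X_pow_eq_monomial]

end Derivatives

/-! ### Finite differences and Taylor remainders -/

lemma forwardDiff_eq_iterate (r : ℕ) (f : ℝ → ℝ) (h x : ℝ) :
    forwardDiff r f h x = (fwdDiff h)^[r] f x := by
  rw [fwdDiff_iter_eq_sum_shift, forwardDiff, ← Finset.sum_range_reflect]
  refine Finset.sum_congr rfl fun k hk => ?_
  have hk' : k ≤ r := by simpa [Nat.lt_succ_iff] using hk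
  rw [show r + 1 - 1 - k = r - k by omega, Nat.choose_symm hk', Nat.cast_sub hk']
  simp only [zsmul_eq_mul, nsmul_eq_mul]
  push_cast
  congr 3
  ring_nf

lemma backwardDiff_eq_reflect (r : ℕ) (f : ℝ → ℝ) (h x : ℝ) :
    backwardDiff r f h x = (-1) ^ r * backwardDiff r f (-h) (x - r * h) := by
  rw [backwardDiff, backwardDiff, ← Finset.sum_range_reflect, Finset.mul_sum]
  refine Finset.sum_congr rfl fun k hk => ?_
  have hk' : k ≤ r := by simpa [Nat.lt_succ_iff] using hk
  rw [show r + 1 - 1 - k = r - k by omega, Nat.choose_symm hk', Nat.cast_sub hk']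
  have e : (-1 : ℝ) ^ (r - k) = (-1) ^ r * (-1) ^ k := by
    have h1 : (-1 : ℝ) ^ r = (-1) ^ (r - k) * (-1) ^ k := by rw [← pow_add, Nat.sub_add_cancel hk']
    have h2 : (-1 : ℝ) ^ k * (-1) ^ k = 1 := by rw [← mul_pow]; norm_num
    rw [h1, mul_assoc, h2, mul_one]
  rw [e, show x - (↑r - ↑k) * h = x - r * h - k * -h by ring]
  ring

/-- The backward difference is, up to sign, the forward difference of the reflected function. -/
lemma abs_backwardDiff_eq_forwardDiff (r : ℕ) (f : ℝ → ℝ) (h x : ℝ) :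
    |backwardDiff r f h x| = |forwardDiff r (fun t => f (1 - t)) h (1 - x)| := by
  have : forwardDiff r (fun t => f (1 - t)) h (1 - x) = backwardDiff r f (-h) (x - r * h) := by
    refine Finset.sum_congr rfl fun k _ => ?_
    congr 2
    ring_nf
  rw [this, backwardDiff_eq_reflect, abs_mul, abs_pow, abs_neg, abs_one, one_pow, one_mul]

lemma centralDiff_eq_forwardDiff (r : ℕ) (f : ℝ → ℝ) (s x : ℝ) :
    centralDiff r f s x = forwardDiff r f s (x - r / 2 * s) := by
  refine Finset.sum_congr rfl fun k _ => ?_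
  congr 2
  ring_nf

lemma abs_centralDiff_reflect (r : ℕ) (f : ℝ → ℝ) (s x : ℝ) :
    |centralDiff r (fun t => f (1 - t)) s (1 - x)| = |centralDiff r f s x| := by
  rw [centralDiff_eq_forwardDiff, show 1 - x - r / 2 * s = 1 - (x + r / 2 * s) by ring,
    ← abs_backwardDiff_eq_forwardDiff]
  congr 1
  refine Finset.sum_congr rfl fun k _ => ?_
  congr 2
  ring_nf

lemma abs_fwdDiff_iter_le_two_pow {M : Type*} [AddCommMonoid M] (h : M) (r : ℕ) (f : M → ℝ) (y : M)
    {B : ℝ} (hB : ∀ j ≤ r, |f (y + j • h)| ≤ B) : |(fwdDiff h)^[r] f y| ≤ 2 ^ r * B := by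
  induction r generalizing f B with
  | zero => simpa using hB 0 le_rfl
  | succ r ih =>
    rw [Function.iterate_succ_apply]
    refine (ih (fwdDiff h f) (B := 2 * B) fun j hj => ?_).trans (le_of_eq (by ring))
    have h1 := hB j (by omega)
    have h2 := hB (j + 1) (by omega)
    rw [succ_nsmul, ← add_assoc] at h2
    rw [fwdDiff]
    linarith [abs_sub (f (y + j • h + h)) (f (y + j • h))]

/-- A difference of order `r` is at most `h ^ r` times the `r`-th derivative. Derivatives are
given as a chain `G 0, G 1, …`. -/
lemma abs_fwdDiff_iter_le_of_chain (r : ℕ) (G : ℕ → ℝ → ℝ)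
    (hG : ∀ j < r, ∀ z, HasDerivAt (G j) (G (j + 1) z) z) {h y M : ℝ} (hh : 0 ≤ h)
    (hM : ∀ z ∈ Icc y (y + r * h), |G r z| ≤ M) : |(fwdDiff h)^[r] (G 0) y| ≤ h ^ r * M := by
  induction r generalizing G M with
  | zero => simpa using hM y (by simp)
  | succ r ih =>
    rw [Function.iterate_succ_apply]
    have hstep := ih (fun j z => G j (z + h) - G j z) (M := h * M)
      (fun j hj z => ((hG j (by omega) (z + h)).comp_add_const z h).sub (hG j (by omega) z)) ?_
    · calc _ ≤ h ^ r * (h * M) := hstep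
        _ = _ := by ring
    · intro z hz
      have hmv := (convex_Icc z (z + h)).norm_image_sub_le_of_norm_hasDerivWithin_le
        (f := G r) (f' := G (r + 1)) (C := M)
        (fun w _ => (hG r (by omega) w).hasDerivWithinAt) (fun w hw => by
          refine hM w ⟨hz.1.trans hw.1, hw.2.trans ?_⟩
          push_cast
          nlinarith [hz.2])
        (left_mem_Icc.2 (by linarith)) (right_mem_Icc.2 (by linarith))
      simp only [Real.norm_eq_abs] at hmv
      rw [add_sub_cancel_left, abs_of_nonneg hh] at hmv
      linarith

/-- Taylor's theorem for a chain of derivatives, on either side of the base point. -/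
lemma abs_taylor_remainder_le (r : ℕ) (G : ℕ → ℝ → ℝ)
    (hG : ∀ j < r, ∀ z, HasDerivAt (G j) (G (j + 1) z) z) {x y M : ℝ}
    (hM : ∀ z ∈ uIcc x y, |G r z| ≤ M) :
    |G 0 y - ∑ j ∈ Finset.range r, G j x / j.factorial * (y - x) ^ j| ≤ M * |y - x| ^ r := by
  induction r generalizing G y with
  | zero => simpa using hM y right_mem_uIcc
  | succ r ih =>
    have hM0 : 0 ≤ M := (abs_nonneg _).trans (hM x left_mem_uIcc)
    have hder : ∀ z, HasDerivAt
        (fun z => G 0 z - ∑ j ∈ Finset.range (r + 1), G j x / j.factorial * (z - x) ^ j)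
        (G 1 z - ∑ j ∈ Finset.range r, G (j + 1) x / j.factorial * (z - x) ^ j) z := by
      intro z
      refine (hG 0 (by omega) z).sub ?_
      have h1 : HasDerivAt
          (fun z => ∑ j ∈ Finset.range (r + 1), G j x / j.factorial * (z - x) ^ j)
          (∑ j ∈ Finset.range (r + 1), G j x / j.factorial * (j * (z - x) ^ (j - 1))) z := by
        refine HasDerivAt.fun_sum fun j _ => ?_
        have := (((hasDerivAt_id z).sub_const x).pow j).const_mul (G j x / j.factorial)
        simpa using this
      refine h1.congr_deriv ?_
      rw [Finset.sum_range_succ']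
      simp only [Nat.cast_zero, zero_mul, mul_zero, add_zero, Nat.add_sub_cancel]
      refine Finset.sum_congr rfl fun j _ => ?_
      rw [Nat.factorial_succ]
      push_cast
      field_simp
    have hmv := (convex_uIcc x y).norm_image_sub_le_of_norm_hasDerivWithin_le
      (C := M * |y - x| ^ r) (fun w _ => (hder w).hasDerivWithinAt) (fun w hw => by
        have hsub : uIcc x w ⊆ uIcc x y := uIcc_subset_uIcc left_mem_uIcc hw
        have h2 := ih (fun j => G (j + 1)) (y := w) (fun j hj z => hG (j + 1) (by omega) z)
          (fun z hz => hM z (hsub hz))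
        refine h2.trans ?_
        have h3 : |w - x| ≤ |y - x| := by
          rcases le_total x y with hxy | hxy
          · rw [uIcc_of_le hxy] at hw
            rw [abs_of_nonneg (by linarith [hw.1]), abs_of_nonneg (by linarith)]
            linarith [hw.2]
          · rw [uIcc_of_ge hxy] at hw
            rw [abs_of_nonpos (by linarith [hw.2]), abs_of_nonpos (by linarith)]
            linarith [hw.1]
        gcongr) left_mem_uIcc right_mem_uIcc
    simp only [Real.norm_eq_abs] at hmv
    have hx0 : G 0 x - ∑ j ∈ Finset.range (r + 1), G j x / j.factorial * (x - x) ^ j = 0 := by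
      rw [Finset.sum_range_succ']
      simp
    rw [hx0, sub_zero] at hmv
    calc _ ≤ M * |y - x| ^ r * |y - x| := hmv
      _ = _ := by ring

section Polynomials

open Polynomial

lemma hasDerivAt_iterate_derivative (P : ℝ[X]) (j : ℕ) (z : ℝ) :
    HasDerivAt (fun y => (derivative^[j] P).eval y) ((derivative^[j + 1] P).eval z) z := by
  rw [Function.iterate_succ_apply']
  exact (derivative^[j] P).hasDerivAt z

/-- The polynomial `∑_{j<r} a_j / j! (X - x)^j`. -/
noncomputable def taylorPoly (r : ℕ) (a : ℕ → ℝ) (x : ℝ) : ℝ[X] :=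
  ∑ j ∈ Finset.range r, C (a j / j.factorial) * (X - C x) ^ j

lemma eval_taylorPoly (r : ℕ) (a : ℕ → ℝ) (x y : ℝ) :
    (taylorPoly r a x).eval y = ∑ j ∈ Finset.range r, a j / j.factorial * (y - x) ^ j := by
  simp [taylorPoly, eval_finsetSum]

lemma natDegree_taylorPoly_lt {r : ℕ} (hr : 1 ≤ r) (a : ℕ → ℝ) (x : ℝ) :
    (taylorPoly r a x).natDegree < r := by
  refine lt_of_le_of_lt (natDegree_sum_le_of_forall_le _ _ (n := r - 1) fun j hj => ?_) (by omega)
  refine (natDegree_C_mul_le _ _).trans ((natDegree_pow_le).trans ?_)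
  have := Finset.mem_range.1 hj
  rw [natDegree_X_sub_C, mul_one]
  omega

/-! ### The modification at the endpoints -/

lemma leftInterp_sub (r n : ℕ) (f g : ℝ → ℝ) (x : ℝ) :
    leftInterp r n (fun t => f t - g t) x = leftInterp r n f x - leftInterp r n g x := by
  unfold leftInterp
  rw [← eval_sub, ← map_sub]
  rfl

lemma injOn_nodes {r n : ℕ} (hn : 1 ≤ n) :
    Set.InjOn (fun i : ℕ => (i : ℝ) / n) (Finset.Icc 1 r : Finset ℕ) := by
  intro i _ j _ hij
  have hn0 : (n : ℝ) ≠ 0 := by positivity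
  have : (i : ℝ) = j := by
    simpa [div_left_inj' hn0] using hij
  exact_mod_cast this

lemma leftInterp_eval {r n : ℕ} (hn : 1 ≤ n) {P : ℝ[X]} (hP : P.natDegree < r)
    (x : ℝ) : leftInterp r n (fun t => P.eval t) x = P.eval x := by
  unfold leftInterp
  have hdeg : P.degree < (Finset.Icc 1 r).card := by
    rw [Nat.card_Icc, Nat.add_sub_cancel]
    exact lt_of_le_of_lt degree_le_natDegree (by exact_mod_cast hP)
  rw [← Lagrange.eq_interpolate (injOn_nodes hn) hdeg]

lemma eval_basis {r : ℕ} (v : ℕ → ℝ) (i : ℕ) (x : ℝ) :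
    (Lagrange.basis (Finset.Icc 1 r) v i).eval x =
      ∏ j ∈ (Finset.Icc 1 r).erase i, (v i - v j)⁻¹ * (x - v j) := by
  rw [Lagrange.basis, eval_prod]
  refine Finset.prod_congr rfl fun j _ => ?_
  simp [Lagrange.basisDivisor]

lemma rightInterp_eq (r n : ℕ) (f : ℝ → ℝ) (x : ℝ) :
    rightInterp r n f x = leftInterp r n (fun t => f (1 - t)) (1 - x) := by
  unfold rightInterp leftInterp
  rw [Lagrange.interpolate_apply, Lagrange.interpolate_apply, eval_finsetSum, eval_finsetSum]
  refine Finset.sum_congr rfl fun i _ => ?_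
  rw [eval_mul, eval_mul, eval_basis, eval_basis, eval_C, eval_C]
  congr 1
  refine Finset.prod_congr rfl fun j _ => ?_
  rw [show 1 - (i : ℝ) / n - (1 - j / n) = -(i / n - j / n) by ring,
    show x - (1 - (j : ℝ) / n) = -(1 - x - j / n) by ring, inv_neg, neg_mul_neg]

lemma exists_abs_leftInterp_le (r : ℕ) : ∃ c : ℝ, 1 ≤ c ∧ ∀ (n : ℕ) (f : ℝ → ℝ) (B x : ℝ), 1 ≤ n →
    0 ≤ B → (∀ i ∈ Finset.Icc 1 r, |f ((i : ℝ) / n)| ≤ B) → 0 ≤ x → x ≤ 2 / n →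
    |leftInterp r n f x| ≤ c * B := by
  refine ⟨1 + r * (r + 2) ^ r, by simp; positivity, fun n f B x hn hB hf hx0 hx => ?_⟩
  have hn0 : (0 : ℝ) < n := by positivity
  have hb : ∀ i ∈ Finset.Icc 1 r, |(Lagrange.basis (Finset.Icc 1 r)
      (fun i : ℕ => (i : ℝ) / n) i).eval x| ≤ ((r : ℝ) + 2) ^ r := by
    intro i hi
    rw [eval_basis, Finset.abs_prod]
    have h1 : ∀ j ∈ (Finset.Icc 1 r).erase i,
        |((i : ℝ) / n - j / n)⁻¹ * (x - j / n)| ≤ (r : ℝ) + 2 := by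
      intro j hj
      obtain ⟨hne, hj'⟩ := Finset.mem_erase.1 hj
      have hjr : (j : ℝ) ≤ r := by exact_mod_cast (Finset.mem_Icc.1 hj').2
      have hij : (1 : ℝ) ≤ |(i : ℝ) - j| := by
        have : (1 : ℤ) ≤ |(i : ℤ) - j| := Int.one_le_abs (by omega)
        exact_mod_cast this
      have hij0 : (i : ℝ) - j ≠ 0 := by
        intro h
        rw [h, abs_zero] at hij
        linarith
      have e : ((i : ℝ) / n - j / n)⁻¹ * (x - j / n) = (n * x - j) / (i - j) := by
        field_simp
      rw [e, abs_div, div_le_iff₀ (by linarith)]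
      have h2 : |(n : ℝ) * x - j| ≤ r + 2 := by
        have h3 : (n : ℝ) * x ≤ 2 := by
          rw [le_div_iff₀ hn0] at hx
          linarith
        have h4 : 0 ≤ (n : ℝ) * x := by positivity
        have h5 : (0 : ℝ) ≤ j := Nat.cast_nonneg j
        rw [abs_le]
        constructor <;> linarith
      nlinarith [(Nat.cast_nonneg r : (0 : ℝ) ≤ r)]
    have h0r : (0 : ℝ) ≤ r := Nat.cast_nonneg r
    calc _ ≤ ∏ j ∈ (Finset.Icc 1 r).erase i, ((r : ℝ) + 2) :=
          Finset.prod_le_prod (fun j _ => abs_nonneg _) h1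
      _ = ((r : ℝ) + 2) ^ ((Finset.Icc 1 r).erase i).card := by rw [Finset.prod_const]
      _ ≤ _ := by
        refine pow_le_pow_right₀ (by linarith) ?_
        refine (Finset.card_le_card (Finset.erase_subset _ _)).trans ?_
        simp
  unfold leftInterp
  rw [Lagrange.interpolate_apply, eval_finsetSum]
  calc _ ≤ ∑ i ∈ Finset.Icc 1 r, B * ((r : ℝ) + 2) ^ r := by
        refine (Finset.abs_sum_le_sum_abs _ _).trans (Finset.sum_le_sum fun i hi => ?_)
        rw [eval_mul, eval_C, abs_mul]
        exact mul_le_mul (hf i hi) (hb i hi) (abs_nonneg _) hB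
    _ = r * (B * ((r : ℝ) + 2) ^ r) := by simp
    _ ≤ _ := by nlinarith

variable {r : ℕ} {ψ : ℝ → ℝ}

lemma modified_of_le (hψ : IsCutoff r ψ) {n : ℕ} (hn : 5 ≤ n) (f : ℝ → ℝ) {y : ℝ}
    (hy : y ≤ 1 - 2 / n) : modified ψ r n f y =
      (1 - ψ (n * y - 1)) * leftInterp r n f y + ψ (n * y - 1) * f y := by
  have hn0 : (0 : ℝ) < n := by positivity
  unfold modified
  split_ifs with h1 h2
  · rw [le_div_iff₀ hn0] at h1
    rw [hψ.eq_zero _ (by linarith)]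
    ring
  · rfl
  · push Not at h2
    rw [div_le_iff₀ hn0] at h2
    rw [hψ.eq_one _ (by linarith)]
    ring

lemma modified_of_ge (hψ : IsCutoff r ψ) {n : ℕ} (hn : 5 ≤ n) (f : ℝ → ℝ) {y : ℝ}
    (hy : 2 / n ≤ y) : modified ψ r n f y =
      (1 - ψ (n * (1 - y) - 1)) * rightInterp r n f y + ψ (n * (1 - y) - 1) * f y := by
  have hn0 : (0 : ℝ) < n := by positivity
  have h12 : 1 / (n : ℝ) < 2 / n := by gcongr; norm_num
  unfold modified
  rw [if_neg (by linarith), if_neg (by linarith)]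
  split_ifs with h1 h2
  · have : 2 / (n : ℝ) ≤ 1 - y := by linarith
    rw [div_le_iff₀ hn0] at this
    rw [hψ.eq_one _ (by linarith)]
    ring
  · rfl
  · have : 1 - y ≤ 1 / (n : ℝ) := by linarith
    rw [le_div_iff₀ hn0] at this
    rw [hψ.eq_zero _ (by linarith)]
    ring

lemma modified_of_mem (hψ : IsCutoff r ψ) {n : ℕ} (hn : 5 ≤ n) (f : ℝ → ℝ) {y : ℝ}
    (hy1 : 2 / n ≤ y) (hy2 : y ≤ 1 - 2 / n) : modified ψ r n f y = f y := by
  have hn0 : (0 : ℝ) < n := by positivity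
  rw [modified_of_le hψ hn f hy2, hψ.eq_one]
  · ring
  · rw [div_le_iff₀ hn0] at hy1
    linarith

lemma two_div_le {n : ℕ} (hn : 5 ≤ n) : 2 / (n : ℝ) ≤ 2 / 5 := by
  have : (5 : ℝ) ≤ n := by exact_mod_cast hn
  gcongr

lemma modified_reflect (hψ : IsCutoff r ψ) {n : ℕ} (hn : 5 ≤ n) (f : ℝ → ℝ) (y : ℝ) :
    modified ψ r n (fun t => f (1 - t)) y = modified ψ r n f (1 - y) := by
  have h2 := two_div_le hn
  rcases le_or_gt y (1 - 2 / n) with hy | hy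
  · rw [modified_of_le hψ hn _ hy, modified_of_ge hψ hn f (by linarith), rightInterp_eq]
    simp only [sub_sub_cancel]
  · rw [modified_of_ge hψ hn _ (by linarith), modified_of_le hψ hn f (by linarith), rightInterp_eq]
    simp only [sub_sub_cancel]

lemma modified_sub (n : ℕ) (f g : ℝ → ℝ) (y : ℝ) :
    modified ψ r n (fun t => f t - g t) y = modified ψ r n f y - modified ψ r n g y := by
  have hR : rightInterp r n (fun t => f t - g t) y = rightInterp r n f y - rightInterp r n g y := by
    simp only [rightInterp_eq]
    exact leftInterp_sub r n (fun t => f (1 - t)) (fun t => g (1 - t)) (1 - y)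
  unfold modified
  rw [leftInterp_sub, hR]
  split_ifs <;> ring

lemma modified_eval {n : ℕ} (hn : 1 ≤ n) {P : ℝ[X]} (hP : P.natDegree < r)
    (y : ℝ) : modified ψ r n (fun t => P.eval t) y = P.eval y := by
  have hR : rightInterp r n (fun t => P.eval t) y = P.eval y := by
    rw [rightInterp_eq]
    have h1 : (P.comp (1 - X)).natDegree < r := by
      refine lt_of_le_of_lt natDegree_comp_le ?_
      have : (1 - X : ℝ[X]).natDegree = 1 := by
        rw [show (1 - X : ℝ[X]) = -(X - C 1) by simp, natDegree_neg, natDegree_X_sub_C]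
      rw [this, mul_one]
      exact hP
    have h2 := leftInterp_eval hn h1 (1 - y)
    simpa [eval_comp] using h2
  unfold modified
  rw [leftInterp_eval hn hP, hR]
  split_ifs <;> ring

/-- On the left part the modified function is controlled by the function at the interpolation
nodes, if the point is near the end, and by its value at the point. -/
lemma exists_abs_modified_le (hr : 1 ≤ r) (hψ : IsCutoff r ψ) : ∃ c : ℝ, 1 ≤ c ∧
    ∀ (n : ℕ) (f : ℝ → ℝ) (B y : ℝ), 5 ≤ n → 0 ≤ y → y ≤ 1 - 2 / n →
    (y < 2 / n → ∀ i ∈ Finset.Icc 1 r, |f ((i : ℝ) / n)| ≤ B) → (1 / n < y → |f y| ≤ B) →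
    |modified ψ r n f y| ≤ c * B := by
  obtain ⟨c, hc, h⟩ := exists_abs_leftInterp_le r
  refine ⟨c, hc, fun n f B y hn hy0 hy hB1 hB2 => ?_⟩
  have hn0 : (0 : ℝ) < n := by positivity
  have hθ := hψ.mem_Icc (n * y - 1)
  rw [modified_of_le hψ hn f hy]
  rcases lt_or_ge y (2 / n) with h1 | h1
  · have hB0 : 0 ≤ B := (abs_nonneg _).trans (hB1 h1 1 (Finset.mem_Icc.2 ⟨le_rfl, hr⟩))
    have hL := h n f B y (by omega) hB0 (hB1 h1) hy0 h1.le
    rcases le_or_gt y (1 / n) with h2 | h2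
    · rw [le_div_iff₀ hn0] at h2
      rw [hψ.eq_zero _ (by linarith)]
      simpa using hL
    · have hf := hB2 h2
      have hf' : |f y| ≤ c * B := hf.trans (le_mul_of_one_le_left hB0 hc)
      refine (abs_add_le _ _).trans ?_
      rw [abs_mul, abs_mul, abs_of_nonneg hθ.1, abs_of_nonneg (by linarith [hθ.2])]
      have e1 := mul_le_mul_of_nonneg_left hL (by linarith [hθ.2] : 0 ≤ 1 - ψ (n * y - 1))
      have e2 := mul_le_mul_of_nonneg_left hf' hθ.1
      linarith
  · have h12 : 1 / (n : ℝ) < y := lt_of_lt_of_le (by gcongr; norm_num) h1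
    have hf := hB2 h12
    have hB0 : 0 ≤ B := (abs_nonneg _).trans hf
    rw [div_le_iff₀ hn0] at h1
    rw [hψ.eq_one _ (by linarith)]
    simpa using hf.trans (le_mul_of_one_le_left hB0 hc)

end Polynomials

/-! ### Weighted estimates for the modified combinations -/

lemma exists_sum_bern_scaled_le (p q : ℝ) (j : ℕ) : ∃ C : ℝ, 0 < C ∧ ∀ (N : ℕ) (x : ℝ), 1 ≤ N →
    x ∈ Icc (0 : ℝ) 1 →
    ∑ k ∈ Finset.range (N + 1), bern N k x *
        ((((k : ℝ) + 1) / N) ^ p * ((((N - k : ℕ) : ℝ) + 1) / N) ^ q * (1 + dev N k x) ^ j) ≤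
      C * ((x + 1 / N) ^ p * (1 - x + 1 / N) ^ q) := by
  obtain ⟨C, hC, h⟩ := exists_sum_bern_weight_le p q j
  refine ⟨C, hC, fun N x hN hx => ?_⟩
  have hN0 : (0 : ℝ) < N := by positivity
  have hx1 : 0 ≤ 1 - x := by linarith [hx.2]
  have hx0 := hx.1
  have e1 : x + 1 / N = (N * x + 1) / N := by field_simp
  have e2 : 1 - x + 1 / N = (N * (1 - x) + 1) / N := by field_simp
  rw [e1, e2, Real.div_rpow (by positivity) hN0.le, Real.div_rpow (by positivity) hN0.le]
  have hpt : ∀ k ∈ Finset.range (N + 1), bern N k x *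
        ((((k : ℝ) + 1) / N) ^ p * ((((N - k : ℕ) : ℝ) + 1) / N) ^ q * (1 + dev N k x) ^ j) =
      ((N : ℝ) ^ p * (N : ℝ) ^ q)⁻¹ * (bern N k x *
        (((k : ℝ) + 1) ^ p * (((N - k : ℕ) : ℝ) + 1) ^ q * (1 + dev N k x) ^ j)) := by
    intro k _
    rw [Real.div_rpow (by positivity) hN0.le, Real.div_rpow (by positivity) hN0.le]
    field_simp
  rw [Finset.sum_congr rfl hpt, ← Finset.mul_sum]
  have h1 := mul_le_mul_of_nonneg_left (h N x hx)
    (show 0 ≤ ((N : ℝ) ^ p * (N : ℝ) ^ q)⁻¹ by positivity)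
  refine h1.trans (le_of_eq ?_)
  field_simp

lemma rpow_le_of_nonpos_ratio {Y z c p : ℝ} (hY : 0 < Y) (hc : 0 < c) (h : Y ≤ c * z)
    (hp : p ≤ 0) : z ^ p ≤ c ^ (-p) * Y ^ p := by
  have h3 : Y / c ≤ z := by rw [div_le_iff₀ hc]; linarith
  calc z ^ p ≤ (Y / c) ^ p := Real.rpow_le_rpow_of_nonpos (by positivity) h3 hp
    _ = _ := by
      rw [Real.div_rpow hY.le hc.le, Real.rpow_neg hc.le]
      field_simp

lemma abs_forwardDiff_reflect (r : ℕ) (f : ℝ → ℝ) (h x : ℝ) :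
    |forwardDiff r (fun t => f (1 - t)) h (1 - x - r * h)| = |forwardDiff r f h x| := by
  have h1 := abs_centralDiff_reflect r f h (x + r / 2 * h)
  rw [centralDiff_eq_forwardDiff, centralDiff_eq_forwardDiff] at h1
  rw [← show x + r / 2 * h - r / 2 * h = x by ring, ← h1]
  congr 2
  ring

lemma fwdDiff_iter_node (r N k : ℕ) (F : ℝ → ℝ) :
    (fwdDiff 1)^[r] (fun k : ℕ => F ((k : ℝ) / N)) k = forwardDiff r F (1 / N) (k / N) := by
  rw [forwardDiff_eq_iterate, fwdDiff_iter_eq_sum_shift, fwdDiff_iter_eq_sum_shift]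
  refine Finset.sum_congr rfl fun j _ => ?_
  simp only [nsmul_eq_mul]
  congr 2
  push_cast
  ring

section Modified

open Polynomial

variable {r : ℕ} {ψ : ℝ → ℝ}

lemma exists_abs_modified_node_le_left (hr : 1 ≤ r) (hψ : IsCutoff r ψ) (p q K : ℝ) (hK : 1 ≤ K) :
    ∃ C : ℝ, 0 < C ∧ ∀ (n N : ℕ) (h : ℝ → ℝ) (M : ℝ), 5 + 2 * r ≤ n → n ≤ N → (N : ℝ) ≤ K * n →
    0 ≤ M → (∀ y ∈ Icc (1 / (n : ℝ)) (1 - 1 / n), |h y| ≤ M * (y ^ p * (1 - y) ^ q)) →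
    ∀ k ≤ N, (k : ℝ) / N ≤ 1 / 2 → |modified ψ r n h ((k : ℝ) / N)| ≤
      C * (M * ((((k : ℝ) + 1) / N) ^ p * ((((N - k : ℕ) : ℝ) + 1) / N) ^ q)) := by
  obtain ⟨c, hc, hmod⟩ := exists_abs_modified_le hr hψ
  set R : ℝ := 4 + r * K with hR
  have hr0 : (0 : ℝ) ≤ r := Nat.cast_nonneg r
  have hrK : (r : ℝ) ≤ r * K := le_mul_of_one_le_right hr0 hK
  have hR1 : 1 ≤ R := by linarith
  refine ⟨c * (R ^ |p| * R ^ |q|), by positivity, fun n N h M hn hnN hNK hM hh k hk hk2 => ?_⟩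
  have hn0 : (0 : ℝ) < n := by
    have : 0 < n := by omega
    exact_mod_cast this
  have hnN' : (n : ℝ) ≤ N := by exact_mod_cast hnN
  have hN0 : (0 : ℝ) < N := by linarith
  have hnr : 5 + 2 * (r : ℝ) ≤ n := by exact_mod_cast hn
  have hY' : (((N - k : ℕ) : ℝ) + 1) / N = 1 - k / N + 1 / N := by
    rw [Nat.cast_sub hk]
    field_simp
  have hY : ((k : ℝ) + 1) / N = k / N + 1 / N := by rw [add_div]
  set y := (k : ℝ) / N with hy
  have hy0 : 0 ≤ y := by positivity
  rw [hY', hY]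
  have hNn : 1 / (N : ℝ) ≤ 1 / n := one_div_le_one_div_of_le hn0 hnN'
  have hNpos : 0 < 1 / (N : ℝ) := by positivity
  have hn5 : 1 / (n : ℝ) ≤ 1 / 5 := one_div_le_one_div_of_le (by norm_num) (by linarith)
  have hnK : 1 / (n : ℝ) ≤ K * (1 / N) := by
    rw [mul_one_div, div_le_div_iff₀ hn0 hN0]
    linarith
  have h2n : 2 / (n : ℝ) = 2 * (1 / n) := by ring
  have key : ∀ z, z ∈ Icc (1 / (n : ℝ)) (1 - 1 / n) → z ≤ 1 / 2 → z ≤ R * (y + 1 / N) →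
      y + 1 / N ≤ R * z →
      |h z| ≤ R ^ |p| * R ^ |q| * (M * ((y + 1 / N) ^ p * (1 - y + 1 / N) ^ q)) := by
    intro z hz hz2 h1 h2
    refine (hh z hz).trans ?_
    have hz0 : 0 < z := lt_of_lt_of_le (by positivity) hz.1
    have e1 := rpow_le_of_ratio (A := z) (B := y + 1 / N) hz0 (by positivity) hR1 h1 h2 p
    have e2 := rpow_le_of_ratio (A := 1 - z) (B := 1 - y + 1 / N) (by linarith) (by linarith)
      hR1 (by nlinarith) (by nlinarith) q
    have hz1 : 0 ≤ 1 - z := by linarith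
    have hy1 : 0 ≤ 1 - y + 1 / N := by linarith
    calc M * (z ^ p * (1 - z) ^ q) ≤
          M * ((R ^ |p| * (y + 1 / N) ^ p) * (R ^ |q| * (1 - y + 1 / N) ^ q)) := by gcongr
      _ = _ := by ring
  have hB := hmod n h (R ^ |p| * R ^ |q| * (M * ((y + 1 / N) ^ p * (1 - y + 1 / N) ^ q))) y
    (by omega) hy0 (by linarith) ?_ ?_
  · refine hB.trans (le_of_eq (by ring))
  · intro hy2 i hi
    obtain ⟨hi1, hi2⟩ := Finset.mem_Icc.1 hi
    have hi1' : (1 : ℝ) ≤ i := by exact_mod_cast hi1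
    have hi2' : (i : ℝ) ≤ r := by exact_mod_cast hi2
    have f1 : 1 / (n : ℝ) ≤ i / n := by gcongr
    have f2 : (i : ℝ) / n ≤ 1 / 2 := by
      rw [div_le_iff₀ hn0]
      linarith
    refine key _ ⟨f1, by linarith⟩ f2 ?_ ?_
    · have : (i : ℝ) / n ≤ r * K * (1 / N) := by
        rw [div_eq_mul_one_div, mul_assoc]
        gcongr
      nlinarith
    · nlinarith
  · intro hy1
    refine key y ⟨hy1.le, by linarith⟩ hk2 ?_ ?_
    · nlinarith
    · nlinarith

/-- A Jacobi-weight bound away from the ends passes to the nodal values of the modification. -/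
lemma exists_abs_modified_node_le (hr : 1 ≤ r) (hψ : IsCutoff r ψ) (p q K : ℝ) (hK : 1 ≤ K) :
    ∃ C : ℝ, 0 < C ∧ ∀ (n N : ℕ) (h : ℝ → ℝ) (M : ℝ), 5 + 2 * r ≤ n → n ≤ N → (N : ℝ) ≤ K * n →
    0 ≤ M → (∀ y ∈ Icc (1 / (n : ℝ)) (1 - 1 / n), |h y| ≤ M * (y ^ p * (1 - y) ^ q)) →
    ∀ k ≤ N, |modified ψ r n h ((k : ℝ) / N)| ≤
      C * (M * ((((k : ℝ) + 1) / N) ^ p * ((((N - k : ℕ) : ℝ) + 1) / N) ^ q)) := by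
  obtain ⟨C₁, hC₁, h₁⟩ := exists_abs_modified_node_le_left hr hψ p q K hK
  obtain ⟨C₂, hC₂, h₂⟩ := exists_abs_modified_node_le_left hr hψ q p K hK
  refine ⟨C₁ + C₂, by positivity, fun n N h M hn hnN hNK hM hh k hk => ?_⟩
  have hN0 : (0 : ℝ) < N := by
    have : 0 < N := by omega
    exact_mod_cast this
  have hpos : 0 ≤ M * ((((k : ℝ) + 1) / N) ^ p * ((((N - k : ℕ) : ℝ) + 1) / N) ^ q) := by
    positivity
  rcases le_total ((k : ℝ) / N) (1 / 2) with h2 | h2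
  · refine (h₁ n N h M hn hnN hNK hM hh k hk h2).trans ?_
    nlinarith
  · have e : 1 - (k : ℝ) / N = ((N - k : ℕ) : ℝ) / N := by
      rw [Nat.cast_sub hk]
      field_simp
    have h3 := h₂ n N (fun t => h (1 - t)) M hn hnN hNK hM (fun y hy => by
      have := hh (1 - y) ⟨by linarith [hy.2], by linarith [hy.1]⟩
      rw [sub_sub_cancel] at this
      rwa [mul_comm (y ^ q)]) (N - k) (Nat.sub_le _ _) (by rw [← e]; linarith)
    rw [← e, modified_reflect hψ (by omega), sub_sub_cancel, Nat.sub_sub_self hk,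
      mul_comm (_ ^ q)] at h3
    refine h3.trans ?_
    nlinarith

lemma forwardDiff_taylorPoly (hr : 1 ≤ r) (a : ℕ → ℝ) (x h y : ℝ) (hh : 0 ≤ h) :
    (fwdDiff h)^[r] (fun t => (taylorPoly r a x).eval t) y = 0 := by
  have h0 : derivative^[r] (taylorPoly r a x) = 0 :=
    iterate_derivative_eq_zero (natDegree_taylorPoly_lt hr a x)
  have := abs_fwdDiff_iter_le_of_chain r (fun j z => (derivative^[j] (taylorPoly r a x)).eval z)
    (fun j _ z => hasDerivAt_iterate_derivative _ j z) (h := h) (y := y) (M := 0) hh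
    (fun z _ => by simp [h0])
  rw [mul_zero] at this
  simpa using this

/-- Near the left end, differences of the modification only see the function away from `0`:
the modification differs by a Taylor polynomial from the modification of the remainder. -/
lemma exists_forwardDiff_modified_le_left (hr : 1 ≤ r) (hψ : IsCutoff r ψ) {p q K : ℝ} (hK : 1 ≤ K)
    (hp : p ≤ 0) (hq : q ≤ 0) :
    ∃ C : ℝ, 0 < C ∧ ∀ (n N : ℕ) (G : ℕ → ℝ → ℝ) (M : ℝ), 5 + 2 * r ≤ n → n ≤ N →
    (N : ℝ) ≤ K * n → 0 ≤ M → (∀ j < r, ∀ z, HasDerivAt (G j) (G (j + 1) z) z) →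
    (∀ y ∈ Ioo (0 : ℝ) 1, |G r y| ≤ M * (y ^ p * (1 - y) ^ q)) →
    ∀ k ≤ N - r, (k : ℝ) / N < 2 / n → |forwardDiff r (modified ψ r n (G 0)) (1 / N) (k / N)| ≤
      C * (M * (1 / (N : ℝ)) ^ r * ((((k : ℝ) + 1) / (N - r : ℕ)) ^ p *
        ((((N - r - k : ℕ) : ℝ) + 1) / (N - r : ℕ)) ^ q)) := by
  obtain ⟨c, hc, hmod⟩ := exists_abs_modified_le hr hψ
  refine ⟨2 ^ r * (c * (((r + 2) * K) ^ r * (6 ^ (-p) * 4 ^ (-q)))), by positivity,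
    fun n N G M hn hnN hNK hM hG hGr k hk hk2 => ?_⟩
  have hr0 : (0 : ℝ) ≤ r := Nat.cast_nonneg r
  have hn0 : (0 : ℝ) < n := by
    have : 0 < n := by omega
    exact_mod_cast this
  have hnN' : (n : ℝ) ≤ N := by exact_mod_cast hnN
  have hN0 : (0 : ℝ) < N := by linarith
  have hnr : 5 + 2 * (r : ℝ) ≤ n := by exact_mod_cast hn
  have hNr : ((N - r : ℕ) : ℝ) = N - r := Nat.cast_sub (by omega)
  have hNr2 : (N : ℝ) / 2 ≤ ((N - r : ℕ) : ℝ) := by rw [hNr]; linarith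
  have hNr0 : (0 : ℝ) < ((N - r : ℕ) : ℝ) := by linarith
  have hrn : ((r : ℝ) + 2) / n ≤ 1 / 2 := by rw [div_le_iff₀ hn0]; linarith
  have hNn : 1 / (N : ℝ) ≤ 1 / n := one_div_le_one_div_of_le hn0 hnN'
  have h1n : 0 < 1 / (n : ℝ) := by positivity
  have hr2n : ((r : ℝ) + 2) / n = r * (1 / n) + 2 * (1 / n) := by ring
  have h2n : 2 / (n : ℝ) = 2 * (1 / n) := by ring
  have hn5 : 1 / (n : ℝ) ≤ 1 / 5 := one_div_le_one_div_of_le (by norm_num) (by linarith)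
  set M' := M * ((1 / (n : ℝ)) ^ p * (1 / 2 : ℝ) ^ q) with hM'
  have hM'0 : 0 ≤ M' := by positivity
  set T := taylorPoly r (fun j => G j (1 / n)) (1 / n) with hT
  set B := M' * (((r : ℝ) + 2) / n) ^ r with hB
  have hrem : ∀ y, 1 / (n : ℝ) ≤ y → y ≤ ((r : ℝ) + 2) / n → |G 0 y - T.eval y| ≤ B := by
    intro y hy1 hy2
    rw [hT, eval_taylorPoly]
    refine (abs_taylor_remainder_le r G hG (M := M') fun z hz => ?_).trans ?_
    · rw [uIcc_of_le hy1] at hz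
      have hz0 : 0 < z := lt_of_lt_of_le h1n hz.1
      have hz1 : z ≤ 1 / 2 := hz.2.trans (hy2.trans hrn)
      refine (hGr z ⟨hz0, by linarith⟩).trans ?_
      have e1 := Real.rpow_le_rpow_of_nonpos h1n hz.1 hp
      have e2 : (1 - z) ^ q ≤ (1 / 2 : ℝ) ^ q :=
        Real.rpow_le_rpow_of_nonpos (by norm_num) (by linarith) hq
      have : 0 ≤ (1 - z) ^ q := Real.rpow_nonneg (by linarith) _
      rw [hM']
      gcongr
    · rw [hB, abs_of_nonneg (by linarith)]
      gcongr
      linarith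
  have hval : ∀ j ≤ r, |modified ψ r n (fun t => G 0 t - T.eval t) (k / N + j • (1 / (N : ℝ)))| ≤
      c * B := by
    intro j hj
    have hj' : (j : ℝ) ≤ r := by exact_mod_cast hj
    have hjn : (j : ℝ) * (1 / N) ≤ r * (1 / n) := by gcongr
    have hy0 : 0 ≤ (k : ℝ) / N + j • (1 / (N : ℝ)) := by
      rw [nsmul_eq_mul]
      positivity
    rw [nsmul_eq_mul] at hy0 ⊢
    refine hmod n _ B _ (by omega) hy0 (by linarith) (fun _ i hi => ?_) (fun h1 => ?_)
    · obtain ⟨hi1, hi2⟩ := Finset.mem_Icc.1 hi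
      have hi1' : (1 : ℝ) ≤ i := by exact_mod_cast hi1
      have hi2' : (i : ℝ) ≤ r := by exact_mod_cast hi2
      exact hrem _ (by gcongr) (by gcongr; linarith)
    · exact hrem _ h1.le (by linarith)
  have hsplit : modified ψ r n (G 0) =
      modified ψ r n (fun t => G 0 t - T.eval t) + fun t => T.eval t := by
    funext y
    rw [Pi.add_apply, modified_sub, modified_eval (by omega) (natDegree_taylorPoly_lt hr _ _)]
    ring
  have hdiff : forwardDiff r (modified ψ r n (G 0)) (1 / N) (k / N) =
      (fwdDiff (1 / (N : ℝ)))^[r] (modified ψ r n (fun t => G 0 t - T.eval t)) (k / N) := by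
    rw [forwardDiff_eq_iterate, hsplit, fwdDiff_iter_add, Pi.add_apply,
      forwardDiff_taylorPoly hr _ _ _ _ (by positivity), add_zero]
  rw [hdiff]
  refine (abs_fwdDiff_iter_le_two_pow _ r _ _ hval).trans ?_
  have e1 : (1 / (n : ℝ)) ^ p ≤ 6 ^ (-p) * (((k : ℝ) + 1) / (N - r : ℕ)) ^ p := by
    refine rpow_le_of_nonpos_ratio (by positivity) (by norm_num) ?_ hp
    have : ((k : ℝ) + 1) / (N - r : ℕ) ≤ ((k : ℝ) + 1) / (N / 2) := by gcongr
    have e : ((k : ℝ) + 1) / (N / 2) = 2 * (k / N) + 2 * (1 / N) := by field_simp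
    linarith
  have e2 : (1 / 2 : ℝ) ^ q ≤ 4 ^ (-q) * ((((N - r - k : ℕ) : ℝ) + 1) / (N - r : ℕ)) ^ q := by
    refine rpow_le_of_nonpos_ratio (by positivity) (by norm_num) ?_ hq
    rw [div_le_iff₀ hNr0, Nat.cast_sub hk]
    have : (1 : ℝ) ≤ ((N - r : ℕ) : ℝ) := by linarith
    have : (0 : ℝ) ≤ k := Nat.cast_nonneg k
    linarith
  have e3 : ((r : ℝ) + 2) / n ≤ (r + 2) * K * (1 / N) := by
    rw [mul_one_div, div_le_div_iff₀ hn0 hN0, mul_assoc]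
    gcongr
  calc 2 ^ r * (c * B) ≤ 2 ^ r * (c * (M * ((6 ^ (-p) * (((k : ℝ) + 1) / (N - r : ℕ)) ^ p) *
        (4 ^ (-q) * ((((N - r - k : ℕ) : ℝ) + 1) / (N - r : ℕ)) ^ q)) *
          ((r + 2) * K * (1 / N)) ^ r)) := by
        rw [hB, hM']
        gcongr
    _ = _ := by
      rw [mul_pow]
      ring

/-- Differences of the modification of a function with weighted `r`-th derivative.
The function is given with its chain of derivatives. -/
lemma exists_forwardDiff_modified_le (hr : 1 ≤ r) (hψ : IsCutoff r ψ) {p q K : ℝ} (hK : 1 ≤ K)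
    (hp : p ≤ 0) (hq : q ≤ 0) :
    ∃ C : ℝ, 0 < C ∧ ∀ (n N : ℕ) (G : ℕ → ℝ → ℝ) (M : ℝ), 5 + 2 * r ≤ n → n ≤ N →
    (N : ℝ) ≤ K * n → 0 ≤ M → (∀ j < r, ∀ z, HasDerivAt (G j) (G (j + 1) z) z) →
    (∀ y ∈ Ioo (0 : ℝ) 1, |G r y| ≤ M * (y ^ p * (1 - y) ^ q)) →
    ∀ k ≤ N - r, |forwardDiff r (modified ψ r n (G 0)) (1 / N) (k / N)| ≤
      C * (M * (1 / (N : ℝ)) ^ r * ((((k : ℝ) + 1) / (N - r : ℕ)) ^ p *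
        ((((N - r - k : ℕ) : ℝ) + 1) / (N - r : ℕ)) ^ q)) := by
  obtain ⟨C₁, hC₁, h₁⟩ := exists_forwardDiff_modified_le_left hr hψ hK hp hq
  obtain ⟨C₂, hC₂, h₂⟩ := exists_forwardDiff_modified_le_left hr hψ hK hq hp
  refine ⟨C₁ + C₂ + 4 ^ (-p) * 4 ^ (-q), by positivity,
    fun n N G M hn hnN hNK hM hG hGr k hk => ?_⟩
  have hr0 : (0 : ℝ) ≤ r := Nat.cast_nonneg r
  have hn0 : (0 : ℝ) < n := by
    have : 0 < n := by omega
    exact_mod_cast this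
  have hnN' : (n : ℝ) ≤ N := by exact_mod_cast hnN
  have hN0 : (0 : ℝ) < N := by linarith
  have hnr : 5 + 2 * (r : ℝ) ≤ n := by exact_mod_cast hn
  have hNr : ((N - r : ℕ) : ℝ) = N - r := Nat.cast_sub (by omega)
  have hNr2 : (N : ℝ) / 2 ≤ ((N - r : ℕ) : ℝ) := by rw [hNr]; linarith
  have hNr0 : (0 : ℝ) < ((N - r : ℕ) : ℝ) := by linarith
  have hsub : ((N - r - k : ℕ) : ℝ) = N - r - k := by rw [Nat.cast_sub hk, hNr]
  have hend : 1 - (k : ℝ) / N - r * (1 / N) = ((N - r - k : ℕ) : ℝ) / N := by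
    rw [hsub]
    field_simp
    ring
  set W := M * (1 / (N : ℝ)) ^ r * ((((k : ℝ) + 1) / (N - r : ℕ)) ^ p *
        ((((N - r - k : ℕ) : ℝ) + 1) / (N - r : ℕ)) ^ q) with hW
  have hW0 : 0 ≤ W := by positivity
  have h4 : (0 : ℝ) ≤ 4 ^ (-p) * 4 ^ (-q) := by positivity
  rcases lt_or_ge ((k : ℝ) / N) (2 / n) with hl | hl
  · refine (h₁ n N G M hn hnN hNK hM hG hGr k hk hl).trans ?_
    nlinarith [mul_nonneg hC₂.le hW0, mul_nonneg h4 hW0]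
  rcases lt_or_ge (((N - r - k : ℕ) : ℝ) / N) (2 / n) with hl' | hl'
  · have h3 := h₂ n N (fun j z => (-1) ^ j * G j (1 - z)) M hn hnN hNK hM (fun j hj z => by
        have h := ((hG j hj (1 - z)).comp_const_sub 1 z).const_mul ((-1 : ℝ) ^ j)
        refine h.congr_deriv ?_
        rw [pow_succ]
        ring) (fun y hy => by
        rw [abs_mul, abs_pow, abs_neg, abs_one, one_pow, one_mul, mul_comm (y ^ q)]
        have := hGr (1 - y) ⟨by linarith [hy.2], by linarith [hy.1]⟩
        rwa [sub_sub_cancel] at this) (N - r - k) (Nat.sub_le _ _) hl'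
    have hF : modified ψ r n (fun z => (-1) ^ 0 * G 0 (1 - z)) =
        fun z => modified ψ r n (G 0) (1 - z) := by
      funext z
      rw [← modified_reflect hψ (by omega) (G 0) z]
      simp
    rw [hF, ← hend, abs_forwardDiff_reflect, Nat.sub_sub_self hk, mul_comm (_ ^ q)] at h3
    refine h3.trans ?_
    nlinarith [mul_nonneg hC₁.le hW0, mul_nonneg h4 hW0]
  · have hk0 : (0 : ℝ) < (k : ℝ) / N := lt_of_lt_of_le (by positivity) hl
    have hk1 : (1 : ℝ) ≤ k := by
      have : k ≠ 0 := by rintro rfl; simp at hk0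
      exact_mod_cast Nat.one_le_iff_ne_zero.2 this
    have hl0 : (0 : ℝ) < ((N - r - k : ℕ) : ℝ) / N := lt_of_lt_of_le (by positivity) hl'
    have hl1 : (1 : ℝ) ≤ ((N - r - k : ℕ) : ℝ) := by
      have : N - r - k ≠ 0 := by intro h; rw [h] at hl0; simp at hl0
      exact_mod_cast Nat.one_le_iff_ne_zero.2 this
    have hmid : |forwardDiff r (modified ψ r n (G 0)) (1 / N) (k / N)| ≤ (1 / (N : ℝ)) ^ r *
        (M * ((k / N : ℝ) ^ p * (((N - r - k : ℕ) : ℝ) / N) ^ q)) := by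
      have heq : forwardDiff r (modified ψ r n (G 0)) (1 / N) (k / N) =
          (fwdDiff (1 / (N : ℝ)))^[r] (G 0) (k / N) := by
        rw [← forwardDiff_eq_iterate]
        refine Finset.sum_congr rfl fun j hj => ?_
        have hj' : (j : ℝ) ≤ r := by
          exact_mod_cast Nat.lt_succ_iff.1 (Finset.mem_range.1 hj)
        have hjN : 0 ≤ ((r : ℝ) - j) * (1 / N) := mul_nonneg (by linarith) (by positivity)
        have hjN2 : 0 ≤ (j : ℝ) * (1 / N) := by positivity
        rw [modified_of_mem hψ (by omega) (G 0) (by linarith) (by linarith)]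
      rw [heq]
      refine abs_fwdDiff_iter_le_of_chain r G hG (by positivity) fun z hz => ?_
      have hz2 : ((N - r - k : ℕ) : ℝ) / N ≤ 1 - z := by linarith [hz.2]
      have hz0 : 0 < z := lt_of_lt_of_le hk0 hz.1
      refine (hGr z ⟨hz0, by linarith⟩).trans ?_
      have e1 := Real.rpow_le_rpow_of_nonpos hk0 hz.1 hp
      have e2 := Real.rpow_le_rpow_of_nonpos hl0 hz2 hq
      have : 0 ≤ (1 - z) ^ q := Real.rpow_nonneg (by linarith) _
      gcongr
    have hratio : ∀ m : ℝ, 1 ≤ m → (m + 1) / (N - r : ℕ) ≤ 4 * (m / N) := by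
      intro m hm
      have h5 : (m + 1) / (N - r : ℕ) ≤ (m + 1) / (N / 2) := by gcongr
      have h6 : (m + 1) / ((N : ℝ) / 2) ≤ (m + m) / (N / 2) := by gcongr
      have h7 : (m + m) / ((N : ℝ) / 2) = 4 * (m / N) := by
        field_simp
        ring
      linarith
    have e1 := rpow_le_of_nonpos_ratio (z := (k : ℝ) / N) (by positivity) (by norm_num)
      (hratio k hk1) hp
    have e2 := rpow_le_of_nonpos_ratio (z := ((N - r - k : ℕ) : ℝ) / N) (by positivity)
      (by norm_num) (hratio _ hl1) hq
    calc _ ≤ _ := hmid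
      _ ≤ (1 / (N : ℝ)) ^ r * (M * ((4 ^ (-p) * (((k : ℝ) + 1) / (N - r : ℕ)) ^ p) *
          (4 ^ (-q) * ((((N - r - k : ℕ) : ℝ) + 1) / (N - r : ℕ)) ^ q))) := by gcongr
      _ = (4 ^ (-p) * 4 ^ (-q)) * W := by rw [hW]; ring
      _ ≤ _ := by nlinarith [mul_nonneg hC₁.le hW0, mul_nonneg hC₂.le hW0]

end Modified

/-! ### Derivatives of the modified combinations -/

section StarDerivative

open Polynomial

variable {r : ℕ} {ψ : ℝ → ℝ} {d : ℕ → ℕ → ℕ} {c : ℕ → ℕ → ℝ}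

lemma IsCombination.exists_bound {m : ℕ} (h : IsCombination m d c) : ∃ K : ℝ, 1 ≤ K ∧
    ∀ n, 1 ≤ n → (∀ i < m, n ≤ d n i ∧ (d n i : ℝ) ≤ K * n) ∧
      ∑ i ∈ Finset.range m, |c n i| ≤ K := by
  obtain ⟨K, hK⟩ := h.bounded
  refine ⟨max K 1, le_max_right _ _, fun n hn => ⟨fun i hi => ⟨h.le_node hn hi, ?_⟩, ?_⟩⟩
  · exact ((hK n hn).1 i hi).trans (by gcongr; exact le_max_left _ _)
  · exact (hK n hn).2.trans (le_max_left _ _)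

lemma abs_sum_mul_le {m : ℕ} {a b : ℕ → ℝ} {K B : ℝ} (hB : 0 ≤ B)
    (ha : ∑ i ∈ Finset.range m, |a i| ≤ K) (hb : ∀ i < m, |b i| ≤ B) :
    |∑ i ∈ Finset.range m, a i * b i| ≤ K * B := by
  calc _ ≤ ∑ i ∈ Finset.range m, |a i| * B := by
        refine (Finset.abs_sum_le_sum_abs _ _).trans (Finset.sum_le_sum fun i hi => ?_)
        rw [abs_mul]
        exact mul_le_mul_of_nonneg_left (hb i (Finset.mem_range.1 hi)) (abs_nonneg _)
    _ ≤ _ := by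
        rw [← Finset.sum_mul]
        exact mul_le_mul_of_nonneg_right ha hB

lemma abs_derivative_combPoly_le {m n : ℕ} {g : ℝ → ℝ} {x K B : ℝ} (hB : 0 ≤ B)
    (hc : ∑ i ∈ Finset.range m, |c n i| ≤ K)
    (h : ∀ i < m, |(derivative^[r] (bernPoly (d n i) (fun k => g ((k : ℝ) / d n i)))).eval x| ≤ B) :
    |(derivative^[r] (combPoly m d c n g)).eval x| ≤ K * B := by
  have : (derivative^[r] (combPoly m d c n g)).eval x = ∑ i ∈ Finset.range m, c n i *
      (derivative^[r] (bernPoly (d n i) (fun k => g ((k : ℝ) / d n i)))).eval x := by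
    rw [combPoly, iterate_derivative_sum, eval_finsetSum]
    refine Finset.sum_congr rfl fun i _ => ?_
    rw [iterate_derivative_C_mul, eval_mul, eval_C]
  rw [this]
  exact abs_sum_mul_le hB hc h

/-- Weighted bounds for the `r`-th derivative pass through the modified combination, with a
constant that depends only on the weight and the combination. -/
lemma exists_derivative_star_le_of_derivative (hr : 1 ≤ r) (hψ : IsCutoff r ψ)
    (hdc : IsCombination (r - 1) d c) {p q : ℝ} (hp : p ≤ 0) (hq : q ≤ 0) :
    ∃ C : ℝ, 0 < C ∧ ∀ (n : ℕ) (G : ℕ → ℝ → ℝ) (M : ℝ), 5 + 2 * r ≤ n → 0 ≤ M →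
    (∀ j < r, ∀ z, HasDerivAt (G j) (G (j + 1) z) z) →
    (∀ y ∈ Ioo (0 : ℝ) 1, |G r y| ≤ M * (y ^ p * (1 - y) ^ q)) → ∀ x ∈ Ioo (0 : ℝ) 1,
    |(derivative^[r] (combPoly (r - 1) d c n (modified ψ r n (G 0)))).eval x| ≤
      C * (M * (x ^ p * (1 - x) ^ q)) := by
  obtain ⟨K, hK, hdK⟩ := hdc.exists_bound
  obtain ⟨C₁, hC₁, h₁⟩ := exists_forwardDiff_modified_le hr hψ hK hp hq
  obtain ⟨C₂, hC₂, h₂⟩ := exists_sum_bern_scaled_le p q 0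
  refine ⟨K * (C₁ * C₂), by positivity, fun n G M hn hM hG hGr x hx => ?_⟩
  have hx' : x ∈ Icc (0 : ℝ) 1 := ⟨hx.1.le, hx.2.le⟩
  have hx0 := hx.1
  have hx1 : 0 < 1 - x := by linarith [hx.2]
  obtain ⟨hd, hc⟩ := hdK n (by omega)
  rw [mul_assoc]
  refine abs_derivative_combPoly_le (by positivity) hc fun i hi => ?_
  obtain ⟨hnN, hNK⟩ := hd i hi
  set N := d n i
  have hN0 : (0 : ℝ) < N := by
    have : 0 < N := by omega
    exact_mod_cast this
  have hN'0 : 1 ≤ N - r := by omega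
  refine (abs_derivative_bernPoly_le (by omega : r ≤ N) _ hx').trans ?_
  have hpt : ∀ k ∈ Finset.range (N - r + 1), bern (N - r) k x *
      |(fwdDiff 1)^[r] (fun k : ℕ => modified ψ r n (G 0) ((k : ℝ) / N)) k| ≤
      C₁ * M * (1 / (N : ℝ)) ^ r * (bern (N - r) k x * ((((k : ℝ) + 1) / (N - r : ℕ)) ^ p *
        ((((N - r - k : ℕ) : ℝ) + 1) / (N - r : ℕ)) ^ q * (1 + dev (N - r) k x) ^ 0)) := by
    intro k hk
    have hk' : k ≤ N - r := by simpa [Nat.lt_succ_iff] using hk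
    rw [fwdDiff_iter_node, pow_zero, mul_one]
    have h := mul_le_mul_of_nonneg_left (h₁ n N G M hn hnN hNK hM hG hGr k hk')
      (bern_nonneg (N := N - r) (k := k) hx')
    linarith
  have hs := h₂ (N - r) x hN'0 hx'
  have e1 : (x + 1 / (N - r : ℕ)) ^ p ≤ x ^ p :=
    Real.rpow_le_rpow_of_nonpos hx0 (by simp) hp
  have e2 : (1 - x + 1 / (N - r : ℕ)) ^ q ≤ (1 - x) ^ q :=
    Real.rpow_le_rpow_of_nonpos hx1 (by simp) hq
  calc _ ≤ (N : ℝ) ^ r * (C₁ * M * (1 / (N : ℝ)) ^ r *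
        (C₂ * ((x + 1 / (N - r : ℕ)) ^ p * (1 - x + 1 / (N - r : ℕ)) ^ q))) := by
        gcongr
        refine (Finset.sum_le_sum hpt).trans ?_
        rw [← Finset.mul_sum]
        gcongr
    _ ≤ (N : ℝ) ^ r * (C₁ * M * (1 / (N : ℝ)) ^ r * (C₂ * (x ^ p * (1 - x) ^ q))) := by gcongr
    _ = _ := by
      rw [one_div, inv_pow]
      field_simp

lemma sqrt_div_pow_eq_rpow {a : ℝ} (ha : 0 ≤ a) (r : ℕ) :
    Real.sqrt a ^ r = a ^ ((r : ℝ) / 2) := by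
  rw [Real.sqrt_eq_rpow, ← Real.rpow_natCast, ← Real.rpow_mul ha]
  congr 1
  ring

/-- Derivative bound where `N x (1 - x) ≥ 1`: differentiating the basis costs a factor of order
`√(N / (x (1 - x)))` per derivative. -/
lemma exists_derivative_bernPoly_interior (r : ℕ) (p q : ℝ) : ∃ C : ℝ, 0 < C ∧
    ∀ (N : ℕ) (a : ℕ → ℝ) (M x : ℝ), 1 ≤ N → 0 ≤ M → x ∈ Ioo (0 : ℝ) 1 → 1 ≤ N * (x * (1 - x)) →
    (∀ k ≤ N, |a k| ≤ M * ((((k : ℝ) + 1) / N) ^ p * ((((N - k : ℕ) : ℝ) + 1) / N) ^ q)) →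
    |(derivative^[r] (bernPoly N a)).eval x| ≤ C * (M * (N : ℝ) ^ ((r : ℝ) / 2) *
      (x ^ (p - r / 2) * (1 - x) ^ (q - r / 2))) := by
  obtain ⟨C₁, hC₁, h₁⟩ := exists_abs_derivative_bernPoly_le r
  obtain ⟨C₂, hC₂, h₂⟩ := exists_sum_bern_scaled_le p q r
  refine ⟨C₁ * 2 ^ r * C₂ * (2 ^ |p| * 2 ^ |q|), by positivity,
    fun N a M x hN hM hx hNx ha => (h₁ N a x hx).trans ?_⟩
  have hx' : x ∈ Icc (0 : ℝ) 1 := ⟨hx.1.le, hx.2.le⟩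
  have hx0 := hx.1
  have hx1 : 0 < 1 - x := by linarith [hx.2]
  have hN0 : (0 : ℝ) < N := by positivity
  set s := x * (1 - x) with hs
  have hs0 : 0 < s := by positivity
  have hNs : 1 / (N : ℝ) ≤ s := by
    rw [div_le_iff₀ hN0]
    linarith
  have hsx : s ≤ x := by nlinarith
  have hsx1 : s ≤ 1 - x := by nlinarith
  have hN1 : 0 < 1 / (N : ℝ) := by positivity
  have hσ : sig N x / s ≤ 2 * Real.sqrt (N / s) := by
    have h3 : (1 : ℝ) ≤ Real.sqrt (N * s) := by
      rw [Real.one_le_sqrt]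
      exact hNx
    have h4 : Real.sqrt (N * s) = Real.sqrt (N / s) * s := by
      rw [show (N : ℝ) * s = N / s * s ^ 2 by field_simp, Real.sqrt_mul (by positivity),
        Real.sqrt_sq hs0.le]
    rw [div_le_iff₀ hs0, mul_assoc, ← h4, sig]
    linarith
  have hσ0 : 0 ≤ sig N x / s := div_nonneg (sig_pos N x).le hs0.le
  have e1 : (x + 1 / N) ^ p ≤ 2 ^ |p| * x ^ p :=
    rpow_le_of_ratio (by positivity) hx0 (by norm_num) (by linarith) (by linarith) p
  have e2 : (1 - x + 1 / N) ^ q ≤ 2 ^ |q| * (1 - x) ^ q :=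
    rpow_le_of_ratio (by positivity) hx1 (by norm_num) (by linarith) (by linarith) q
  have hsum : ∑ k ∈ Finset.range (N + 1), bern N k x * (|a k| * (1 + dev N k x) ^ r) ≤
      M * (C₂ * ((2 ^ |p| * x ^ p) * (2 ^ |q| * (1 - x) ^ q))) := by
    calc _ ≤ ∑ k ∈ Finset.range (N + 1), M * (bern N k x *
        ((((k : ℝ) + 1) / N) ^ p * ((((N - k : ℕ) : ℝ) + 1) / N) ^ q * (1 + dev N k x) ^ r)) := by
          refine Finset.sum_le_sum fun k hk => ?_
          have hk' : k ≤ N := by simpa [Nat.lt_succ_iff] using hk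
          have hd := dev_nonneg N k x
          have hb := bern_nonneg (N := N) (k := k) hx'
          calc _ ≤ bern N k x * ((M * ((((k : ℝ) + 1) / N) ^ p *
                ((((N - k : ℕ) : ℝ) + 1) / N) ^ q)) * (1 + dev N k x) ^ r) := by
                gcongr
                exact ha k hk'
            _ = _ := by ring
      _ ≤ M * (C₂ * ((x + 1 / N) ^ p * (1 - x + 1 / N) ^ q)) := by
          rw [← Finset.mul_sum]
          gcongr
          exact h₂ N x hN hx'
      _ ≤ _ := by gcongr
  have hsum0 : 0 ≤ ∑ k ∈ Finset.range (N + 1), bern N k x * (|a k| * (1 + dev N k x) ^ r) :=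
    Finset.sum_nonneg fun k _ => by
      have := dev_nonneg N k x
      have := bern_nonneg (N := N) (k := k) hx'
      positivity
  calc _ ≤ C₁ * (2 * Real.sqrt (N / s)) ^ r *
        (M * (C₂ * ((2 ^ |p| * x ^ p) * (2 ^ |q| * (1 - x) ^ q)))) := by gcongr
    _ = _ := by
      rw [mul_pow, sqrt_div_pow_eq_rpow (by positivity), hs, Real.div_rpow hN0.le (by positivity),
        Real.mul_rpow hx0.le hx1.le, Real.rpow_sub hx0, Real.rpow_sub hx1]
      field_simp

/-- Derivative bound where `N x (1 - x) ≤ 1`: the derivative is expressed by differences of the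
coefficients, at a cost of `N` per derivative. -/
lemma exists_derivative_bernPoly_end (r : ℕ) {p q : ℝ} (hp : p ≤ r / 2) (hq : q ≤ r / 2) :
    ∃ C : ℝ, 0 < C ∧
    ∀ (N : ℕ) (a : ℕ → ℝ) (M x : ℝ), 1 + 2 * r ≤ N → 0 ≤ M → x ∈ Ioo (0 : ℝ) 1 →
    N * (x * (1 - x)) ≤ 1 →
    (∀ k ≤ N, |a k| ≤ M * ((((k : ℝ) + 1) / N) ^ p * ((((N - k : ℕ) : ℝ) + 1) / N) ^ q)) →
    |(derivative^[r] (bernPoly N a)).eval x| ≤ C * (M * (N : ℝ) ^ ((r : ℝ) / 2) *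
      (x ^ (p - r / 2) * (1 - x) ^ (q - r / 2))) := by
  obtain ⟨C₂, hC₂, h₂⟩ := exists_sum_bern_scaled_le p q 0
  set R : ℝ := 2 * (r + 1) with hR
  have hr0 : (0 : ℝ) ≤ r := Nat.cast_nonneg r
  have hR1 : 1 ≤ R := by linarith
  refine ⟨2 ^ r * (R ^ |p| * R ^ |q|) * C₂ * 7 ^ ((r : ℝ) / 2), by positivity,
    fun N a M x hN hM hx hNx ha => ?_⟩
  have hx' : x ∈ Icc (0 : ℝ) 1 := ⟨hx.1.le, hx.2.le⟩
  have hx0 := hx.1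
  have hx1 : 0 < 1 - x := by linarith [hx.2]
  have hNr : 1 + 2 * (r : ℝ) ≤ N := by exact_mod_cast hN
  have hN0 : (0 : ℝ) < N := by linarith
  have hN' : ((N - r : ℕ) : ℝ) = N - r := Nat.cast_sub (by omega)
  have hN'2 : (N : ℝ) / 2 ≤ ((N - r : ℕ) : ℝ) := by rw [hN']; linarith
  have hN'0 : (0 : ℝ) < ((N - r : ℕ) : ℝ) := by linarith
  have hN'N : ((N - r : ℕ) : ℝ) ≤ N := by rw [hN']; linarith
  refine (abs_derivative_bernPoly_le (by omega : r ≤ N) _ hx').trans ?_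
  have hpt : ∀ k ∈ Finset.range (N - r + 1), bern (N - r) k x * |(fwdDiff 1)^[r] a k| ≤
      2 ^ r * (R ^ |p| * R ^ |q|) * M * (bern (N - r) k x * ((((k : ℝ) + 1) / (N - r : ℕ)) ^ p *
        ((((N - r - k : ℕ) : ℝ) + 1) / (N - r : ℕ)) ^ q * (1 + dev (N - r) k x) ^ 0)) := by
    intro k hk
    have hk' : k ≤ N - r := by simpa [Nat.lt_succ_iff] using hk
    have hk0 : (0 : ℝ) ≤ k := Nat.cast_nonneg k
    have hsub : ((N - r - k : ℕ) : ℝ) = N - r - k := by rw [Nat.cast_sub hk', hN']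
    have hsub0 : (0 : ℝ) ≤ ((N - r - k : ℕ) : ℝ) := Nat.cast_nonneg _
    have h5 : ∀ j ≤ r, |a (k + j • 1)| ≤ R ^ |p| * R ^ |q| * (M * ((((k : ℝ) + 1) / (N - r : ℕ)) ^ p *
        ((((N - r - k : ℕ) : ℝ) + 1) / (N - r : ℕ)) ^ q)) := by
      intro j hj
      have hj0 : (0 : ℝ) ≤ j := Nat.cast_nonneg j
      have hj' : (j : ℝ) ≤ r := by exact_mod_cast hj
      have hle : k + j ≤ N := by omega
      have hsub2 : ((N - (k + j) : ℕ) : ℝ) = N - r - k + (r - j) := by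
        rw [Nat.cast_sub hle]
        push_cast
        ring
      have hcmp : ∀ u v : ℝ, 0 < v → v ≤ u → u ≤ (r + 1) * v →
          u / N ≤ R * (v / (N - r : ℕ)) ∧ v / (N - r : ℕ) ≤ R * (u / N) := by
        intro u v hv hvu huv
        have hu : 0 ≤ u := hv.le.trans hvu
        constructor
        · calc u / N ≤ ((r + 1) * v) / (N - r : ℕ) := by gcongr
            _ ≤ _ := by
              rw [hR, mul_div_assoc]
              have : 0 ≤ v / ((N - r : ℕ) : ℝ) := by positivity
              nlinarith
        · calc v / (N - r : ℕ) ≤ u / (N / 2) := by gcongr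
            _ = 2 * (u / N) := by field_simp
            _ ≤ _ := by
              have : 0 ≤ u / N := div_nonneg (by linarith) hN0.le
              nlinarith
      obtain ⟨g1, g2⟩ := hcmp ((k + j : ℕ) + 1) (k + 1) (by positivity) (by push_cast; linarith)
        (by push_cast; nlinarith)
      obtain ⟨g3, g4⟩ := hcmp ((N - (k + j) : ℕ) + 1) ((N - r - k : ℕ) + 1) (by positivity)
        (by rw [hsub, hsub2]; linarith) (by rw [hsub] at hsub0 ⊢; rw [hsub2]; nlinarith)
      have f1 := rpow_le_of_ratio (by positivity) (by positivity) hR1 g1 g2 p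
      have f2 := rpow_le_of_ratio (by positivity) (by positivity) hR1 g3 g4 q
      rw [smul_eq_mul, mul_one]
      refine (ha (k + j) hle).trans ?_
      calc _ ≤ M * ((R ^ |p| * (((k : ℝ) + 1) / (N - r : ℕ)) ^ p) *
            (R ^ |q| * ((((N - r - k : ℕ) : ℝ) + 1) / (N - r : ℕ)) ^ q)) := by gcongr
        _ = _ := by ring
    have h6 := abs_fwdDiff_iter_le_two_pow 1 r a k h5
    have h := mul_le_mul_of_nonneg_left h6 (bern_nonneg (N := N - r) (k := k) hx')
    rw [pow_zero, mul_one]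
    linarith
  have hs := h₂ (N - r) x (by omega) hx'
  set u := 1 / ((N - r : ℕ) : ℝ) with hu
  have hu0 : 0 < u := by positivity
  have hu2 : u * N ≤ 2 := by
    rw [hu, div_mul_eq_mul_div, div_le_iff₀ hN'0]
    linarith
  have hu1 : u ≤ 1 := by
    have : (1 : ℕ) ≤ N - r := by omega
    rw [hu, div_le_one hN'0]
    exact_mod_cast this
  -- near the ends `N` is at most a multiple of the reciprocal of the shifted weight
  have hNle : (N : ℝ) ^ ((r : ℝ) / 2) ≤
      7 ^ ((r : ℝ) / 2) * ((x + u) ^ (-((r : ℝ) / 2)) * (1 - x + u) ^ (-((r : ℝ) / 2))) := by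
    have h7 : (N : ℝ) ≤ 7 * ((x + u) * (1 - x + u))⁻¹ := by
      rw [← div_eq_mul_inv, le_div_iff₀ (by positivity)]
      have : (N : ℝ) * ((x + u) * (1 - x + u)) = N * (x * (1 - x)) + u * N + (u * N) * u := by ring
      nlinarith
    calc _ ≤ (7 * ((x + u) * (1 - x + u))⁻¹) ^ ((r : ℝ) / 2) := by gcongr
      _ = _ := by
        rw [Real.mul_rpow (by norm_num) (by positivity), Real.inv_rpow (by positivity),
          Real.mul_rpow (by positivity) (by positivity), Real.rpow_neg (by positivity),
          Real.rpow_neg (by positivity), mul_inv]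
  have hpow : (N : ℝ) ^ r = (N : ℝ) ^ ((r : ℝ) / 2) * (N : ℝ) ^ ((r : ℝ) / 2) := by
    rw [← Real.rpow_add hN0, add_halves, Real.rpow_natCast]
  have e1 : (x + u) ^ (p - r / 2) ≤ x ^ (p - r / 2) :=
    Real.rpow_le_rpow_of_nonpos hx0 (by linarith) (by linarith)
  have e2 : (1 - x + u) ^ (q - r / 2) ≤ (1 - x) ^ (q - r / 2) :=
    Real.rpow_le_rpow_of_nonpos hx1 (by linarith) (by linarith)
  calc _ ≤ (N : ℝ) ^ r * (2 ^ r * (R ^ |p| * R ^ |q|) * M *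
        (C₂ * ((x + u) ^ p * (1 - x + u) ^ q))) := by
        gcongr
        refine (Finset.sum_le_sum hpt).trans ?_
        rw [← Finset.mul_sum]
        gcongr
    _ ≤ ((N : ℝ) ^ ((r : ℝ) / 2) * (7 ^ ((r : ℝ) / 2) * ((x + u) ^ (-((r : ℝ) / 2)) *
          (1 - x + u) ^ (-((r : ℝ) / 2))))) * (2 ^ r * (R ^ |p| * R ^ |q|) * M *
        (C₂ * ((x + u) ^ p * (1 - x + u) ^ q))) := by
        rw [hpow]
        gcongr
    _ = 2 ^ r * (R ^ |p| * R ^ |q|) * C₂ * 7 ^ ((r : ℝ) / 2) * (M * (N : ℝ) ^ ((r : ℝ) / 2) *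
          ((x + u) ^ (p - r / 2) * (1 - x + u) ^ (q - r / 2))) := by
        rw [sub_eq_add_neg p, sub_eq_add_neg q, Real.rpow_add (by positivity),
          Real.rpow_add (by positivity)]
        ring
    _ ≤ _ := by gcongr

/-- Weighted Bernstein inequality for the modified combination. -/
lemma exists_derivative_star_le (hr : 1 ≤ r) (hψ : IsCutoff r ψ)
    (hdc : IsCombination (r - 1) d c) {p q : ℝ} (hp : p ≤ r / 2) (hq : q ≤ r / 2) :
    ∃ C : ℝ, 0 < C ∧ ∀ (n : ℕ) (h : ℝ → ℝ) (M : ℝ), 5 + 2 * r ≤ n → 0 ≤ M →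
    (∀ y ∈ Icc (1 / (n : ℝ)) (1 - 1 / n), |h y| ≤ M * (y ^ p * (1 - y) ^ q)) →
    ∀ x ∈ Ioo (0 : ℝ) 1,
    |(derivative^[r] (combPoly (r - 1) d c n (modified ψ r n h))).eval x| ≤
      C * (M * (n : ℝ) ^ ((r : ℝ) / 2) * (x ^ (p - r / 2) * (1 - x) ^ (q - r / 2))) := by
  obtain ⟨K, hK, hdK⟩ := hdc.exists_bound
  obtain ⟨C₀, hC₀, h₀⟩ := exists_abs_modified_node_le hr hψ p q K hK
  obtain ⟨C₁, hC₁, h₁⟩ := exists_derivative_bernPoly_interior r p q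
  obtain ⟨C₂, hC₂, h₂⟩ := exists_derivative_bernPoly_end r hp hq
  refine ⟨K * ((C₁ + C₂) * C₀ * K ^ ((r : ℝ) / 2)), by positivity, fun n h M hn hM hh x hx => ?_⟩
  have hx0 := hx.1
  have hx1 : 0 < 1 - x := by linarith [hx.2]
  obtain ⟨hd, hc⟩ := hdK n (by omega)
  rw [mul_assoc]
  refine abs_derivative_combPoly_le (by positivity) hc fun i hi => ?_
  obtain ⟨hnN, hNK⟩ := hd i hi
  have hnode := h₀ n (d n i) h M hn hnN hNK hM hh
  set N := d n i
  have hnode' : ∀ k ≤ N, |(fun k : ℕ => modified ψ r n h ((k : ℝ) / N)) k| ≤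
      (C₀ * M) * ((((k : ℝ) + 1) / N) ^ p * ((((N - k : ℕ) : ℝ) + 1) / N) ^ q) := fun k hk => by
    rw [mul_assoc]
    exact hnode k hk
  have hb : |(derivative^[r] (bernPoly N (fun k => modified ψ r n h ((k : ℝ) / N)))).eval x| ≤
      (C₁ + C₂) * (C₀ * M * (N : ℝ) ^ ((r : ℝ) / 2) *
        (x ^ (p - r / 2) * (1 - x) ^ (q - r / 2))) := by
    have hpos : 0 ≤ C₀ * M * (N : ℝ) ^ ((r : ℝ) / 2) *
        (x ^ (p - r / 2) * (1 - x) ^ (q - r / 2)) := by positivity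
    rcases le_total 1 (N * (x * (1 - x))) with hc1 | hc1
    · refine (h₁ N _ (C₀ * M) x (by omega) (by positivity) hx hc1 hnode').trans ?_
      gcongr
      linarith
    · refine (h₂ N _ (C₀ * M) x (by omega) (by positivity) hx hc1 hnode').trans ?_
      gcongr
      linarith
  refine hb.trans ?_
  calc _ ≤ (C₁ + C₂) * (C₀ * M * (K * n) ^ ((r : ℝ) / 2) *
        (x ^ (p - r / 2) * (1 - x) ^ (q - r / 2))) := by gcongr
    _ = _ := by
      rw [Real.mul_rpow (by linarith) (Nat.cast_nonneg n)]
      ring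

end StarDerivative

/-! ### From the rate of approximation to smoothness -/

/-- The weighted pointwise rate of approximation by `B*_{n,r-1}`. -/
def StarRate (α β : ℝ) (r : ℕ) (a₀ lam : ℝ) (d : ℕ → ℕ → ℕ) (c : ℕ → ℕ → ℝ) (ψ f : ℝ → ℝ) : Prop :=
  ∃ C : ℝ, ∃ N : ℕ, ∀ n : ℕ, N ≤ n → ∀ x ∈ Ioo (0 : ℝ) 1,
    weight α β x * |f x - starOp ψ r d c n f x| ≤
      C * ((n : ℝ) ^ (-(1 / 2) : ℝ) * phi x ^ (-lam) * delta n x) ^ a₀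

/-- One-sided smoothness near `0`: the forward difference of step `h` at `y` is of order
`h ^ a₀ · max(h,y) ^ (-lam a₀ / 2) · y ^ (-α)`. Both halves of the modulus of smoothness, and both
halves of the rate of approximation, are equivalent to this condition for `f` and for `f(1 - ·)`. -/
def HalfSmooth (r : ℕ) (α lam a₀ : ℝ) (f : ℝ → ℝ) : Prop :=
  ∃ C h₀ : ℝ, 0 < C ∧ 0 < h₀ ∧ ∀ y ∈ Ioc (0 : ℝ) (3 / 4), ∀ h ∈ Ioc (0 : ℝ) h₀,
    |forwardDiff r f h y| ≤ C * (h ^ a₀ * max h y ^ (-(lam * a₀ / 2)) * y ^ (-α))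

lemma phi_pos {x : ℝ} (hx : x ∈ Ioo (0 : ℝ) 1) : 0 < phi x :=
  Real.sqrt_pos.2 (mul_pos hx.1 (by linarith [hx.2]))

lemma phi_rpow {x : ℝ} (hx : x ∈ Ioo (0 : ℝ) 1) (t : ℝ) :
    phi x ^ t = x ^ (t / 2) * (1 - x) ^ (t / 2) := by
  have h0 := hx.1
  have h1 : 0 < 1 - x := by linarith [hx.2]
  rw [phi, Real.sqrt_eq_rpow, ← Real.rpow_mul (by positivity), Real.mul_rpow h0.le h1.le,
    show 1 / 2 * t = t / 2 by ring]

lemma weight_pos {α β x : ℝ} (hx : x ∈ Ioo (0 : ℝ) 1) : 0 < weight α β x :=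
  mul_pos (Real.rpow_pos_of_pos hx.1 _) (Real.rpow_pos_of_pos (by linarith [hx.2]) _)

lemma le_weight_inv_mul {α β x u v : ℝ} (hx : x ∈ Ioo (0 : ℝ) 1) (h : weight α β x * u ≤ v) :
    u ≤ v * (x ^ (-α) * (1 - x) ^ (-β)) := by
  have h1 : 0 < 1 - x := by linarith [hx.2]
  have hw := weight_pos (α := α) (β := β) hx
  have e : x ^ (-α) * (1 - x) ^ (-β) = (weight α β x)⁻¹ := by
    rw [weight, mul_inv, Real.rpow_neg hx.1.le, Real.rpow_neg h1.le]
  rw [e, ← div_eq_mul_inv, le_div_iff₀ hw]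
  linarith

lemma inv_sqrt_eq_rpow (n : ℕ) : (n : ℝ) ^ (-(1 / 2) : ℝ) = 1 / Real.sqrt n := by
  rw [Real.rpow_neg (Nat.cast_nonneg n), ← Real.sqrt_eq_rpow, one_div]

section Inverse

open Polynomial

variable {r : ℕ} {ψ : ℝ → ℝ} {d : ℕ → ℕ → ℕ} {c : ℕ → ℕ → ℝ} {α β a₀ lam : ℝ} {f : ℝ → ℝ}

lemma one_div_le_mul_of_mem {n : ℕ} (hn : 2 ≤ n) {y : ℝ}
    (hy : y ∈ Icc (1 / (n : ℝ)) (1 - 1 / n)) : 1 / (2 * n : ℝ) ≤ y * (1 - y) := by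
  have hn0 : (0 : ℝ) < n := by positivity
  have e : 1 / (2 * n : ℝ) = 1 / n * (1 / 2) := by field_simp
  have h0 : 0 < 1 / (n : ℝ) := by positivity
  rw [e]
  rcases le_total y (1 / 2) with h | h
  · have : 1 / 2 ≤ 1 - y := by linarith
    exact mul_le_mul hy.1 this (by norm_num) (by linarith [hy.1])
  · rw [mul_comm y]
    exact mul_le_mul (by linarith [hy.2]) h (by norm_num) (by linarith [hy.2])

/-- The error at level `m`, seen from the coarser interior `[1/n, 1-1/n]` with `n` comparable
to `m`, is a pure Jacobi weight. -/
lemma StarRate.exists_interior (ha₀ : 0 < a₀) (hE : StarRate α β r a₀ lam d c ψ f)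
    {A : ℝ} (hA : 1 ≤ A) : ∃ C : ℝ, ∃ N₀ : ℕ, 0 < C ∧ ∀ m n : ℕ, N₀ ≤ m → 1 ≤ m → 2 ≤ n →
      (n : ℝ) ≤ A * m → ∀ y ∈ Icc (1 / (n : ℝ)) (1 - 1 / n),
      |f y - starOp ψ r d c m f y| ≤ C * (n : ℝ) ^ (-(a₀ / 2)) *
        (y ^ ((1 - lam) * a₀ / 2 - α) * (1 - y) ^ ((1 - lam) * a₀ / 2 - β)) := by
  obtain ⟨C, N₀, h⟩ := hE
  set κ := Real.sqrt A * (1 + Real.sqrt (2 * A)) with hκ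
  have hκ0 : 0 < κ := by
    have : 0 < A := by linarith
    positivity
  refine ⟨(|C| + 1) * κ ^ a₀, N₀, by positivity, fun m n hm hm1 hn hnA y hy => ?_⟩
  have hn0 : (0 : ℝ) < n := by positivity
  have hm0 : (0 : ℝ) < m := by positivity
  have h1n : 0 < 1 / (n : ℝ) := by positivity
  have hy' : y ∈ Ioo (0 : ℝ) 1 := ⟨by linarith [hy.1], by linarith [hy.2]⟩
  have hy0 := hy'.1
  have hy1 : 0 < 1 - y := by linarith [hy'.2]
  have hφ := phi_pos hy'
  have hsn : 0 < Real.sqrt n := Real.sqrt_pos.2 hn0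
  have hsm : 0 < Real.sqrt m := Real.sqrt_pos.2 hm0
  have hA0 : 0 ≤ A := by linarith
  have e1 : 1 / Real.sqrt m ≤ Real.sqrt A * (1 / Real.sqrt n) := by
    rw [mul_one_div, div_le_div_iff₀ hsm hsn, one_mul, ← Real.sqrt_mul hA0]
    exact Real.sqrt_le_sqrt hnA
  have e2 : 1 / Real.sqrt m ≤ Real.sqrt (2 * A) * phi y := by
    refine e1.trans ?_
    have h2 := Real.sqrt_le_sqrt (one_div_le_mul_of_mem hn hy)
    rw [Real.sqrt_div zero_le_one, Real.sqrt_one, Real.sqrt_mul zero_le_two] at h2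
    rw [Real.sqrt_mul zero_le_two, mul_comm (Real.sqrt 2), mul_assoc]
    have h3 : 1 / Real.sqrt n ≤ Real.sqrt 2 * phi y := by
      calc _ = Real.sqrt 2 * (1 / (Real.sqrt 2 * Real.sqrt n)) := by field_simp
        _ ≤ _ := by gcongr; exact h2
    gcongr
  have hB : (m : ℝ) ^ (-(1 / 2) : ℝ) * phi y ^ (-lam) * delta m y ≤
      κ * ((n : ℝ) ^ (-(1 / 2) : ℝ) * phi y ^ (1 - lam)) := by
    rw [inv_sqrt_eq_rpow, inv_sqrt_eq_rpow, delta]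
    calc _ ≤ (Real.sqrt A * (1 / Real.sqrt n)) * phi y ^ (-lam) *
          (phi y + Real.sqrt (2 * A) * phi y) := by gcongr
      _ = κ * (1 / Real.sqrt n * (phi y ^ (-lam) * phi y)) := by rw [hκ]; ring
      _ = _ := by
        rw [show 1 - lam = -lam + 1 by ring, Real.rpow_add hφ, Real.rpow_one]
  have hB0 : 0 ≤ (m : ℝ) ^ (-(1 / 2) : ℝ) * phi y ^ (-lam) * delta m y := by
    have : 0 ≤ delta m y := by unfold delta; positivity
    positivity
  have hmain : weight α β y * |f y - starOp ψ r d c m f y| ≤ (|C| + 1) *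
      (κ ^ a₀ * ((n : ℝ) ^ (-(a₀ / 2)) * (y ^ ((1 - lam) * a₀ / 2) *
        (1 - y) ^ ((1 - lam) * a₀ / 2)))) := by
    calc _ ≤ C * ((m : ℝ) ^ (-(1 / 2) : ℝ) * phi y ^ (-lam) * delta m y) ^ a₀ := h m hm y hy'
      _ ≤ (|C| + 1) * (κ * ((n : ℝ) ^ (-(1 / 2) : ℝ) * phi y ^ (1 - lam))) ^ a₀ := by
        have := le_abs_self C
        gcongr
        linarith
      _ = _ := by
        rw [Real.mul_rpow (x := κ) hκ0.le (by positivity),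
          Real.mul_rpow (x := (n : ℝ) ^ _) (by positivity) (by positivity),
          ← Real.rpow_mul hn0.le, ← Real.rpow_mul hφ.le, phi_rpow hy',
          show -(1 / 2) * a₀ = -(a₀ / 2) by ring]
  refine (le_weight_inv_mul hy' hmain).trans (le_of_eq ?_)
  rw [sub_eq_add_neg _ α, sub_eq_add_neg _ β, Real.rpow_add hy0, Real.rpow_add hy1]
  ring

lemma combPoly_sub {m n : ℕ} (g h : ℝ → ℝ) :
    combPoly m d c n g = combPoly m d c n (fun t => g t - h t) + combPoly m d c n h := by
  simp only [combPoly, bernPoly, ← Finset.sum_add_distrib, ← mul_add]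
  refine Finset.sum_congr rfl fun i _ => ?_
  congr 1
  refine Finset.sum_congr rfl fun k _ => ?_
  rw [← add_mul, ← C_add, sub_add_cancel]

/-- Under the rate hypothesis the derivatives of `B*_n f` satisfy the matching Bernstein-type
bound. The operators at the levels `m ≈ n / A` and `n` are compared: applying `B*_n` to
`f = (f - B*_m f) + B*_m f` gives `M_n ≤ C_A + C' A^{-(r-a₀)/2} M_m` for the normalised suprema
`M_n`, with `C'` independent of `A`, so that a large `A` makes the recursion contract. -/
lemma StarRate.exists_abs_derivative_le (hr : 2 ≤ r) (hψ : IsCutoff r ψ)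
    (hdc : IsCombination (r - 1) d c) (hα : 0 < α) (hβ : 0 < β) (ha₀ : 0 < a₀) (har : a₀ < r)
    (hlam0 : 0 ≤ lam) (hE : StarRate α β r a₀ lam d c ψ f) :
    ∃ Γ : ℝ, ∃ N₁ : ℕ, 0 < Γ ∧ ∀ n : ℕ, N₁ ≤ n → ∀ x ∈ Ioo (0 : ℝ) 1,
      |(derivative^[r] (combPoly (r - 1) d c n (modified ψ r n f))).eval x| ≤
        Γ * (n : ℝ) ^ (((r : ℝ) - a₀) / 2) * (x ^ ((1 - lam) * a₀ / 2 - α - r / 2) *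
          (1 - x) ^ ((1 - lam) * a₀ / 2 - β - r / 2)) := by
  have hla : (1 - lam) * a₀ ≤ r := by nlinarith
  set p := (1 - lam) * a₀ / 2 - α with hp
  set q := (1 - lam) * a₀ / 2 - β with hq
  have hp' : p ≤ r / 2 := by rw [hp]; linarith
  have hq' : q ≤ r / 2 := by rw [hq]; linarith
  set e := ((r : ℝ) - a₀) / 2 with he
  have he0 : 0 < e := by rw [he]; linarith
  obtain ⟨C₁, hC₁, h₁⟩ := exists_derivative_star_le (by omega) hψ hdc hp' hq'
  obtain ⟨C₂, hC₂, h₂⟩ := exists_derivative_star_le_of_derivative (by omega) hψ hdc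
    (show p - r / 2 ≤ 0 by linarith) (show q - r / 2 ≤ 0 by linarith)
  -- the ratio of levels that makes the recursion contract
  obtain ⟨A, hA1, hA⟩ : ∃ A : ℕ, 2 ≤ A ∧ 2 * C₂ ≤ (A : ℝ) ^ e := by
    obtain ⟨A, hA⟩ := exists_nat_ge ((2 * C₂) ^ (1 / e))
    refine ⟨A + 2, by omega, ?_⟩
    have h3 : ((2 * C₂) ^ (1 / e)) ^ e ≤ ((A + 2 : ℕ) : ℝ) ^ e := by
      refine Real.rpow_le_rpow (by positivity) (hA.trans ?_) he0.le
      push_cast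
      linarith
    rwa [← Real.rpow_mul (by positivity), one_div_mul_cancel he0.ne', Real.rpow_one] at h3
  have hA1' : (1 : ℝ) ≤ A := by exact_mod_cast (by omega : 1 ≤ A)
  obtain ⟨C₃, N₀, hC₃, h₃⟩ := hE.exists_interior ha₀ (A := 2 * A) (by linarith)
  set N₁ := max N₀ (5 + 2 * r) with hN₁
  have hbase : ∀ n : ℕ, ∃ b : ℝ, 0 ≤ b ∧ ∀ x ∈ Ioo (0 : ℝ) 1,
      |(derivative^[r] (combPoly (r - 1) d c n (modified ψ r n f))).eval x| ≤ b := by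
    intro n
    obtain ⟨b, hb⟩ := isCompact_Icc.exists_bound_of_continuousOn (s := Icc (0 : ℝ) 1)
      (derivative^[r] (combPoly (r - 1) d c n (modified ψ r n f))).continuous.continuousOn
    exact ⟨b, (norm_nonneg _).trans (hb 0 (by simp)), fun x hx => hb x ⟨hx.1.le, hx.2.le⟩⟩
  choose b hb0 hb using hbase
  set Γ := ∑ n ∈ Finset.range (A * N₁), b n + 2 * (C₁ * C₃) with hΓ
  have hsum0 : 0 ≤ ∑ n ∈ Finset.range (A * N₁), b n := Finset.sum_nonneg fun n _ => hb0 n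
  have hΓ0 : 0 < Γ := by positivity
  refine ⟨Γ, N₁, hΓ0, fun n => ?_⟩
  induction n using Nat.strong_induction_on with
  | _ n ih =>
    intro hn x hx
    have hx0 := hx.1
    have hx1 : 0 < 1 - x := by linarith [hx.2]
    have hn5 : 5 + 2 * r ≤ n := (le_max_right _ _).trans hn
    have hn0 : (0 : ℝ) < n := by
      have : 0 < n := by omega
      exact_mod_cast this
    have hn1 : (1 : ℝ) ≤ n := by
      have : 1 ≤ n := by omega
      exact_mod_cast this
    set v := x ^ (p - r / 2) * (1 - x) ^ (q - r / 2) with hv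
    have hv0 : 0 < v := by positivity
    rcases lt_or_ge n (A * N₁) with hlt | hge
    · have hv1 : 1 ≤ v := by
        rw [hv]
        have f1 := Real.one_le_rpow_of_pos_of_le_one_of_nonpos hx0 hx.2.le
          (show p - r / 2 ≤ 0 by linarith)
        have f2 := Real.one_le_rpow_of_pos_of_le_one_of_nonpos hx1 (by linarith)
          (show q - r / 2 ≤ 0 by linarith)
        nlinarith
      have hne : 1 ≤ (n : ℝ) ^ e := Real.one_le_rpow hn1 he0.le
      have hbΓ : b n ≤ Γ := by
        have := Finset.single_le_sum (fun n _ => hb0 n) (Finset.mem_range.2 hlt)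
        have : 0 < C₁ * C₃ := by positivity
        linarith
      calc _ ≤ b n := hb n x hx
        _ ≤ Γ := hbΓ
        _ ≤ Γ * (n : ℝ) ^ e := le_mul_of_one_le_right hΓ0.le hne
        _ ≤ _ := le_mul_of_one_le_right (by positivity) hv1
    · set m := n / A with hm
      have hmN : N₁ ≤ m := by
        rw [hm, Nat.le_div_iff_mul_le (by omega), mul_comm]
        exact hge
      have hm1 : 1 ≤ m := by omega
      have hmA : (m : ℝ) * A ≤ n := by exact_mod_cast Nat.div_mul_le_self n A
      have hnm : (n : ℝ) ≤ 2 * A * m := by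
        have h4 : n < A * (m + 1) := by
          have := Nat.lt_div_mul_add (a := n) (b := A) (by omega)
          rw [← hm] at this
          nlinarith
        have h5 : (n : ℝ) < A * (m + 1) := by exact_mod_cast h4
        have h6 : (1 : ℝ) ≤ m := by exact_mod_cast hm1
        nlinarith
      set g := fun t => (combPoly (r - 1) d c m (modified ψ r m f)).eval t with hg
      have hgG : ∀ y ∈ Ioo (0 : ℝ) 1,
          |(derivative^[r] (combPoly (r - 1) d c m (modified ψ r m f))).eval y| ≤
          Γ * (m : ℝ) ^ e * (y ^ (p - r / 2) * (1 - y) ^ (q - r / 2)) := by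
        exact ih m (Nat.div_lt_self (by omega) hA1) hmN
      have hD1 := h₁ n (fun t => f t - g t) (C₃ * (n : ℝ) ^ (-(a₀ / 2))) hn5 (by positivity)
        (fun y hy => by
          have := h₃ m n ((le_max_left _ _).trans hmN) hm1 (by omega) hnm y hy
          rw [hg]
          simp only [eval_combPoly]
          exact this) x hx
      have hD2 := h₂ n (fun j z => (derivative^[j]
        (combPoly (r - 1) d c m (modified ψ r m f))).eval z) (Γ * (m : ℝ) ^ e) hn5 (by positivity)
        (fun j _ z => hasDerivAt_iterate_derivative _ j z) hgG x hx
      simp only [Function.iterate_zero_apply, ← hg] at hD2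
      change _ ≤ C₂ * (Γ * (m : ℝ) ^ e * v) at hD2
      change _ ≤ C₁ * (C₃ * (n : ℝ) ^ (-(a₀ / 2)) * (n : ℝ) ^ ((r : ℝ) / 2) * v) at hD1
      have hsplit : combPoly (r - 1) d c n (modified ψ r n f) =
          combPoly (r - 1) d c n (modified ψ r n (fun t => f t - g t)) +
            combPoly (r - 1) d c n (modified ψ r n g) := by
        rw [combPoly_sub (modified ψ r n f) (modified ψ r n g)]
        congr 2
        funext t
        rw [modified_sub]
      have hpow : (n : ℝ) ^ (-(a₀ / 2)) * (n : ℝ) ^ ((r : ℝ) / 2) = (n : ℝ) ^ e := by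
        rw [← Real.rpow_add hn0, he]
        congr 1
        ring
      have hmn : C₂ * (m : ℝ) ^ e ≤ (n : ℝ) ^ e / 2 := by
        have h7 : (m : ℝ) ^ e * (A : ℝ) ^ e ≤ (n : ℝ) ^ e := by
          rw [← Real.mul_rpow (Nat.cast_nonneg m) (Nat.cast_nonneg A)]
          exact Real.rpow_le_rpow (by positivity) hmA he0.le
        have h8 : 0 ≤ (m : ℝ) ^ e := by positivity
        nlinarith
      rw [hsplit, iterate_map_add, eval_add]
      refine ((abs_add_le _ _).trans (add_le_add hD1 hD2)).trans ?_
      have heq : C₁ * (C₃ * (n : ℝ) ^ (-(a₀ / 2)) * (n : ℝ) ^ ((r : ℝ) / 2) * v) +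
          C₂ * (Γ * (m : ℝ) ^ e * v) =
          C₁ * C₃ * (n : ℝ) ^ e * v + Γ * v * (C₂ * (m : ℝ) ^ e) := by
        rw [mul_assoc C₃, hpow]
        ring
      rw [heq]
      calc _ ≤ C₁ * C₃ * (n : ℝ) ^ e * v + Γ * v * ((n : ℝ) ^ e / 2) := by gcongr
        _ ≤ Γ * (n : ℝ) ^ e * v := by
          have h9 : 0 ≤ (Γ - 2 * (C₁ * C₃)) * ((n : ℝ) ^ e * v) :=
            mul_nonneg (by linarith) (by positivity)
          linarith

end Inverse

/-! ### Forward differences near the end -/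

/-- Doubling the step: `Δ_{2h}^r f(y) = ∑ C(r,j) Δ_h^r f(y + j h)`, where the term `j = 0` is kept
apart. -/
lemma abs_fwdDiff_double_le (r : ℕ) (f : ℝ → ℝ) (h y : ℝ) {X B : ℝ}
    (hX : |(fwdDiff h)^[r] f y| ≤ X)
    (hB : ∀ j : ℕ, 1 ≤ j → j ≤ r → |(fwdDiff h)^[r] f (y + j * h)| ≤ B) :
    |(fwdDiff (h + h))^[r] f y| ≤ X + (2 ^ r - 1) * B := by
  induction r generalizing f y X with
  | zero => simpa using hX
  | succ r ih =>
    rw [Function.iterate_succ_apply] at hX ⊢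
    simp only [Function.iterate_succ_apply] at hB
    set u := fwdDiff h f with hu
    have hsplit : fwdDiff (h + h) f = u + fun t => u (t + h) := by
      funext t
      simp only [hu, fwdDiff, Pi.add_apply]
      rw [add_assoc]
      ring
    rw [hsplit, fwdDiff_iter_add, Pi.add_apply]
    have h1 := ih u y hX fun j hj hjr => hB j hj (by omega)
    have h2 := ih (fun t => u (t + h)) y (X := B) (by
        rw [fwdDiff_iter_comp_add]
        simpa using hB 1 le_rfl (by omega)) fun j hj hjr => by
        rw [fwdDiff_iter_comp_add]
        have := hB (j + 1) (by omega) (by omega)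
        push_cast at this
        rwa [add_mul, one_mul, ← add_assoc] at this
    refine (abs_add_le _ _).trans ?_
    have : (2 : ℝ) ^ (r + 1) = 2 * 2 ^ r := by rw [pow_succ]; ring
    rw [this]
    linarith

/-- Halving the step extends a bound for forward differences from steps `h ≤ y` to all steps. -/
lemma halfSmooth_of_small_steps {r : ℕ} {α lam a₀ : ℝ} {f : ℝ → ℝ} (hα : 0 < α) (ha₀ : 0 < a₀)
    (hlam0 : 0 ≤ lam) (hlam1 : lam ≤ 1) {C h₀ : ℝ} (hC : 0 < C) (hh₀ : 0 < h₀)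
    (H : ∀ y ∈ Ioc (0 : ℝ) (13 / 16), ∀ h ∈ Ioc (0 : ℝ) h₀, h ≤ y →
      |forwardDiff r f h y| ≤ C * (h ^ a₀ * y ^ (-(lam * a₀ / 2)) * y ^ (-α))) :
    HalfSmooth r α lam a₀ f := by
  set b := a₀ - lam * a₀ / 2 with hb
  have hb0 : 0 < b := by rw [hb]; nlinarith
  have hla : 0 ≤ lam * a₀ / 2 := by positivity
  have hhalf : (1 / 2 : ℝ) ^ b < 1 := Real.rpow_lt_one (by norm_num) (by norm_num) hb0
  have hgap : 0 < 1 - (1 / 2 : ℝ) ^ b := by linarith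
  set C' := C + 2 ^ r * C / (1 - (1 / 2 : ℝ) ^ b) with hC'
  have hC'0 : 0 < C' := by positivity
  have hsplit : ∀ h : ℝ, 0 < h → h ^ a₀ * h ^ (-(lam * a₀ / 2)) = h ^ b := fun h hh => by
    rw [← Real.rpow_add hh, hb, sub_eq_add_neg]
  set h₁ := min h₀ (1 / (16 * (r + 1))) with hh₁
  have hh₁0 : 0 < h₁ := by positivity
  -- for `h ≤ y` the given bound is stronger than the one with `h ^ b`
  have hsmall : ∀ y ∈ Ioc (0 : ℝ) (13 / 16), ∀ h ∈ Ioc (0 : ℝ) h₁, h ≤ y →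
      |forwardDiff r f h y| ≤ C * (h ^ b * y ^ (-α)) := by
    intro y hy h hh hhy
    refine (H y hy h ⟨hh.1, hh.2.trans (min_le_left _ _)⟩ hhy).trans ?_
    have := Real.rpow_le_rpow_of_nonpos hh.1 hhy (show -(lam * a₀ / 2) ≤ 0 by linarith)
    have hy0 := hy.1
    have hh0 := hh.1
    rw [← hsplit h hh0]
    gcongr
  have hiter : ∀ (i : ℕ) (y : ℝ), y ∈ Ioc (0 : ℝ) (3 / 4) → ∀ h ∈ Ioc (0 : ℝ) h₁, h ≤ 2 ^ i * y →
      |forwardDiff r f h y| ≤ C' * (h ^ b * y ^ (-α)) := by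
    intro i
    induction i with
    | zero =>
      intro y hy h hh hhy
      rw [pow_zero, one_mul] at hhy
      have hy0 := hy.1
      have hh0 := hh.1
      refine (hsmall y ⟨hy.1, by linarith [hy.2]⟩ h hh hhy).trans ?_
      have : C ≤ C' := by
        rw [hC']
        have : 0 ≤ 2 ^ r * C / (1 - (1 / 2 : ℝ) ^ b) := by positivity
        linarith
      gcongr
    | succ i ih =>
      intro y hy h hh hhy
      have hy0 := hy.1
      have hh0 := hh.1
      have hstep : h / 2 ∈ Ioc (0 : ℝ) h₁ := ⟨by positivity, by linarith [hh.2]⟩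
      have h1 := ih y hy (h / 2) hstep (by rw [pow_succ] at hhy; linarith)
      have h2 : ∀ j : ℕ, 1 ≤ j → j ≤ r → |(fwdDiff (h / 2))^[r] f (y + j * (h / 2))| ≤
          C * (h ^ b * y ^ (-α)) := by
        intro j hj hjr
        have hj1 : (1 : ℝ) ≤ j := by exact_mod_cast hj
        have hjr' : (j : ℝ) ≤ r := by exact_mod_cast hjr
        have hjh : h / 2 ≤ j * (h / 2) := le_mul_of_one_le_left (by positivity) hj1
        have hjh2 : (j : ℝ) * (h / 2) ≤ 1 / 16 := by
          have h3 : h ≤ 1 / (16 * (r + 1)) := hh.2.trans (min_le_right _ _)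
          rw [le_div_iff₀ (by positivity)] at h3
          nlinarith
        rw [← forwardDiff_eq_iterate]
        refine (hsmall _ ⟨by linarith, by linarith [hy.2]⟩ _ hstep (by linarith)).trans ?_
        have e1 : (h / 2) ^ b ≤ h ^ b := Real.rpow_le_rpow (by positivity) (by linarith) hb0.le
        have e2 : (y + j * (h / 2)) ^ (-α) ≤ y ^ (-α) :=
          Real.rpow_le_rpow_of_nonpos hy0 (by linarith) (by linarith)
        gcongr
      rw [forwardDiff_eq_iterate] at h1 ⊢
      have h3 := abs_fwdDiff_double_le r f (h / 2) y h1 h2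
      rw [add_halves] at h3
      refine h3.trans ?_
      have e3 : (h / 2) ^ b = (1 / 2 : ℝ) ^ b * h ^ b := by
        rw [← Real.mul_rpow (by norm_num) hh0.le]
        congr 1
        ring
      have e4 : C' * (1 - (1 / 2 : ℝ) ^ b) = C * (1 - (1 / 2 : ℝ) ^ b) + 2 ^ r * C := by
        rw [hC', add_mul, div_mul_cancel₀ _ hgap.ne']
      have hW : 0 < h ^ b * y ^ (-α) := by positivity
      rw [e3]
      have e5 : 0 ≤ (C * (1 - (1 / 2 : ℝ) ^ b) + C) * (h ^ b * y ^ (-α)) := by positivity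
      nlinarith
  refine ⟨C', h₁, hC'0, hh₁0, fun y hy h hh => ?_⟩
  have hy0 := hy.1
  have hh0 := hh.1
  rcases le_total h y with hhy | hhy
  · rw [max_eq_right hhy]
    refine (H y ⟨hy.1, by linarith [hy.2]⟩ h ⟨hh.1, hh.2.trans (min_le_left _ _)⟩ hhy).trans ?_
    have : C ≤ C' := by
      rw [hC']
      have : 0 ≤ 2 ^ r * C / (1 - (1 / 2 : ℝ) ^ b) := by positivity
      linarith
    gcongr
  · rw [max_eq_left hhy, hsplit h hh0]
    obtain ⟨i, hi⟩ := pow_unbounded_of_one_lt (h / y) one_lt_two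
    exact hiter i y hy h hh (by rw [div_lt_iff₀ hy0] at hi; exact hi.le)

section Inverse

open Polynomial

variable {r : ℕ} {ψ : ℝ → ℝ} {d : ℕ → ℕ → ℕ} {c : ℕ → ℕ → ℝ} {α β a₀ lam : ℝ} {f : ℝ → ℝ}

/-- The pointwise rate on the local scale: if `h` is at least the local scale at `y` of level `n`,
the error near `y` is of order `h ^ a₀ · y ^ (-lam a₀ / 2 - α)`. -/
lemma rate_le_local {C E y h z : ℝ} {n : ℕ} (hα : 0 < α) (hβ : 0 < β) (ha₀ : 0 < a₀)
    (hlam0 : 0 ≤ lam) (hlam1 : lam ≤ 1) (hy0 : 0 < y) (hh0 : 0 < h) (hn1 : y / h ^ 2 ≤ n)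
    (hnh : 1 / h ≤ n) (hzy : y ≤ z) (hzr : z ≤ (r + 1) * y) (hz78 : 1 / 8 ≤ 1 - z)
    (hE : weight α β z * E ≤ C * ((n : ℝ) ^ (-(1 / 2) : ℝ) * phi z ^ (-lam) * delta n z) ^ a₀) :
    E ≤ (|C| + 1) * (8 * (r + 2)) ^ a₀ * 8 ^ β *
      (h ^ a₀ * y ^ (-(lam * a₀ / 2)) * y ^ (-α)) := by
  have hr0 : (0 : ℝ) ≤ r := Nat.cast_nonneg r
  set κ : ℝ := 8 * (r + 2) with hκ
  have hκ0 : 0 < κ := by positivity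
  have hn0 : (0 : ℝ) < n := lt_of_lt_of_le (by positivity) hnh
  have hz' : z ∈ Ioo (0 : ℝ) 1 := ⟨by linarith, by linarith⟩
  have hφ := phi_pos hz'
  have hsn : 0 < Real.sqrt n := Real.sqrt_pos.2 hn0
  have e1 : 1 / Real.sqrt n * phi z ≤ (r + 1) * h := by
    rw [div_mul_eq_mul_div, one_mul, div_le_iff₀ hsn]
    have h6 : phi z ≤ Real.sqrt (((r + 1) * h) ^ 2 * n) := by
      refine Real.sqrt_le_sqrt ?_
      have h7 : y ≤ n * h ^ 2 := by rwa [div_le_iff₀ (by positivity)] at hn1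
      calc z * (1 - z) ≤ z := mul_le_of_le_one_right hz'.1.le (by linarith [hz'.1])
        _ ≤ (r + 1) * y := hzr
        _ ≤ (r + 1) * (n * h ^ 2) := by gcongr
        _ ≤ (r + 1) * ((r + 1) * (n * h ^ 2)) := by
          have : 0 ≤ (r : ℝ) * ((r + 1) * (n * h ^ 2)) := by positivity
          linarith
        _ = ((r + 1) * h) ^ 2 * n := by ring
    rw [Real.sqrt_mul (by positivity), Real.sqrt_sq (by positivity)] at h6
    exact h6
  have e2 : 1 / Real.sqrt n * (1 / Real.sqrt n) ≤ h := by
    rw [div_mul_div_comm, Real.mul_self_sqrt hn0.le, one_mul, div_le_iff₀ hn0]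
    have : 1 ≤ h * (1 / h) := by rw [mul_one_div_cancel hh0.ne']
    nlinarith
  have e3 : phi z ^ (-lam) ≤ 8 * y ^ (-(lam / 2)) := by
    rw [phi_rpow hz']
    have f1 : z ^ (-lam / 2) ≤ y ^ (-(lam / 2)) := by
      rw [neg_div]
      exact Real.rpow_le_rpow_of_nonpos hy0 hzy (by linarith)
    have f2 : (1 - z) ^ (-lam / 2) ≤ 8 := by
      calc (1 - z) ^ (-lam / 2) ≤ (1 / 8 : ℝ) ^ (-lam / 2) :=
            Real.rpow_le_rpow_of_nonpos (by norm_num) hz78 (by linarith)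
        _ = 8 ^ (lam / 2) := by
            rw [one_div, Real.inv_rpow (by norm_num), neg_div, Real.rpow_neg (by norm_num),
              inv_inv]
        _ ≤ 8 ^ (1 : ℝ) := Real.rpow_le_rpow_of_exponent_le (by norm_num) (by linarith)
        _ = 8 := Real.rpow_one 8
    rw [mul_comm (8 : ℝ)]
    have : 0 ≤ (1 - z) ^ (-lam / 2) := Real.rpow_nonneg (by linarith) _
    gcongr
  have hB : (n : ℝ) ^ (-(1 / 2) : ℝ) * phi z ^ (-lam) * delta n z ≤
      κ * (h * y ^ (-(lam / 2))) := by
    rw [inv_sqrt_eq_rpow, delta]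
    calc _ = (1 / Real.sqrt n * phi z + 1 / Real.sqrt n * (1 / Real.sqrt n)) *
          phi z ^ (-lam) := by ring
      _ ≤ ((r + 1) * h + h) * (8 * y ^ (-(lam / 2))) := by gcongr
      _ = _ := by rw [hκ]; ring
  have hB0 : 0 ≤ (n : ℝ) ^ (-(1 / 2) : ℝ) * phi z ^ (-lam) * delta n z := by
    have : 0 ≤ delta n z := by unfold delta; positivity
    positivity
  refine (le_weight_inv_mul hz' hE).trans ?_
  have g1 : z ^ (-α) ≤ y ^ (-α) := Real.rpow_le_rpow_of_nonpos hy0 hzy (by linarith)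
  have g2 : (1 - z) ^ (-β) ≤ 8 ^ β := by
    calc (1 - z) ^ (-β) ≤ (1 / 8 : ℝ) ^ (-β) :=
          Real.rpow_le_rpow_of_nonpos (by norm_num) hz78 (by linarith)
      _ = 8 ^ β := by
          rw [one_div, Real.inv_rpow (by norm_num), Real.rpow_neg (by norm_num), inv_inv]
  have hz0 := hz'.1
  have hz1 : 0 < 1 - z := by linarith
  have hCa := le_abs_self C
  calc _ ≤ (|C| + 1) * (κ * (h * y ^ (-(lam / 2)))) ^ a₀ * (y ^ (-α) * 8 ^ β) := by
        gcongr
        linarith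
    _ = _ := by
        rw [Real.mul_rpow hκ0.le (by positivity), Real.mul_rpow (x := h) hh0.le (by positivity),
          ← Real.rpow_mul hy0.le, show -(lam / 2) * a₀ = -(lam * a₀ / 2) by ring]
        ring

/-- The inverse estimate: at the point `y` with step `h ≤ y` the level `n ≈ y / h²` has local
scale `h`. -/
lemma StarRate.halfSmooth (hr : 2 ≤ r) (hψ : IsCutoff r ψ)
    (hdc : IsCombination (r - 1) d c) (hα : 0 < α) (hβ : 0 < β) (ha₀ : 0 < a₀) (har : a₀ < r)
    (hlam0 : 0 ≤ lam) (hlam1 : lam ≤ 1) (hE : StarRate α β r a₀ lam d c ψ f) :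
    HalfSmooth r α lam a₀ f := by
  obtain ⟨Γ, N₁, hΓ, hD⟩ := hE.exists_abs_derivative_le hr hψ hdc hα hβ ha₀ har hlam0
  obtain ⟨C, N₀, hE'⟩ := hE
  set e := ((r : ℝ) - a₀) / 2 with he
  have he0 : 0 < e := by rw [he]; linarith
  have hla : (1 - lam) * a₀ ≤ r := by nlinarith
  have hp : (1 - lam) * a₀ / 2 - α - r / 2 ≤ 0 := by linarith
  have hq : (1 - lam) * a₀ / 2 - β - r / 2 ≤ 0 := by linarith
  have hr0 : (0 : ℝ) ≤ r := Nat.cast_nonneg r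
  set q := (1 - lam) * a₀ / 2 - β - r / 2 with hqdef
  set h₀ := min (1 / ((N₀ : ℝ) + N₁ + 1)) (1 / (16 * (r + 1))) with hh₀
  have hh₀0 : 0 < h₀ := by positivity
  set κ : ℝ := 8 * (r + 2) with hκ
  have hκ0 : 0 < κ := by positivity
  refine halfSmooth_of_small_steps (C := 2 ^ r * ((|C| + 1) * κ ^ a₀ * 8 ^ β) +
    Γ * 2 ^ e * 8 ^ (-q)) (h₀ := h₀) hα ha₀ hlam0 hlam1 (by positivity) hh₀0
    fun y hy h hh hhy => ?_
  have hy0 := hy.1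
  have hh0 := hh.1
  have hrh : r * h ≤ 1 / 16 := by
    have h3 : h ≤ 1 / (16 * (r + 1)) := hh.2.trans (min_le_right _ _)
    rw [le_div_iff₀ (by positivity)] at h3
    nlinarith
  have hh1 : h ≤ 1 / ((N₀ : ℝ) + N₁ + 1) := hh.2.trans (min_le_left _ _)
  set n := ⌈y / h ^ 2⌉₊ with hn
  have hyh : 1 / h ≤ y / h ^ 2 := by
    rw [div_le_div_iff₀ hh0 (by positivity)]
    nlinarith
  have hNh : (N₀ : ℝ) + N₁ + 1 ≤ 1 / h := by
    rw [le_div_iff₀ hh0]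
    rw [le_div_iff₀ (by positivity)] at hh1
    linarith
  have hn1 : y / h ^ 2 ≤ n := Nat.le_ceil _
  have hn2 : (n : ℝ) ≤ 2 * (y / h ^ 2) := by
    have := Nat.ceil_lt_add_one (show 0 ≤ y / h ^ 2 by positivity)
    have h5 : (0 : ℝ) ≤ (N₀ : ℝ) + N₁ := by positivity
    rw [← hn] at this
    linarith
  have hnN : (N₀ : ℝ) + N₁ + 1 ≤ n := by linarith
  have hnN' : N₀ + N₁ + 1 ≤ n := by exact_mod_cast hnN
  have hn0 : (0 : ℝ) < n := by
    have : 0 < n := by omega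
    exact_mod_cast this
  set P := combPoly (r - 1) d c n (modified ψ r n f) with hP
  -- the approximation error at the nodes of the difference
  have herr : ∀ j ≤ r, |(fun t => f t - P.eval t) (y + j • h)| ≤
      (|C| + 1) * κ ^ a₀ * 8 ^ β * (h ^ a₀ * y ^ (-(lam * a₀ / 2)) * y ^ (-α)) := by
    intro j hj
    have hj' : (j : ℝ) ≤ r := by exact_mod_cast hj
    have hj0 : (0 : ℝ) ≤ j := Nat.cast_nonneg j
    have hjh : (j : ℝ) * h ≤ r * h := by gcongr
    have hjh0 : 0 ≤ (j : ℝ) * h := by positivity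
    rw [nsmul_eq_mul]
    have hzr : y + j * h ≤ (r + 1) * y := by nlinarith
    have hz78 : 1 / 8 ≤ 1 - (y + j * h) := by linarith [hy.2]
    have hloc := rate_le_local (r := r) hα hβ ha₀ hlam0 hlam1 hy0 hh0 hn1 (hyh.trans hn1)
      (by linarith : y ≤ y + j * h) hzr hz78 (hE' n (by omega) _ ⟨by linarith, by linarith⟩)
    simp only [hP, eval_combPoly]
    exact hloc
  have h1 := abs_fwdDiff_iter_le_two_pow h r (fun t => f t - P.eval t) y herr
  have h2 := abs_fwdDiff_iter_le_of_chain r (fun j z => (derivative^[j] P).eval z)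
    (fun j _ z => hasDerivAt_iterate_derivative P j z) (h := h) (y := y)
    (M := Γ * (2 * (y / h ^ 2)) ^ e * (y ^ ((1 - lam) * a₀ / 2 - α - r / 2) * 8 ^ (-q))) hh0.le
    fun z hz => by
      have hz78 : 1 / 8 ≤ 1 - z := by linarith [hy.2, hz.2]
      have hz0 : 0 < z := lt_of_lt_of_le hy0 hz.1
      refine (hD n (by omega) z ⟨hz0, by linarith⟩).trans ?_
      have g1 := Real.rpow_le_rpow_of_nonpos hy0 hz.1 hp
      have g2 : (1 - z) ^ q ≤ 8 ^ (-q) := by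
        calc (1 - z) ^ q ≤ (1 / 8 : ℝ) ^ q :=
              Real.rpow_le_rpow_of_nonpos (by norm_num) hz78 hq
          _ = 8 ^ (-q) := by
              rw [one_div, Real.inv_rpow (by norm_num), Real.rpow_neg (by norm_num)]
      have : 0 ≤ (1 - z) ^ q := Real.rpow_nonneg (by linarith) _
      gcongr
  have hexp : h ^ r * (Γ * (2 * (y / h ^ 2)) ^ e *
      (y ^ ((1 - lam) * a₀ / 2 - α - r / 2) * 8 ^ (-q))) =
      Γ * 2 ^ e * 8 ^ (-q) * (h ^ a₀ * y ^ (-(lam * a₀ / 2)) * y ^ (-α)) := by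
    have k1 : (y / h ^ 2) ^ e = y ^ e * h ^ (-((r : ℝ) - a₀)) := by
      rw [Real.div_rpow hy0.le (by positivity), Real.rpow_neg hh0.le, ← Real.rpow_natCast h 2,
        ← Real.rpow_mul hh0.le, div_eq_mul_inv]
      congr 3
      rw [he]
      push_cast
      ring
    have k2 : h ^ r * h ^ (-((r : ℝ) - a₀)) = h ^ a₀ := by
      rw [← Real.rpow_natCast, ← Real.rpow_add hh0]
      congr 1
      ring
    have k3 : y ^ e * y ^ ((1 - lam) * a₀ / 2 - α - r / 2) = y ^ (-(lam * a₀ / 2)) * y ^ (-α) := by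
      rw [← Real.rpow_add hy0, ← Real.rpow_add hy0]
      congr 1
      rw [he]
      ring
    rw [Real.mul_rpow (by norm_num) (by positivity), k1]
    calc _ = Γ * 2 ^ e * 8 ^ (-q) * ((h ^ r * h ^ (-((r : ℝ) - a₀))) *
          (y ^ e * y ^ ((1 - lam) * a₀ / 2 - α - r / 2))) := by ring
      _ = _ := by rw [k2, k3]; ring
  rw [hexp] at h2
  have hsplit : f = (fun t => f t - P.eval t) + fun t => P.eval t := by
    funext t
    simp
  rw [forwardDiff_eq_iterate, hsplit, fwdDiff_iter_add, Pi.add_apply]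
  refine (abs_add_le _ _).trans ?_
  have h2' : |(fwdDiff h)^[r] (fun t => P.eval t) y| ≤ _ := h2
  rw [add_mul]
  refine add_le_add (h1.trans (le_of_eq (by ring))) h2'

end Inverse

/-! ### Smoothing by averages -/

/-- The average of `F` over `[y, y + s]`. -/
noncomputable def avg (s : ℝ) (F : ℝ → ℝ) (y : ℝ) : ℝ := ∫ u in (0 : ℝ)..1, F (y + s * u)

lemma avg_zero (F : ℝ → ℝ) : avg 0 F = F := by
  funext y
  simp [avg]

lemma continuous_avg (s : ℝ) {F : ℝ → ℝ} (hF : Continuous F) : Continuous (avg s F) := by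
  unfold avg
  refine intervalIntegral.continuous_parametric_intervalIntegral_of_continuous' ?_ 0 1
  fun_prop

lemma continuous_iterate_avg (s : ℝ) {F : ℝ → ℝ} (hF : Continuous F) (j : ℕ) :
    Continuous ((avg s)^[j] F) := by
  induction j with
  | zero => exact hF
  | succ j ih =>
    rw [Function.iterate_succ_apply']
    exact continuous_avg s ih

lemma hasDerivAt_avg {s : ℝ} (hs : s ≠ 0) {F : ℝ → ℝ} (hF : Continuous F) (y : ℝ) :
    HasDerivAt (avg s F) (s⁻¹ * fwdDiff s F y) y := by
  have h1 : avg s F = fun y => s⁻¹ * ((∫ t in (0 : ℝ)..(y + s), F t) - ∫ t in (0 : ℝ)..y, F t) := by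
    funext z
    rw [avg, intervalIntegral.integral_comp_add_mul (fun t => F t) hs z, smul_eq_mul,
      intervalIntegral.integral_interval_sub_left (hF.intervalIntegrable _ _)
        (hF.intervalIntegrable _ _)]
    simp
  have h2 : ∀ z, HasDerivAt (fun y => ∫ t in (0 : ℝ)..y, F t) (F z) z := fun z =>
    (hF.integral_hasStrictDerivAt 0 z).hasDerivAt
  rw [h1]
  exact (((h2 (y + s)).comp_add_const y s).sub (h2 y)).const_mul _

lemma hasDerivAt_fwdDiff_iter (s : ℝ) (j : ℕ) {H H' : ℝ → ℝ} (h : ∀ z, HasDerivAt H (H' z) z)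
    (z : ℝ) : HasDerivAt ((fwdDiff s)^[j] H) ((fwdDiff s)^[j] H' z) z := by
  induction j generalizing H H' with
  | zero => exact h z
  | succ j ih =>
    rw [Function.iterate_succ_apply, Function.iterate_succ_apply]
    exact ih fun z => ((h (z + s)).comp_add_const z s).sub (h z)

/-- Iterated averages with different steps inherit bounds for linear combinations of values. -/
lemma abs_sum_iterate_avg_le {F : ℝ → ℝ} (hF : Continuous F) (m : ℕ) (c s : ℕ → ℝ) {M : ℝ} (j : ℕ)
    (y : ℕ → ℝ)
    (h : ∀ u ∈ Icc (0 : ℝ) j, |∑ k ∈ Finset.range m, c k * F (y k + s k * u)| ≤ M) :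
    |∑ k ∈ Finset.range m, c k * (avg (s k))^[j] F (y k)| ≤ M := by
  induction j generalizing y with
  | zero => simpa using h 0 (by simp)
  | succ j ih =>
    have hint : ∑ k ∈ Finset.range m, c k * (avg (s k))^[j + 1] F (y k) =
        ∫ u in (0 : ℝ)..1, ∑ k ∈ Finset.range m, c k * (avg (s k))^[j] F (y k + s k * u) := by
      rw [intervalIntegral.integral_finsetSum]
      · refine Finset.sum_congr rfl fun k _ => ?_
        rw [Function.iterate_succ_apply', avg, intervalIntegral.integral_const_mul]
      · intro k _
        have := continuous_iterate_avg (s k) hF j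
        exact Continuous.intervalIntegrable (by fun_prop) _ _
    rw [hint]
    have hb := intervalIntegral.norm_integral_le_of_norm_le_const (a := 0) (b := 1) (C := M)
      (f := fun u => ∑ k ∈ Finset.range m, c k * (avg (s k))^[j] F (y k + s k * u))
      (fun u hu => by
        rw [uIoc_of_le zero_le_one] at hu
        refine ih (fun k => y k + s k * u) fun v hv => ?_
        have := h (u + v) ⟨by linarith [hu.1, hv.1], by push_cast; linarith [hu.2, hv.2]⟩
        simpa only [mul_add, add_assoc] using this)
    simpa using hb

/-- A continuous function has a smoothing `G 0` with derivatives `G 1, …, G r`, such that the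
error and the `r`-th derivative at a point are controlled by forward differences at that point. -/
lemma exists_smoothing {r : ℕ} (hr : 1 ≤ r) {F : ℝ → ℝ} (hF : Continuous F) {s : ℝ} (hs : 0 < s) :
    ∃ G : ℕ → ℝ → ℝ, (∀ j < r, ∀ z, HasDerivAt (G j) (G (j + 1) z) z) ∧
      ∀ y M : ℝ, 0 ≤ M → (∀ h ∈ Ioc (0 : ℝ) (r * s), |forwardDiff r F h y| ≤ M) →
        |F y - G 0 y| ≤ M ∧ |G r y| ≤ 2 ^ r * (s ^ r)⁻¹ * M := by
  set c : ℕ → ℝ := fun k => (-1) ^ k * (r.choose k : ℝ) with hc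
  set t : ℕ → ℝ := fun k => ((r : ℝ) - k) * s with ht
  refine ⟨fun j z => -(-1) ^ r * ∑ k ∈ Finset.range r,
    c k * (((t k)⁻¹) ^ j * (fwdDiff (t k))^[j] ((avg (t k))^[r - j] F) z), ?_, ?_⟩
  · intro j hj z
    refine HasDerivAt.const_mul _ (HasDerivAt.fun_sum fun k hk => HasDerivAt.const_mul _ ?_)
    have hk' : (k : ℝ) < r := by exact_mod_cast Finset.mem_range.1 hk
    have htk : t k ≠ 0 := (mul_pos (by linarith) hs).ne'
    have h1 : (avg (t k))^[r - j] F = avg (t k) ((avg (t k))^[r - (j + 1)] F) := by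
      rw [← Function.iterate_succ_apply' (avg (t k)), show (r - (j + 1)).succ = r - j by omega]
    rw [h1]
    have h2 := hasDerivAt_fwdDiff_iter (t k) j
      (fun z => hasDerivAt_avg htk (continuous_iterate_avg (t k) hF (r - (j + 1))) z) z
    refine (h2.const_mul _).congr_deriv ?_
    have h3 : (fun z => (t k)⁻¹ * fwdDiff (t k) ((avg (t k))^[r - (j + 1)] F) z) =
        (t k)⁻¹ • fwdDiff (t k) ((avg (t k))^[r - (j + 1)] F) := rfl
    rw [h3, fwdDiff_iter_const_smul, ← Function.iterate_succ_apply, Pi.smul_apply, smul_eq_mul,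
      pow_succ]
    ring
  · intro y M hM h
    have hsum0 : ∑ k ∈ Finset.range (r + 1), c k = 0 := by
      have := Int.alternating_sum_range_choose_of_ne (n := r) (by omega)
      have h4 := congrArg (Int.cast : ℤ → ℝ) this
      push_cast at h4
      exact h4
    constructor
    · have h1 := abs_sum_iterate_avg_le hF (r + 1) c t (M := M) r (fun _ => y) fun u hu => by
        rcases eq_or_lt_of_le hu.1 with h0 | h0
        · rw [← h0]
          simp only [mul_zero, add_zero]
          rw [← Finset.sum_mul, hsum0]
          simpa using hM
        · have := h (s * u) ⟨by positivity, by nlinarith [hu.2]⟩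
          rw [forwardDiff] at this
          simpa only [hc, ht, mul_assoc] using this
      rw [Finset.sum_range_succ] at h1
      have e1 : t r = 0 := by simp [ht]
      have e2 : (avg 0)^[r] F = F := by
        have : avg 0 = id := funext avg_zero
        rw [this, Function.iterate_id, id]
      rw [e1, e2] at h1
      have e3 : |(-1 : ℝ) ^ r| = 1 := by simp
      have e4 : (-1 : ℝ) ^ r * (-1) ^ r = 1 := by rw [← mul_pow]; norm_num
      have e5 : c r = (-1) ^ r := by simp [hc]
      rw [e5] at h1
      have e6 : F y - -(-1) ^ r * ∑ k ∈ Finset.range r,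
          c k * (((t k)⁻¹) ^ 0 * (fwdDiff (t k))^[0] ((avg (t k))^[r - 0] F) y) =
          (-1) ^ r * (∑ k ∈ Finset.range r, c k * (avg (t k))^[r] F y + (-1) ^ r * F y) := by
        simp only [pow_zero, one_mul, Function.iterate_zero_apply, Nat.sub_zero]
        linear_combination (-F y) * e4
      rw [e6, abs_mul, e3, one_mul]
      exact h1
    · rw [abs_mul]
      have e3 : |-(-1 : ℝ) ^ r| = 1 := by simp
      rw [e3, one_mul]
      have hb : ∀ k ∈ Finset.range r, |c k * (((t k)⁻¹) ^ r *
          (fwdDiff (t k))^[r] ((avg (t k))^[r - r] F) y)| ≤ (r.choose k : ℝ) * ((s ^ r)⁻¹ * M) := by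
        intro k hk
        have hk' : (k : ℝ) + 1 ≤ r := by exact_mod_cast Finset.mem_range.1 hk
        have hk0 : (0 : ℝ) ≤ k := Nat.cast_nonneg k
        have hts : s ≤ t k := by
          simp only [ht]
          nlinarith
        have ht0 : 0 < t k := by linarith
        have hck : |c k| = (r.choose k : ℝ) := by
          simp [hc, abs_mul]
        rw [Nat.sub_self, Function.iterate_zero_apply, abs_mul (c k), hck, abs_mul,
          ← forwardDiff_eq_iterate]
        have h5 := h (t k) ⟨ht0, by simp only [ht]; nlinarith⟩
        have h6 : |((t k)⁻¹) ^ r| ≤ (s ^ r)⁻¹ := by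
          rw [abs_of_nonneg (by positivity), ← inv_pow]
          gcongr
        gcongr
      have hch : ∑ k ∈ Finset.range r, (r.choose k : ℝ) ≤ 2 ^ r := by
        have h7 := Nat.sum_range_choose r
        rw [Finset.sum_range_succ] at h7
        have h8 : ∑ k ∈ Finset.range r, r.choose k ≤ 2 ^ r := by omega
        exact_mod_cast h8
      calc _ ≤ ∑ k ∈ Finset.range r, (r.choose k : ℝ) * ((s ^ r)⁻¹ * M) :=
            (Finset.abs_sum_le_sum_abs _ _).trans (Finset.sum_le_sum hb)
        _ = (∑ k ∈ Finset.range r, (r.choose k : ℝ)) * ((s ^ r)⁻¹ * M) := by rw [Finset.sum_mul]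
        _ ≤ 2 ^ r * ((s ^ r)⁻¹ * M) := by gcongr
        _ = _ := by ring

/-! ### Local polynomial approximation -/

lemma MemCw.exists_bound {α β : ℝ} {f : ℝ → ℝ} (hf : MemCw α β f) : ∃ C : ℝ, 0 < C ∧
    ∀ y ∈ Ioo (0 : ℝ) 1, |f y| ≤ C * (y ^ (-α) * (1 - y) ^ (-β)) := by
  have h0 : ∀ᶠ x in 𝓝[>] (0 : ℝ), |weight α β x * f x| < 1 := by
    have := hf.tendsto_zero.abs
    rw [abs_zero] at this
    exact this.eventually (gt_mem_nhds one_pos)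
  have h1 : ∀ᶠ x in 𝓝[<] (1 : ℝ), |weight α β x * f x| < 1 := by
    have := hf.tendsto_one.abs
    rw [abs_zero] at this
    exact this.eventually (gt_mem_nhds one_pos)
  obtain ⟨u, hu, hu'⟩ := mem_nhdsGT_iff_exists_Ioo_subset.1 h0
  obtain ⟨v, hv, hv'⟩ := mem_nhdsLT_iff_exists_Ioo_subset.1 h1
  set u' := min u (1 / 2) with hu'def
  set v' := max v (1 / 2) with hv'def
  have hu0 : 0 < u' := lt_min hu (by norm_num)
  have hv1 : v' < 1 := max_lt hv (by norm_num)
  have hsub : Icc u' v' ⊆ Ioo (0 : ℝ) 1 := fun y hy =>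
    ⟨lt_of_lt_of_le hu0 hy.1, lt_of_le_of_lt hy.2 hv1⟩
  have hcont : ContinuousOn (fun x => weight α β x * f x) (Icc u' v') := by
    refine ContinuousOn.mul (fun x hx => ?_) (hf.continuousOn.mono hsub)
    have hx' := hsub hx
    refine ContinuousAt.continuousWithinAt ?_
    unfold weight
    refine ContinuousAt.mul (Real.continuousAt_rpow_const _ _ (Or.inl hx'.1.ne')) ?_
    exact ContinuousAt.rpow_const (by fun_prop) (Or.inl (by linarith [hx'.2]))
  obtain ⟨B, hB⟩ := isCompact_Icc.exists_bound_of_continuousOn hcont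
  refine ⟨max B 1, by positivity, fun y hy => ?_⟩
  have hw := weight_pos (α := α) (β := β) hy
  refine le_weight_inv_mul hy ?_
  rw [← abs_of_pos hw, ← abs_mul]
  by_cases hyu : y < u'
  · have h2 : |weight α β y * f y| < 1 := hu' ⟨hy.1, lt_of_lt_of_le hyu (min_le_left _ _)⟩
    exact h2.le.trans (le_max_right _ _)
  by_cases hyv : v' < y
  · have h2 : |weight α β y * f y| < 1 := hv' ⟨lt_of_le_of_lt (le_max_left _ _) hyv, hy.2⟩
    exact h2.le.trans (le_max_right _ _)
  push Not at hyu hyv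
  exact (hB y ⟨hyu, hyv⟩).trans (le_max_left _ _)

/-- The local scale `√(x/n) + 1/n` of the Bernstein operator at `x ≤ 1/2`. -/
noncomputable def locScale (n : ℕ) (x : ℝ) : ℝ := Real.sqrt (x / n) + 1 / n

lemma one_div_le_locScale (n : ℕ) (x : ℝ) : 1 / (n : ℝ) ≤ locScale n x := by
  unfold locScale
  linarith [Real.sqrt_nonneg (x / n)]

lemma locScale_le {n : ℕ} (hn : 1 ≤ n) {x : ℝ} (hx : x ≤ 1) :
    locScale n x ≤ 2 / Real.sqrt n := by
  have hn1 : (1 : ℝ) ≤ n := by exact_mod_cast hn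
  have hs : 0 < Real.sqrt n := Real.sqrt_pos.2 (by linarith)
  have h1 : Real.sqrt (x / n) ≤ 1 / Real.sqrt n := by
    rw [← Real.sqrt_one, ← Real.sqrt_div zero_le_one]
    exact Real.sqrt_le_sqrt (by gcongr)
  have h2 : 1 / (n : ℝ) ≤ 1 / Real.sqrt n := by
    refine one_div_le_one_div_of_le hs ?_
    rw [Real.sqrt_le_left (by linarith)]
    nlinarith
  have h3 : 2 / Real.sqrt n = 1 / Real.sqrt n + 1 / Real.sqrt n := by ring
  unfold locScale
  linarith

section Local

open Polynomial

variable {r : ℕ} {α β a₀ lam : ℝ} {f : ℝ → ℝ}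

set_option maxHeartbeats 1000000 in
/-- At each point `x ≤ 1/2` and level `n` there is a polynomial of degree `< r` that approximates
`f` on the local scale, with errors growing polynomially away from `x`: the Taylor polynomial
at `x` of a smoothing of `f` of constant step. -/
lemma HalfSmooth.exists_local_poly (hr : 1 ≤ r) (hα : 0 < α) (hβ : 0 < β) (ha₀ : 0 < a₀)
    (hlam0 : 0 ≤ lam) (hf : MemCw α β f) (hS : HalfSmooth r α lam a₀ f) :
    ∃ C : ℝ, ∃ n₀ : ℕ, 0 < C ∧ ∀ n : ℕ, n₀ ≤ n → ∀ x ∈ Ioc (0 : ℝ) (1 / 2),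
      ∃ P : ℝ[X], P.natDegree < r ∧
        (∀ y ∈ Icc (min x (1 / n)) (3 / 4), |f y - P.eval y| ≤ C * locScale n x ^ a₀ *
          (1 + |y - x| / locScale n x) ^ r *
            (x ^ (-(α + lam * a₀ / 2)) + y ^ (-(α + lam * a₀ / 2)))) ∧
        ∀ y ∈ Icc (0 : ℝ) 1, |P.eval y| ≤ C * ((n : ℝ) ^ ((r : ℝ) + α) * x ^ (-α)) := by
  obtain ⟨Cf, hCf, hfb⟩ := hf.exists_bound
  obtain ⟨C, h₀, hC, hh₀, hS⟩ := hS
  set a := α + lam * a₀ / 2 with ha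
  have hla : 0 ≤ lam * a₀ / 2 := by positivity
  have ha0 : 0 < a := by linarith
  have hr0 : (0 : ℝ) < r := by exact_mod_cast hr
  have hr1 : (1 : ℝ) ≤ r := by exact_mod_cast hr
  set η := min (h₀ / r) (1 / (16 * r ^ 2)) with hη
  have hη0 : 0 < η := by positivity
  obtain ⟨n₁, hn₁⟩ := exists_nat_ge ((2 / η) ^ 2)
  set C₁ := C * (r : ℝ) ^ a₀ with hC₁
  have hC₁0 : 0 < C₁ := by positivity
  refine ⟨2 ^ r * C₁ + 3 * 4 ^ r * (Cf * 16 ^ β), max n₁ 2, by positivity, fun n hn x hx => ?_⟩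
  have hn2 : 2 ≤ n := (le_max_right _ _).trans hn
  have hn0 : (0 : ℝ) < n := by positivity
  have hn2' : (2 : ℝ) ≤ n := by exact_mod_cast hn2
  have hx0 := hx.1
  set ρ := locScale n x with hρ
  have hρn : 1 / (n : ℝ) ≤ ρ := one_div_le_locScale n x
  have hρ0 : 0 < ρ := lt_of_lt_of_le (by positivity) hρn
  have hρη : ρ ≤ η := by
    refine (locScale_le (by omega) (by linarith [hx.2])).trans ?_
    have h1 : (2 / η) ^ 2 ≤ n := hn₁.trans (by exact_mod_cast (le_max_left _ _).trans hn)
    have h2 := Real.le_sqrt_of_sq_le h1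
    have hsn : 0 < Real.sqrt n := Real.sqrt_pos.2 hn0
    rw [div_le_iff₀ hη0] at h2
    rw [div_le_iff₀ hsn]
    linarith
  have hrρ : r * ρ ≤ h₀ := by
    have := hρη.trans (min_le_left _ _)
    rw [le_div_iff₀ hr0] at this
    linarith
  have hrrρ : r * (r * ρ) ≤ 1 / 16 := by
    have := hρη.trans (min_le_right _ _)
    rw [le_div_iff₀ (by positivity)] at this
    nlinarith
  set ℓ := min x (1 / (n : ℝ)) with hℓ
  have hℓ0 : 0 < ℓ := by positivity
  have hℓx : ℓ ≤ x := min_le_left _ _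
  have hℓ2 : ℓ ≤ 1 / 2 := hℓx.trans hx.2
  -- `f` is frozen outside `[ℓ, 15/16]` to make it continuous on the line
  set F : ℝ → ℝ := fun y => f (max ℓ (min y (15 / 16))) with hF
  have hclamp : ∀ y, max ℓ (min y (15 / 16)) ∈ Icc ℓ (15 / 16) := fun y =>
    ⟨le_max_left _ _, max_le (by linarith) (min_le_right _ _)⟩
  have hFc : Continuous F := by
    refine hf.continuousOn.comp_continuous (by fun_prop) fun y => ?_
    exact ⟨lt_of_lt_of_le hℓ0 (hclamp y).1, by linarith [(hclamp y).2]⟩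
  have hFf : ∀ y ∈ Icc ℓ (15 / 16), F y = f y := fun y hy => by
    simp only [hF]
    rw [min_eq_left hy.2, max_eq_right hy.1]
  set Mf := Cf * (ℓ ^ (-α) * 16 ^ β) with hMf
  have hMf0 : 0 < Mf := by positivity
  have hFb : ∀ y, |F y| ≤ Mf := fun y => by
    have hy := hclamp y
    refine (hfb _ ⟨lt_of_lt_of_le hℓ0 hy.1, by linarith [hy.2]⟩).trans ?_
    set z := max ℓ (min y (15 / 16))
    have e1 : z ^ (-α) ≤ ℓ ^ (-α) := Real.rpow_le_rpow_of_nonpos hℓ0 hy.1 (by linarith)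
    have e2 : (1 - z) ^ (-β) ≤ 16 ^ β := by
      calc (1 - z) ^ (-β) ≤ (1 / 16 : ℝ) ^ (-β) :=
            Real.rpow_le_rpow_of_nonpos (by norm_num) (by linarith [hy.2]) (by linarith)
        _ = 16 ^ β := by
            rw [one_div, Real.inv_rpow (by norm_num), Real.rpow_neg (by norm_num), inv_inv]
    have : 0 ≤ (1 - z) ^ (-β) := Real.rpow_nonneg (by linarith [hy.2]) _
    rw [hMf]
    gcongr
  obtain ⟨G, hG, hGM⟩ := exists_smoothing hr hFc hρ0
  -- sharp bounds on `[ℓ, 3/4]`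
  have hsharp : ∀ y ∈ Icc ℓ (3 / 4), |F y - G 0 y| ≤ C₁ * ρ ^ a₀ * y ^ (-a) ∧
      |G r y| ≤ 2 ^ r * (ρ ^ r)⁻¹ * (C₁ * ρ ^ a₀ * y ^ (-a)) := by
    intro y hy
    have hy0 : 0 < y := lt_of_lt_of_le hℓ0 hy.1
    refine hGM y _ (by positivity) fun h hh => ?_
    have hh0 := hh.1
    have heq : forwardDiff r F h y = forwardDiff r f h y := by
      refine Finset.sum_congr rfl fun k hk => ?_
      have hk' : (k : ℝ) ≤ r := by exact_mod_cast Nat.lt_succ_iff.1 (Finset.mem_range.1 hk)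
      have hk0 : (0 : ℝ) ≤ k := Nat.cast_nonneg k
      have e1 : 0 ≤ ((r : ℝ) - k) * h := mul_nonneg (by linarith) hh0.le
      have e2 : ((r : ℝ) - k) * h ≤ r * (r * ρ) :=
        mul_le_mul (by linarith) hh.2 hh0.le hr0.le
      rw [hFf _ ⟨by linarith [hy.1], by linarith [hy.2]⟩]
    rw [heq]
    refine (hS y ⟨hy0, hy.2⟩ h ⟨hh0, hh.2.trans hrρ⟩).trans ?_
    have e3 : h ^ a₀ ≤ (r : ℝ) ^ a₀ * ρ ^ a₀ := by
      rw [← Real.mul_rpow hr0.le hρ0.le]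
      exact Real.rpow_le_rpow hh0.le hh.2 ha₀.le
    have e4 : max h y ^ (-(lam * a₀ / 2)) ≤ y ^ (-(lam * a₀ / 2)) :=
      Real.rpow_le_rpow_of_nonpos hy0 (le_max_right _ _) (by linarith)
    have e5 : y ^ (-a) = y ^ (-(lam * a₀ / 2)) * y ^ (-α) := by
      rw [← Real.rpow_add hy0, ha]
      congr 1
      ring
    calc C * (h ^ a₀ * max h y ^ (-(lam * a₀ / 2)) * y ^ (-α)) ≤
          C * ((r : ℝ) ^ a₀ * ρ ^ a₀ * y ^ (-(lam * a₀ / 2)) * y ^ (-α)) := by gcongr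
      _ = _ := by rw [e5, hC₁]; ring
  -- crude bounds everywhere
  have hcrude : ∀ y, |F y - G 0 y| ≤ 2 ^ r * Mf ∧
      |G r y| ≤ 2 ^ r * (ρ ^ r)⁻¹ * (2 ^ r * Mf) := by
    intro y
    refine hGM y _ (by positivity) fun h _ => ?_
    rw [forwardDiff_eq_iterate]
    exact abs_fwdDiff_iter_le_two_pow h r F y fun j _ => hFb _
  set P := taylorPoly r (fun j => G j x) x with hP
  refine ⟨P, natDegree_taylorPoly_lt hr _ _, fun y hy => ?_, fun y hy => ?_⟩
  · have hy0 : 0 < y := lt_of_lt_of_le hℓ0 hy.1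
    have hGP : |G 0 y - P.eval y| ≤
        2 ^ r * (ρ ^ r)⁻¹ * (C₁ * ρ ^ a₀ * (x ^ (-a) + y ^ (-a))) * |y - x| ^ r := by
      rw [hP, eval_taylorPoly]
      refine abs_taylor_remainder_le r G hG fun z hz => ?_
      have hz' : min x y ≤ z := hz.1
      have hz'' : z ≤ max x y := hz.2
      have hz0 : 0 < z := lt_of_lt_of_le (by positivity) hz'
      refine (hsharp z ⟨(le_min hℓx hy.1).trans hz', hz''.trans
        (max_le (by linarith [hx.2]) hy.2)⟩).2.trans ?_
      have e1 : z ^ (-a) ≤ x ^ (-a) + y ^ (-a) := by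
        have hxp : 0 ≤ x ^ (-a) := by positivity
        have hyp : 0 ≤ y ^ (-a) := by positivity
        rcases min_le_iff.1 hz' with h | h
        · linarith [Real.rpow_le_rpow_of_nonpos hx0 h (by linarith : -a ≤ 0)]
        · linarith [Real.rpow_le_rpow_of_nonpos hy0 h (by linarith : -a ≤ 0)]
      gcongr
    have hFG := (hsharp y hy).1
    rw [hFf y ⟨hy.1, by linarith [hy.2]⟩] at hFG
    set W := ρ ^ a₀ * (x ^ (-a) + y ^ (-a)) with hW
    have hW0 : 0 < W := by positivity
    have hyW : ρ ^ a₀ * y ^ (-a) ≤ W := by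
      rw [hW]
      gcongr
      have : 0 ≤ x ^ (-a) := by positivity
      linarith
    set D := |y - x| / ρ with hD
    have hD0 : 0 ≤ D := by positivity
    have hDr : (ρ ^ r)⁻¹ * |y - x| ^ r = D ^ r := by
      rw [hD, div_pow]
      field_simp
    have htot : |f y - P.eval y| ≤ C₁ * W + 2 ^ r * C₁ * W * D ^ r := by
      have h1 : |f y - P.eval y| ≤ |f y - G 0 y| + |G 0 y - P.eval y| := abs_sub_le _ _ _
      have h2 : 2 ^ r * (ρ ^ r)⁻¹ * (C₁ * ρ ^ a₀ * (x ^ (-a) + y ^ (-a))) * |y - x| ^ r =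
          2 ^ r * C₁ * W * D ^ r := by
        rw [← hDr, hW]
        ring
      rw [h2] at hGP
      have h3 : C₁ * ρ ^ a₀ * y ^ (-a) ≤ C₁ * W := by
        rw [mul_assoc]
        gcongr
      linarith
    have hpow : 1 + D ^ r ≤ (1 + D) ^ r := by
      obtain ⟨m, rfl⟩ : ∃ m, r = m + 1 := ⟨r - 1, by omega⟩
      rw [pow_succ, pow_succ]
      have h4 : 1 ≤ (1 + D) ^ m := one_le_pow₀ (by linarith)
      have h5 : D ^ m ≤ (1 + D) ^ m := by
        gcongr
        linarith
      nlinarith [mul_le_mul_of_nonneg_right h5 hD0]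
    have h2r : (1 : ℝ) ≤ 2 ^ r := one_le_pow₀ (by norm_num)
    calc |f y - P.eval y| ≤ C₁ * W + 2 ^ r * C₁ * W * D ^ r := htot
      _ ≤ 2 ^ r * C₁ * W * (1 + D ^ r) := by
        have : 0 ≤ (2 ^ r - 1) * (C₁ * W) := mul_nonneg (by linarith) (by positivity)
        linarith
      _ ≤ 2 ^ r * C₁ * W * (1 + D) ^ r := by gcongr
      _ = (2 ^ r * C₁) * (ρ ^ a₀ * (1 + D) ^ r * (x ^ (-a) + y ^ (-a))) := by rw [hW]; ring
      _ ≤ (2 ^ r * C₁ + 3 * 4 ^ r * (Cf * 16 ^ β)) *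
          (ρ ^ a₀ * (1 + D) ^ r * (x ^ (-a) + y ^ (-a))) := by
        gcongr
        have : 0 < 3 * 4 ^ r * (Cf * 16 ^ β) := by positivity
        linarith
      _ = _ := by ring
  · have hyx : |y - x| ≤ 1 := abs_le.2 ⟨by linarith [hy.1, hx.2], by linarith [hy.2]⟩
    have hGP : |G 0 y - P.eval y| ≤ 2 ^ r * (ρ ^ r)⁻¹ * (2 ^ r * Mf) * |y - x| ^ r := by
      rw [hP, eval_taylorPoly]
      exact abs_taylor_remainder_le r G hG fun z _ => (hcrude z).2
    have hn1 : (1 : ℝ) ≤ (n : ℝ) ^ r := one_le_pow₀ (by linarith)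
    have hρr : (ρ ^ r)⁻¹ ≤ (n : ℝ) ^ r := by
      rw [← inv_pow]
      gcongr
      rw [inv_le_comm₀ hρ0 hn0, ← one_div]
      exact hρn
    have hGP' : |G 0 y - P.eval y| ≤ 4 ^ r * (n : ℝ) ^ r * Mf := by
      calc _ ≤ _ := hGP
        _ ≤ 2 ^ r * (n : ℝ) ^ r * (2 ^ r * Mf) * 1 := by
          gcongr
          exact pow_le_one₀ (abs_nonneg _) hyx
        _ = _ := by
          rw [show (4 : ℝ) = 2 * 2 by norm_num, mul_pow]
          ring
    have h24 : (2 : ℝ) ^ r ≤ 4 ^ r := by gcongr; norm_num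
    have h14 : (1 : ℝ) ≤ 4 ^ r := one_le_pow₀ (by norm_num)
    have htot : |P.eval y| ≤ 3 * 4 ^ r * (n : ℝ) ^ r * Mf := by
      have h1 : |P.eval y| ≤ |F y| + |F y - G 0 y| + |G 0 y - P.eval y| := by
        have := abs_sub_abs_le_abs_sub (P.eval y) (F y)
        have h2 := abs_sub_le (F y) (G 0 y) (P.eval y)
        rw [abs_sub_comm] at this
        linarith
      have h2 := hFb y
      have h3 := (hcrude y).1
      have h4n : 1 ≤ 4 ^ r * (n : ℝ) ^ r := by nlinarith
      have e1 : Mf ≤ 4 ^ r * (n : ℝ) ^ r * Mf := le_mul_of_one_le_left hMf0.le h4n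
      have e2 : 2 ^ r * Mf ≤ 4 ^ r * (n : ℝ) ^ r * Mf := by
        gcongr
        exact h24.trans (le_mul_of_one_le_right (by positivity) hn1)
      linarith
    have hℓn : ℓ ^ (-α) ≤ (n : ℝ) ^ α * x ^ (-α) := by
      have h5 : x / n ≤ ℓ := by
        rw [hℓ, le_min_iff]
        constructor
        · exact div_le_self hx0.le (by linarith)
        · gcongr
          linarith [hx.2]
      calc ℓ ^ (-α) ≤ (x / n) ^ (-α) :=
            Real.rpow_le_rpow_of_nonpos (by positivity) h5 (by linarith)
        _ = _ := by
          rw [Real.div_rpow hx0.le hn0.le, Real.rpow_neg hn0.le, div_inv_eq_mul, mul_comm]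
    calc |P.eval y| ≤ 3 * 4 ^ r * (n : ℝ) ^ r * Mf := htot
      _ ≤ 3 * 4 ^ r * (n : ℝ) ^ r * (Cf * (((n : ℝ) ^ α * x ^ (-α)) * 16 ^ β)) := by
        rw [hMf]
        gcongr
      _ = (3 * 4 ^ r * (Cf * 16 ^ β)) * ((n : ℝ) ^ ((r : ℝ) + α) * x ^ (-α)) := by
        rw [Real.rpow_add hn0, Real.rpow_natCast]
        ring
      _ ≤ _ := by
        gcongr
        have : 0 < 2 ^ r * C₁ := by positivity
        linarith

end Local

/-! ### The rate of approximation from smoothness -/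

section Direct

open Polynomial

variable {r : ℕ} {ψ : ℝ → ℝ} {d : ℕ → ℕ → ℕ} {c : ℕ → ℕ → ℝ} {α β a₀ lam : ℝ} {f : ℝ → ℝ}

lemma abs_node_sub_div_locScale_le {n N k : ℕ} (hn : 1 ≤ n) (hnN : n ≤ N) {x : ℝ}
    (hx : x ∈ Icc (0 : ℝ) 1) : |(k : ℝ) / N - x| / locScale n x ≤ dev N k x := by
  have hn0 : (0 : ℝ) < n := by exact_mod_cast hn
  have hnN' : (n : ℝ) ≤ N := by exact_mod_cast hnN
  have hN0 : (0 : ℝ) < N := by linarith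
  have hρ : 0 < locScale n x := lt_of_lt_of_le (by positivity) (one_div_le_locScale n x)
  rw [div_le_iff₀ hρ]
  have e1 : |(k : ℝ) / N - x| = dev N k x * (sig N x / N) := by
    have : (k : ℝ) / N - x = (k - N * x) / N := by field_simp
    rw [this, abs_div, abs_eq_dev_mul_sig, abs_of_pos hN0, mul_div_assoc]
  rw [e1]
  refine mul_le_mul_of_nonneg_left ?_ (dev_nonneg N k x)
  have e2 : Real.sqrt (N * (x * (1 - x))) / N ≤ Real.sqrt (x / n) := by
    have : Real.sqrt (N * (x * (1 - x))) / N = Real.sqrt (x * (1 - x) / N) := by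
      rw [← Real.sqrt_sq hN0.le, ← Real.sqrt_div' _ (sq_nonneg _), Real.sqrt_sq hN0.le]
      congr 1
      field_simp
    rw [this]
    refine Real.sqrt_le_sqrt ?_
    have h1 : x * (1 - x) ≤ x := by nlinarith [hx.1, hx.2]
    have hx0 := hx.1
    gcongr
  have e3 : 1 / (N : ℝ) ≤ 1 / n := one_div_le_one_div_of_le hn0 hnN'
  rw [sig, locScale, add_div]
  linarith

/-- Nodal bounds for the modification of a function that is small near `x`. -/
lemma exists_modified_near_le (hr : 1 ≤ r) (hψ : IsCutoff r ψ) {a : ℝ} (ha : 0 ≤ a) :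
    ∃ Γ : ℝ, 0 < Γ ∧ ∀ (n N : ℕ) (h : ℝ → ℝ) (M x : ℝ), 8 + 2 * r ≤ n → n ≤ N → 0 ≤ M →
      x ∈ Ioc (0 : ℝ) (1 / 2) →
      (∀ y ∈ Icc (1 / (n : ℝ)) (3 / 4), |h y| ≤
        M * (1 + |y - x| / locScale n x) ^ r * (x ^ (-a) + y ^ (-a))) →
      ∀ k : ℕ, (k : ℝ) / N ≤ 3 / 4 → |modified ψ r n h ((k : ℝ) / N)| ≤
        Γ * (M * (1 + dev N k x) ^ r * (x ^ (-a) + (((k : ℝ) + 1) / N) ^ (-a))) := by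
  obtain ⟨κ, hκ, hmod⟩ := exists_abs_modified_le hr hψ
  refine ⟨κ * ((r + 3) ^ r * 3 ^ a), by positivity, fun n N h M x hn hnN hM hx hh k hk => ?_⟩
  have hr0 : (1 : ℝ) ≤ r := by exact_mod_cast hr
  have hn' : (8 : ℝ) + 2 * r ≤ n := by exact_mod_cast hn
  have hn0 : (0 : ℝ) < n := by linarith
  have hnN' : (n : ℝ) ≤ N := by exact_mod_cast hnN
  have hN0 : (0 : ℝ) < N := by linarith
  have hx0 := hx.1
  have hk0 : (0 : ℝ) ≤ (k : ℝ) / N := by positivity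
  have h1N : 1 / (N : ℝ) ≤ 1 / n := one_div_le_one_div_of_le hn0 hnN'
  have hρn : 1 / (n : ℝ) ≤ locScale n x := one_div_le_locScale n x
  have hdev := abs_node_sub_div_locScale_le (k := k) (by omega) hnN
    (x := x) ⟨hx0.le, by linarith [hx.2]⟩
  set ρ := locScale n x with hρ
  have hρ0 : 0 < ρ := lt_of_lt_of_le (by positivity) hρn
  set y := (k : ℝ) / N with hy
  set Y := ((k : ℝ) + 1) / N with hY
  have hYy : Y = y + 1 / N := by rw [hY, hy, add_div]
  have hY0 : 0 < Y := by positivity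
  set D := dev N k x
  have hD0 : 0 ≤ D := dev_nonneg N k x
  -- the general estimate at a point `z` close to the node
  have key : ∀ z ∈ Icc (1 / (n : ℝ)) (3 / 4), Y ≤ 3 * z → |z - y| ≤ (r + 2) * (1 / n) →
      |h z| ≤ (r + 3) ^ r * 3 ^ a * (M * (1 + D) ^ r * (x ^ (-a) + Y ^ (-a))) := by
    intro z hz hYz hzy
    have hz0 : 0 < z := lt_of_lt_of_le (by positivity) hz.1
    refine (hh z hz).trans ?_
    have e1 : 1 + |z - x| / ρ ≤ (r + 3) * (1 + D) := by
      have h1 : |z - x| ≤ |z - y| + |y - x| := abs_sub_le _ _ _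
      have h2 : |z - x| / ρ ≤ (r + 2) + D := by
        rw [div_le_iff₀ hρ0]
        rw [div_le_iff₀ hρ0] at hdev
        have h3 : ((r : ℝ) + 2) * (1 / n) ≤ (r + 2) * ρ := by gcongr
        linarith
      nlinarith
    have e2 : z ^ (-a) ≤ 3 ^ a * Y ^ (-a) := by
      have h4 : Y / 3 ≤ z := by linarith
      calc z ^ (-a) ≤ (Y / 3) ^ (-a) :=
            Real.rpow_le_rpow_of_nonpos (by positivity) h4 (by linarith)
        _ = 3 ^ a * Y ^ (-a) := by
          rw [Real.div_rpow hY0.le (by norm_num), Real.rpow_neg (by norm_num : (0 : ℝ) ≤ 3),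
            div_inv_eq_mul, mul_comm]
    have e3 : (1 : ℝ) ≤ 3 ^ a := Real.one_le_rpow (by norm_num) ha
    have hxa : 0 ≤ x ^ (-a) := by positivity
    have e4 : x ^ (-a) + z ^ (-a) ≤ 3 ^ a * (x ^ (-a) + Y ^ (-a)) := by nlinarith
    calc M * (1 + |z - x| / ρ) ^ r * (x ^ (-a) + z ^ (-a))
        ≤ M * ((r + 3) * (1 + D)) ^ r * (3 ^ a * (x ^ (-a) + Y ^ (-a))) := by gcongr
      _ = _ := by rw [mul_pow]; ring
  rw [mul_assoc]
  refine hmod n h _ y (by omega) hk0 ?_ (fun hy2 i hi => ?_) fun hy1 => ?_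
  · have : 2 / (n : ℝ) ≤ 1 / 4 := by
      rw [div_le_iff₀ hn0]
      linarith
    linarith
  · have hi1 : (1 : ℝ) ≤ i := by exact_mod_cast (Finset.mem_Icc.1 hi).1
    have hir : (i : ℝ) ≤ r := by exact_mod_cast (Finset.mem_Icc.1 hi).2
    have h1i : 1 / (n : ℝ) ≤ i / n := by gcongr
    have hrn : (i : ℝ) / n ≤ r * (1 / n) := by
      rw [mul_one_div]
      gcongr
    have e2n : 2 / (n : ℝ) = 2 * (1 / n) := by ring
    have hp : 0 < 1 / (n : ℝ) := by positivity
    refine key _ ⟨h1i, ?_⟩ (by linarith) (abs_le.2 ⟨?_, ?_⟩)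
    · rw [div_le_iff₀ hn0]
      linarith
    · nlinarith
    · nlinarith
  · refine key y ⟨hy1.le, hk⟩ (by linarith) ?_
    rw [sub_self, abs_zero]
    positivity

/-- Nodes far from `x` contribute less than any power of `1/n`: there `1 + dev` is at least of
order `√n`, which compensates a crude bound of polynomial growth. -/
lemma exists_modified_far_le (hr : 1 ≤ r) (hψ : IsCutoff r ψ) {a K : ℝ} (hK : 1 ≤ K)
    (hα : 0 < α) (hβ : 0 < β) (ha₀ : 0 < a₀) (haα : α ≤ a) :
    ∃ Γ : ℝ, ∃ J : ℕ, 0 < Γ ∧ ∀ (n N : ℕ) (h : ℝ → ℝ) (M x : ℝ), 8 + 2 * r ≤ n → n ≤ N →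
      (N : ℝ) ≤ K * n → 0 ≤ M → x ∈ Ioc (0 : ℝ) (1 / 2) →
      (∀ y ∈ Ioo (0 : ℝ) 1, |h y| ≤
        M * ((n : ℝ) ^ ((r : ℝ) + α) * x ^ (-α)) * (y ^ (-α) * (1 - y) ^ (-β))) →
      ∀ k ≤ N, 3 / 4 ≤ (k : ℝ) / N → |modified ψ r n h ((k : ℝ) / N)| ≤
        Γ * (M * locScale n x ^ a₀ * (1 + dev N k x) ^ J * x ^ (-a)) := by
  obtain ⟨Γ, hΓ, hmod⟩ := exists_abs_modified_node_le hr hψ (-α) (-β) K hK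
  set L : ℝ := r + α + (α + β) + a₀ with hL
  have hL0 : 0 < L := by positivity
  set J := ⌈2 * L⌉₊ with hJ
  refine ⟨Γ * K ^ (α + β) * 8 ^ J, J, by positivity,
    fun n N h M x hn hnN hNK hM hx hh k hk hky => ?_⟩
  have hn' : 8 + 2 * r ≤ n := hn
  have hn0 : (0 : ℝ) < n := by
    have : 0 < n := by omega
    exact_mod_cast this
  have hn1 : (1 : ℝ) ≤ n := by
    have : 1 ≤ n := by omega
    exact_mod_cast this
  have hnN' : (n : ℝ) ≤ N := by exact_mod_cast hnN
  have hN0 : (0 : ℝ) < N := by linarith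
  have hx0 := hx.1
  have hρn : 1 / (n : ℝ) ≤ locScale n x := one_div_le_locScale n x
  have hρ2 : locScale n x ≤ 2 / Real.sqrt n := locScale_le (by omega) (by linarith [hx.2])
  have hdev := abs_node_sub_div_locScale_le (k := k) (by omega) hnN
    (x := x) ⟨hx0.le, by linarith [hx.2]⟩
  set ρ := locScale n x with hρ
  have hρ0 : 0 < ρ := lt_of_lt_of_le (by positivity) hρn
  set D := dev N k x
  have hD0 : 0 ≤ D := dev_nonneg N k x
  have hs0 : 0 < Real.sqrt n := Real.sqrt_pos.2 hn0
  have hsD : Real.sqrt n ≤ 8 * (1 + D) := by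
    have h1 : 1 / 4 ≤ |(k : ℝ) / N - x| := le_trans (by linarith [hx.2]) (le_abs_self _)
    rw [div_le_iff₀ hρ0] at hdev
    have h2 : D * ρ ≤ D * (2 / Real.sqrt n) := by gcongr
    have h3 : 1 / 4 ≤ D * (2 / Real.sqrt n) := by linarith
    rw [mul_div_assoc', le_div_iff₀ hs0] at h3
    linarith
  have hnL : (n : ℝ) ^ L ≤ 8 ^ J * (1 + D) ^ J := by
    have e1 : (n : ℝ) ^ L = Real.sqrt n ^ (2 * L) := by
      rw [Real.sqrt_eq_rpow, ← Real.rpow_mul hn0.le]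
      congr 1
      ring
    have hs1 : 1 ≤ Real.sqrt n := Real.one_le_sqrt.2 hn1
    calc (n : ℝ) ^ L = Real.sqrt n ^ (2 * L) := e1
      _ ≤ Real.sqrt n ^ (J : ℝ) := Real.rpow_le_rpow_of_exponent_le hs1 (Nat.le_ceil _)
      _ = Real.sqrt n ^ J := Real.rpow_natCast _ _
      _ ≤ (8 * (1 + D)) ^ J := by gcongr
      _ = _ := by rw [mul_pow]
  have hb := hmod n N h (M * ((n : ℝ) ^ ((r : ℝ) + α) * x ^ (-α))) (by omega) hnN hNK
    (by positivity) (fun y hy => hh y ⟨lt_of_lt_of_le (by positivity) hy.1,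
      lt_of_le_of_lt hy.2 (by linarith [show 0 < 1 / (n : ℝ) by positivity])⟩) k hk
  refine hb.trans ?_
  have hinv : ∀ (u : ℝ) (t : ℝ), 0 ≤ u → 0 ≤ t → ((u + 1) / N) ^ (-t) ≤ (K * n) ^ t := by
    intro u t hu ht
    calc ((u + 1) / N) ^ (-t) ≤ (1 / (N : ℝ)) ^ (-t) := by
          refine Real.rpow_le_rpow_of_nonpos (by positivity) ?_ (by linarith)
          gcongr
          linarith
      _ = (N : ℝ) ^ t := by
          rw [one_div, Real.inv_rpow hN0.le, Real.rpow_neg hN0.le, inv_inv]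
      _ ≤ _ := by gcongr
  have e2 := hinv k α (Nat.cast_nonneg k) hα.le
  have e3 := hinv ((N - k : ℕ) : ℝ) β (Nat.cast_nonneg _) hβ.le
  have e4 : x ^ (-α) ≤ x ^ (-a) :=
    Real.rpow_le_rpow_of_exponent_ge hx0 (by linarith [hx.2]) (by linarith)
  have e5 : 1 ≤ (n : ℝ) ^ a₀ * ρ ^ a₀ := by
    rw [← Real.mul_rpow hn0.le hρ0.le]
    refine Real.one_le_rpow ?_ ha₀.le
    rw [div_le_iff₀ hn0] at hρn
    linarith
  have e6 : (n : ℝ) ^ L = (n : ℝ) ^ ((r : ℝ) + α) * (n : ℝ) ^ (α + β) * (n : ℝ) ^ a₀ := by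
    rw [← Real.rpow_add hn0, ← Real.rpow_add hn0]
  have e7 : (K * n) ^ α * (K * n) ^ β = K ^ (α + β) * (n : ℝ) ^ (α + β) := by
    rw [← Real.rpow_add (by positivity), Real.mul_rpow (by linarith) hn0.le]
  calc _ ≤ Γ * (M * ((n : ℝ) ^ ((r : ℝ) + α) * x ^ (-a)) * ((K * n) ^ α * (K * n) ^ β)) := by
        gcongr
    _ = Γ * K ^ (α + β) * (M * ((n : ℝ) ^ ((r : ℝ) + α) * (n : ℝ) ^ (α + β)) * x ^ (-a)) * 1 := by
        rw [e7]
        ring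
    _ ≤ Γ * K ^ (α + β) * (M * ((n : ℝ) ^ ((r : ℝ) + α) * (n : ℝ) ^ (α + β)) * x ^ (-a)) *
          ((n : ℝ) ^ a₀ * ρ ^ a₀) := by gcongr
    _ = Γ * K ^ (α + β) * (M * ρ ^ a₀ * x ^ (-a)) * (n : ℝ) ^ L := by
        rw [e6]
        ring
    _ ≤ Γ * K ^ (α + β) * (M * ρ ^ a₀ * x ^ (-a)) * (8 ^ J * (1 + D) ^ J) := by gcongr
    _ = _ := by ring

/-- The operator reproduces polynomials of degree `< r`, so only the nodal values of the
modification of `f - P` matter for the error. -/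
lemma sub_starOp_eq (hr : 1 ≤ r) (hdc : IsCombination (r - 1) d c) {n : ℕ} (hn : 1 ≤ n)
    {P : ℝ[X]} (hP : P.natDegree < r) (x : ℝ) :
    f x - starOp ψ r d c n f x = (f x - P.eval x) - ∑ i ∈ Finset.range (r - 1), c n i *
      ∑ k ∈ Finset.range (d n i + 1),
        modified ψ r n (fun t => f t - P.eval t) ((k : ℝ) / d n i) * bern (d n i) k x := by
  have h1 : starOp ψ r d c n f x =
      (combPoly (r - 1) d c n (modified ψ r n (fun t => f t - P.eval t))).eval x + P.eval x := by
    have e1 : modified ψ r n (fun t => f t - P.eval t) =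
        fun t => modified ψ r n f t - P.eval t := by
      funext t
      rw [modified_sub, modified_eval hn hP]
    have e2 := hdc.combPoly_eval hn (P := P) (by omega)
    rw [starOp, ← eval_combPoly, combPoly_sub (modified ψ r n f) (fun t => P.eval t), e2, e1,
      eval_add]
  rw [h1, eval_combPoly, combination]
  simp only [bernsteinOp, bern]
  ring

/-- The rate of approximation at `x ≤ 1/2`. -/
lemma HalfSmooth.exists_abs_sub_starOp_le (hr : 1 ≤ r) (hψ : IsCutoff r ψ)
    (hdc : IsCombination (r - 1) d c) (hα : 0 < α) (hβ : 0 < β) (ha₀ : 0 < a₀)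
    (hlam0 : 0 ≤ lam) (hf : MemCw α β f) (hS : HalfSmooth r α lam a₀ f) :
    ∃ C : ℝ, ∃ n₀ : ℕ, 0 < C ∧ ∀ n : ℕ, n₀ ≤ n → ∀ x ∈ Ioc (0 : ℝ) (1 / 2),
      |f x - starOp ψ r d c n f x| ≤ C * (locScale n x ^ a₀ * x ^ (-(α + lam * a₀ / 2))) := by
  have hla : 0 ≤ lam * a₀ / 2 := by positivity
  obtain ⟨K, hK, hdK⟩ := hdc.exists_bound
  obtain ⟨Cf, hCf, hfb⟩ := hf.exists_bound
  obtain ⟨C₁, n₁, hC₁, hpoly⟩ := hS.exists_local_poly hr hα hβ ha₀ hlam0 hf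
  set a := α + lam * a₀ / 2 with ha
  have ha0 : 0 < a := by linarith
  obtain ⟨Γ₁, hΓ₁, hnear⟩ := exists_modified_near_le hr hψ ha0.le
  obtain ⟨Γ₂, J, hΓ₂, hfar⟩ := exists_modified_far_le (a := a) hr hψ hK hα hβ ha₀ (by linarith)
  obtain ⟨S₁, hS₁, hsum₁⟩ := exists_sum_bern_scaled_le (-a) 0 (r + J)
  obtain ⟨S₂, hS₂, hsum₂⟩ := exists_sum_bern_scaled_le 0 0 (r + J)
  set Γ := Γ₁ * C₁ + Γ₂ * (Cf + C₁) with hΓ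
  refine ⟨2 * C₁ + K * (Γ * (S₁ + S₂)), n₁ + (8 + 2 * r), by positivity, fun n hn x hx => ?_⟩
  have hx0 := hx.1
  have hxI : x ∈ Icc (0 : ℝ) 1 := ⟨hx0.le, by linarith [hx.2]⟩
  have hn8 : 8 + 2 * r ≤ n := by omega
  have hn1 : (1 : ℝ) ≤ n := by exact_mod_cast (by omega : 1 ≤ n)
  have hn0 : (0 : ℝ) < n := by linarith
  obtain ⟨P, hPdeg, hP1, hP2⟩ := hpoly n (by omega) x hx
  have hρ0 : 0 < locScale n x := lt_of_lt_of_le (by positivity) (one_div_le_locScale n x)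
  set ρ := locScale n x with hρ
  set h : ℝ → ℝ := fun t => f t - P.eval t with hh
  set E := ρ ^ a₀ * x ^ (-a) with hE
  have hE0 : 0 < E := by positivity
  have hhx : |f x - P.eval x| ≤ 2 * C₁ * E := by
    refine (hP1 x ⟨min_le_left _ _, by linarith [hx.2]⟩).trans (le_of_eq ?_)
    rw [sub_self, abs_zero, zero_div, add_zero, one_pow, hE]
    ring
  have hcrude : ∀ y ∈ Ioo (0 : ℝ) 1, |h y| ≤
      (Cf + C₁) * ((n : ℝ) ^ ((r : ℝ) + α) * x ^ (-α)) * (y ^ (-α) * (1 - y) ^ (-β)) := by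
    intro y hy
    have hy1 : 0 < 1 - y := by linarith [hy.2]
    have hy0 := hy.1
    have e1 : 1 ≤ y ^ (-α) := Real.one_le_rpow_of_pos_of_le_one_of_nonpos hy0 hy.2.le (by linarith)
    have e2 : 1 ≤ (1 - y) ^ (-β) :=
      Real.one_le_rpow_of_pos_of_le_one_of_nonpos hy1 (by linarith) (by linarith)
    have e3 : 1 ≤ y ^ (-α) * (1 - y) ^ (-β) := one_le_mul_of_one_le_of_one_le e1 e2
    have e4 : 1 ≤ (n : ℝ) ^ ((r : ℝ) + α) * x ^ (-α) := one_le_mul_of_one_le_of_one_le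
      (Real.one_le_rpow hn1 (by positivity))
      (Real.one_le_rpow_of_pos_of_le_one_of_nonpos hx0 (by linarith [hx.2]) (by linarith))
    calc |h y| ≤ |f y| + |P.eval y| := abs_sub _ _
      _ ≤ Cf * 1 * (y ^ (-α) * (1 - y) ^ (-β)) +
          C₁ * ((n : ℝ) ^ ((r : ℝ) + α) * x ^ (-α)) * 1 := by
        rw [mul_one, mul_one]
        exact add_le_add (hfb y hy) (hP2 y ⟨hy0.le, hy.2.le⟩)
      _ ≤ Cf * ((n : ℝ) ^ ((r : ℝ) + α) * x ^ (-α)) * (y ^ (-α) * (1 - y) ^ (-β)) +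
          C₁ * ((n : ℝ) ^ ((r : ℝ) + α) * x ^ (-α)) * (y ^ (-α) * (1 - y) ^ (-β)) := by gcongr
      _ = _ := by ring
  have hnode : ∀ N : ℕ, n ≤ N → (N : ℝ) ≤ K * n → ∀ k ≤ N,
      |modified ψ r n h ((k : ℝ) / N)| ≤ Γ * ρ ^ a₀ *
        ((1 + dev N k x) ^ (r + J) * (x ^ (-a) + (((k : ℝ) + 1) / N) ^ (-a))) := by
    intro N hnN hNK k hk
    have hN0 : (0 : ℝ) < N := by exact_mod_cast (by omega : 0 < N)
    have hD0 : 0 ≤ dev N k x := dev_nonneg N k x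
    set D := dev N k x
    set Y := ((k : ℝ) + 1) / N with hY
    have hY0 : 0 < Y := by positivity
    have hYa : 0 < Y ^ (-a) := by positivity
    have hxa : 0 < x ^ (-a) := by positivity
    rcases le_total ((k : ℝ) / N) (3 / 4) with hk2 | hk2
    · refine (hnear n N h (C₁ * ρ ^ a₀) x hn8 hnN (by positivity) hx (fun y hy =>
        hP1 y ⟨(min_le_right _ _).trans hy.1, hy.2⟩) k hk2).trans ?_
      have e1 : (1 + D) ^ r ≤ (1 + D) ^ (r + J) := pow_le_pow_right₀ (by linarith) (by omega)
      have e2 : Γ₁ * C₁ ≤ Γ := by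
        have : 0 < Γ₂ * (Cf + C₁) := by positivity
        linarith
      calc _ ≤ Γ₁ * (C₁ * ρ ^ a₀ * (1 + D) ^ (r + J) * (x ^ (-a) + Y ^ (-a))) := by gcongr
        _ = Γ₁ * C₁ * ρ ^ a₀ * ((1 + D) ^ (r + J) * (x ^ (-a) + Y ^ (-a))) := by ring
        _ ≤ _ := by gcongr
    · refine (hfar n N h (Cf + C₁) x hn8 hnN hNK (by positivity) hx hcrude k hk hk2).trans ?_
      have e1 : (1 + D) ^ J ≤ (1 + D) ^ (r + J) := pow_le_pow_right₀ (by linarith) (by omega)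
      have e2 : Γ₂ * (Cf + C₁) ≤ Γ := by
        have : 0 < Γ₁ * C₁ := by positivity
        linarith
      calc _ ≤ Γ₂ * ((Cf + C₁) * ρ ^ a₀ * (1 + D) ^ (r + J) * (x ^ (-a) + Y ^ (-a))) := by
            gcongr
            linarith
        _ = Γ₂ * (Cf + C₁) * ρ ^ a₀ * ((1 + D) ^ (r + J) * (x ^ (-a) + Y ^ (-a))) := by ring
        _ ≤ _ := by gcongr
  have hop : ∀ i < r - 1, |∑ k ∈ Finset.range (d n i + 1),
      modified ψ r n h ((k : ℝ) / d n i) * bern (d n i) k x| ≤ Γ * (S₁ + S₂) * E := by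
    intro i hi
    obtain ⟨hnN, hNK⟩ := (hdK n (by omega)).1 i hi
    set N := d n i
    have h1 := hsum₁ N x (by omega) hxI
    have h2 := hsum₂ N x (by omega) hxI
    simp only [Real.rpow_zero, mul_one, one_mul] at h1 h2
    have hNp : 0 ≤ 1 / (N : ℝ) := by positivity
    have e1 : (x + 1 / N) ^ (-a) ≤ x ^ (-a) :=
      Real.rpow_le_rpow_of_nonpos hx0 (by linarith) (by linarith)
    calc _ ≤ ∑ k ∈ Finset.range (N + 1), Γ * ρ ^ a₀ *
          (x ^ (-a) * (bern N k x * (1 + dev N k x) ^ (r + J)) +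
            bern N k x * ((((k : ℝ) + 1) / N) ^ (-a) * (1 + dev N k x) ^ (r + J))) := by
          refine (Finset.abs_sum_le_sum_abs _ _).trans (Finset.sum_le_sum fun k hk => ?_)
          have hb := bern_nonneg (N := N) (k := k) hxI
          rw [abs_mul, abs_of_nonneg hb]
          have := mul_le_mul_of_nonneg_right
            (hnode N hnN hNK k (Nat.lt_succ_iff.1 (Finset.mem_range.1 hk))) hb
          linarith
      _ = Γ * ρ ^ a₀ * (x ^ (-a) * (∑ k ∈ Finset.range (N + 1),
            bern N k x * (1 + dev N k x) ^ (r + J)) + ∑ k ∈ Finset.range (N + 1),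
            bern N k x * ((((k : ℝ) + 1) / N) ^ (-a) * (1 + dev N k x) ^ (r + J))) := by
          rw [← Finset.mul_sum, Finset.sum_add_distrib, ← Finset.mul_sum]
      _ ≤ Γ * ρ ^ a₀ * (x ^ (-a) * S₂ + S₁ * x ^ (-a)) := by
          have h3 : S₁ * (x + 1 / N) ^ (-a) ≤ S₁ * x ^ (-a) := by gcongr
          gcongr
          exact h1.trans h3
      _ = _ := by rw [hE]; ring
  have hcomb := abs_sum_mul_le (by positivity) (hdK n (by omega)).2 hop
  rw [sub_starOp_eq hr hdc (by omega) hPdeg]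
  calc _ ≤ 2 * C₁ * E + K * (Γ * (S₁ + S₂) * E) := (abs_sub _ _).trans (add_le_add hhx hcomb)
    _ = _ := by ring

/-- The local scale is at most a multiple of `δ_n(x) / √n`. -/
lemma locScale_mul_rpow_le {n : ℕ} (hn : 1 ≤ n) (hlam0 : 0 ≤ lam) {x : ℝ}
    (hx : x ∈ Ioc (0 : ℝ) (1 / 2)) : locScale n x * x ^ (-(lam / 2)) ≤
      2 * ((n : ℝ) ^ (-(1 / 2) : ℝ) * phi x ^ (-lam) * delta n x) := by
  have hn0 : (0 : ℝ) < n := by exact_mod_cast hn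
  have hx0 := hx.1
  have hx1 : 0 < 1 - x := by linarith [hx.2]
  have hs : 0 < Real.sqrt n := Real.sqrt_pos.2 hn0
  have hphi : x ^ (-(lam / 2)) ≤ phi x ^ (-lam) := by
    rw [phi_rpow ⟨hx0, by linarith⟩, neg_div]
    have e1 : 1 ≤ (1 - x) ^ (-(lam / 2)) :=
      Real.one_le_rpow_of_pos_of_le_one_of_nonpos hx1 (by linarith) (by linarith)
    exact le_mul_of_one_le_right (by positivity) e1
  have hsx : Real.sqrt x ≤ 2 * phi x := by
    rw [phi, Real.sqrt_mul hx0.le]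
    have e2 : 1 / 2 ≤ Real.sqrt (1 - x) := Real.le_sqrt_of_sq_le (by linarith [hx.2])
    nlinarith [Real.sqrt_nonneg x]
  have hloc : locScale n x ≤ 2 * ((n : ℝ) ^ (-(1 / 2) : ℝ) * delta n x) := by
    rw [inv_sqrt_eq_rpow, locScale, delta, Real.sqrt_div hx0.le]
    have e3 : 1 / (n : ℝ) = 1 / Real.sqrt n * (1 / Real.sqrt n) := by
      rw [div_mul_div_comm, Real.mul_self_sqrt hn0.le, one_mul]
    have e4 : Real.sqrt x / Real.sqrt n ≤ 1 / Real.sqrt n * (2 * phi x) := by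
      rw [div_eq_mul_one_div, mul_comm]
      gcongr
    have e5 : 0 < 1 / (n : ℝ) := by positivity
    rw [e3] at e5 ⊢
    linarith
  calc _ ≤ 2 * ((n : ℝ) ^ (-(1 / 2) : ℝ) * delta n x) * phi x ^ (-lam) := by
        gcongr
        have : 0 < delta n x := by
          have := phi_pos (x := x) ⟨hx0, by linarith⟩
          unfold delta
          positivity
        positivity
    _ = _ := by ring

lemma HalfSmooth.exists_weight_mul_le (hr : 1 ≤ r) (hψ : IsCutoff r ψ)
    (hdc : IsCombination (r - 1) d c) (hα : 0 < α) (hβ : 0 < β) (ha₀ : 0 < a₀)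
    (hlam0 : 0 ≤ lam) (hf : MemCw α β f) (hS : HalfSmooth r α lam a₀ f) :
    ∃ C : ℝ, ∃ n₀ : ℕ, 0 < C ∧ ∀ n : ℕ, n₀ ≤ n → ∀ x ∈ Ioc (0 : ℝ) (1 / 2),
      weight α β x * |f x - starOp ψ r d c n f x| ≤
        C * ((n : ℝ) ^ (-(1 / 2) : ℝ) * phi x ^ (-lam) * delta n x) ^ a₀ := by
  obtain ⟨C, n₀, hC, h⟩ := hS.exists_abs_sub_starOp_le hr hψ hdc hα hβ ha₀ hlam0 hf
  refine ⟨C * 2 ^ a₀, n₀ + 1, by positivity, fun n hn x hx => ?_⟩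
  have hx0 := hx.1
  have hx1 : 0 < 1 - x := by linarith [hx.2]
  have hn0 : (0 : ℝ) < n := by exact_mod_cast (by omega : 0 < n)
  have hρ0 : 0 < locScale n x := lt_of_lt_of_le (by positivity) (one_div_le_locScale n x)
  have hw : weight α β x ≤ x ^ α := by
    rw [weight]
    exact mul_le_of_le_one_right (by positivity)
      (Real.rpow_le_one hx1.le (by linarith) hβ.le)
  have hW : 0 < (n : ℝ) ^ (-(1 / 2) : ℝ) * phi x ^ (-lam) * delta n x := by
    have := phi_pos (x := x) ⟨hx0, by linarith⟩
    have hd : 0 < delta n x := by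
      unfold delta
      positivity
    positivity
  set W := (n : ℝ) ^ (-(1 / 2) : ℝ) * phi x ^ (-lam) * delta n x
  have e : x ^ α * (C * (locScale n x ^ a₀ * x ^ (-(α + lam * a₀ / 2)))) =
      C * (locScale n x * x ^ (-(lam / 2))) ^ a₀ := by
    rw [Real.mul_rpow hρ0.le (by positivity), ← Real.rpow_mul hx0.le,
      show -(α + lam * a₀ / 2) = -α + -(lam / 2) * a₀ by ring, Real.rpow_add hx0,
      Real.rpow_neg hx0.le α]
    field_simp
  calc _ ≤ x ^ α * (C * (locScale n x ^ a₀ * x ^ (-(α + lam * a₀ / 2)))) := by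
        gcongr
        exact h n (by omega) x hx
    _ = C * (locScale n x * x ^ (-(lam / 2))) ^ a₀ := e
    _ ≤ C * (2 * W) ^ a₀ :=
        mul_le_mul_of_nonneg_left (Real.rpow_le_rpow (by positivity)
          (locScale_mul_rpow_le (by omega) hlam0 hx) ha₀.le) hC.le
    _ = _ := by
        rw [Real.mul_rpow (by norm_num) hW.le]
        ring

end Direct

/-! ### Reflection -/

section Reflection

variable {r : ℕ} {ψ : ℝ → ℝ} {d : ℕ → ℕ → ℕ} {c : ℕ → ℕ → ℝ} {α β a₀ lam : ℝ} {f : ℝ → ℝ}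

lemma weight_reflect (α β x : ℝ) : weight β α (1 - x) = weight α β x := by
  rw [weight, weight, sub_sub_cancel, mul_comm]

lemma phi_reflect (x : ℝ) : phi (1 - x) = phi x := by
  rw [phi, phi, sub_sub_cancel, mul_comm]

lemma delta_reflect (n : ℕ) (x : ℝ) : delta n (1 - x) = delta n x := by
  rw [delta, delta, phi_reflect]

lemma tendsto_one_sub_nhdsGT : Tendsto (fun x : ℝ => 1 - x) (𝓝[>] 0) (𝓝[<] 1) := by
  refine tendsto_nhdsWithin_iff.2 ⟨?_, ?_⟩
  · have : Tendsto (fun x : ℝ => 1 - x) (𝓝 0) (𝓝 (1 - 0)) := (continuous_const.sub continuous_id).tendsto 0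
    rw [sub_zero] at this
    exact this.mono_left nhdsWithin_le_nhds
  · filter_upwards [self_mem_nhdsWithin] with x hx
    have : (0 : ℝ) < x := hx
    exact mem_Iio.2 (by linarith)

lemma tendsto_one_sub_nhdsLT : Tendsto (fun x : ℝ => 1 - x) (𝓝[<] 1) (𝓝[>] 0) := by
  refine tendsto_nhdsWithin_iff.2 ⟨?_, ?_⟩
  · have : Tendsto (fun x : ℝ => 1 - x) (𝓝 1) (𝓝 (1 - 1)) := (continuous_const.sub continuous_id).tendsto 1
    rw [sub_self] at this
    exact this.mono_left nhdsWithin_le_nhds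
  · filter_upwards [self_mem_nhdsWithin] with x hx
    have : x < (1 : ℝ) := hx
    exact mem_Ioi.2 (by linarith)

lemma MemCw.reflect (hf : MemCw α β f) : MemCw β α (fun t => f (1 - t)) where
  continuousOn := hf.continuousOn.comp (by fun_prop) fun x hx =>
    ⟨by linarith [hx.2], by linarith [hx.1]⟩
  tendsto_zero := by
    refine (hf.tendsto_one.comp tendsto_one_sub_nhdsGT).congr fun x => ?_
    rw [Function.comp_apply, weight_reflect]
  tendsto_one := by
    refine (hf.tendsto_zero.comp tendsto_one_sub_nhdsLT).congr fun x => ?_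
    rw [Function.comp_apply, weight_reflect]

lemma bernsteinOp_reflect {N : ℕ} (hN : 1 ≤ N) (g : ℝ → ℝ) (x : ℝ) :
    bernsteinOp N (fun t => g (1 - t)) x = bernsteinOp N g (1 - x) := by
  have hN0 : (N : ℝ) ≠ 0 := by positivity
  unfold bernsteinOp
  rw [← Finset.sum_range_reflect]
  refine Finset.sum_congr rfl fun k hk => ?_
  have hk' : k ≤ N := Nat.lt_succ_iff.1 (Finset.mem_range.1 hk)
  rw [show N + 1 - 1 - k = N - k by omega, Nat.choose_symm hk', Nat.sub_sub_self hk',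
    sub_sub_cancel, Nat.cast_sub hk']
  have : 1 - ((N : ℝ) - k) / N = k / N := by
    field_simp
    ring
  simp only [this]
  ring

lemma starOp_reflect (hψ : IsCutoff r ψ) (hdc : IsCombination (r - 1) d c) {n : ℕ} (hn : 5 ≤ n)
    (f : ℝ → ℝ) (x : ℝ) :
    starOp ψ r d c n (fun t => f (1 - t)) x = starOp ψ r d c n f (1 - x) := by
  have h : modified ψ r n (fun t => f (1 - t)) = fun y => modified ψ r n f (1 - y) :=
    funext fun y => modified_reflect hψ hn f y
  rw [starOp, starOp, h, combination, combination]
  refine Finset.sum_congr rfl fun i hi => ?_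
  have := hdc.le_node (n := n) (by omega) (Finset.mem_range.1 hi)
  rw [bernsteinOp_reflect (by omega) (modified ψ r n f)]

lemma StarRate.reflect (hψ : IsCutoff r ψ) (hdc : IsCombination (r - 1) d c)
    (hE : StarRate α β r a₀ lam d c ψ f) :
    StarRate β α r a₀ lam d c ψ (fun t => f (1 - t)) := by
  obtain ⟨C, N, h⟩ := hE
  refine ⟨C, N + 5, fun n hn x hx => ?_⟩
  have := h n (by omega) (1 - x) ⟨by linarith [hx.2], by linarith [hx.1]⟩
  rw [starOp_reflect hψ hdc (by omega)]
  rwa [phi_reflect, delta_reflect, ← weight_reflect, sub_sub_cancel] at this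

/-- The rate of approximation is equivalent to one-sided smoothness at both ends. -/
theorem starRate_iff (hr : 2 ≤ r) (hψ : IsCutoff r ψ) (hdc : IsCombination (r - 1) d c)
    (hα : 0 < α) (hβ : 0 < β) (ha₀ : 0 < a₀) (har : a₀ < r) (hlam0 : 0 ≤ lam) (hlam1 : lam ≤ 1)
    (hf : MemCw α β f) :
    StarRate α β r a₀ lam d c ψ f ↔
      HalfSmooth r α lam a₀ f ∧ HalfSmooth r β lam a₀ (fun t => f (1 - t)) := by
  constructor
  · intro hE
    exact ⟨hE.halfSmooth hr hψ hdc hα hβ ha₀ har hlam0 hlam1,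
      (hE.reflect hψ hdc).halfSmooth hr hψ hdc hβ hα ha₀ har hlam0 hlam1⟩
  · rintro ⟨h1, h2⟩
    obtain ⟨C₁, n₁, hC₁, h1⟩ := h1.exists_weight_mul_le (by omega) hψ hdc hα hβ ha₀ hlam0 hf
    obtain ⟨C₂, n₂, hC₂, h2⟩ := h2.exists_weight_mul_le (by omega) hψ hdc hβ hα ha₀ hlam0 hf.reflect
    refine ⟨C₁ + C₂, n₁ + n₂ + 5, fun n hn x hx => ?_⟩
    have hW : 0 ≤ (n : ℝ) ^ (-(1 / 2) : ℝ) * phi x ^ (-lam) * delta n x := by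
      have := phi_pos hx
      unfold delta
      positivity
    have hWa : 0 ≤ ((n : ℝ) ^ (-(1 / 2) : ℝ) * phi x ^ (-lam) * delta n x) ^ a₀ := by positivity
    rcases le_total x (1 / 2) with hx2 | hx2
    · refine (h1 n (by omega) x ⟨hx.1, hx2⟩).trans ?_
      gcongr
      linarith
    · have := h2 n (by omega) (1 - x) ⟨by linarith [hx.2], by linarith⟩
      rw [starOp_reflect hψ hdc (by omega), phi_reflect, delta_reflect, weight_reflect,
        sub_sub_cancel] at this
      refine this.trans ?_
      gcongr
      linarith

end Reflection

/-! ### The modulus of smoothness -/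

section Modulus

variable {r : ℕ} {α β a₀ lam t B : ℝ} {f : ℝ → ℝ}

/-- All the weighted differences entering the modulus of smoothness at `t` are at most `B`. -/
def DiffBound (α β : ℝ) (r : ℕ) (lam : ℝ) (f : ℝ → ℝ) (t B : ℝ) : Prop :=
  (∀ h ∈ Ioc 0 t, ∀ x ∈ Icc (endScale r lam t) (1 - endScale r lam t),
    |weight α β x * centralDiff r f (h * phi x ^ lam) x| ≤ B) ∧
  (∀ h ∈ Ioc 0 (endScale r lam t), ∀ x ∈ Icc 0 (12 * endScale r lam t),
    |weight α β x * forwardDiff r f h x| ≤ B) ∧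
  (∀ h ∈ Ioc 0 (endScale r lam t), ∀ x ∈ Icc (1 - 12 * endScale r lam t) 1,
    |weight α β x * backwardDiff r f h x| ≤ B)

lemma DiffBound.of_modulus_le (hB : 0 ≤ B)
    (h : modulus α β r lam f t ≤ ENNReal.ofReal B) : DiffBound α β r lam f t B := by
  unfold modulus at h
  have h12 := (le_self_add).trans h
  have h1 := (le_self_add).trans h12
  have h2 := (le_add_self).trans h12
  have h3 := (le_add_self).trans h
  simp only [iSup_le_iff, ENNReal.ofReal_le_ofReal_iff hB] at h1 h2 h3
  exact ⟨h1, h2, h3⟩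

lemma DiffBound.modulus_le (hB : 0 ≤ B) (h : DiffBound α β r lam f t B) :
    modulus α β r lam f t ≤ ENNReal.ofReal (3 * B) := by
  have e : ENNReal.ofReal (3 * B) =
      ENNReal.ofReal B + ENNReal.ofReal B + ENNReal.ofReal B := by
    rw [← ENNReal.ofReal_add hB hB, ← ENNReal.ofReal_add (by positivity) hB]
    congr 1
    ring
  rw [e]
  obtain ⟨h1, h2, h3⟩ := h
  unfold modulus
  refine add_le_add (add_le_add ?_ ?_) ?_
  · simpa only [iSup_le_iff, ENNReal.ofReal_le_ofReal_iff hB] using h1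
  · simpa only [iSup_le_iff, ENNReal.ofReal_le_ofReal_iff hB] using h2
  · simpa only [iSup_le_iff, ENNReal.ofReal_le_ofReal_iff hB] using h3

lemma DiffBound.reflect (h : DiffBound α β r lam f t B) :
    DiffBound β α r lam (fun u => f (1 - u)) t B := by
  obtain ⟨h1, h2, h3⟩ := h
  refine ⟨fun s hs x hx => ?_, fun s hs x hx => ?_, fun s hs x hx => ?_⟩
  · have := h1 s hs (1 - x) ⟨by linarith [hx.2], by linarith [hx.1]⟩
    rw [abs_mul, ← weight_reflect, sub_sub_cancel, phi_reflect, ← abs_centralDiff_reflect,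
      sub_sub_cancel, ← abs_mul] at this
    exact this
  · have := h3 s hs (1 - x) ⟨by linarith [hx.2], by linarith [hx.1]⟩
    rw [abs_mul, ← weight_reflect, sub_sub_cancel, abs_backwardDiff_eq_forwardDiff,
      sub_sub_cancel, ← abs_mul] at this
    exact this
  · have := h2 s hs (1 - x) ⟨by linarith [hx.2], by linarith [hx.1]⟩
    rw [abs_mul, ← weight_reflect, sub_sub_cancel] at this
    rw [abs_mul, abs_backwardDiff_eq_forwardDiff]
    simpa only [sub_sub_cancel] using this

/-- The modulus of smoothness is `O(t ^ a₀)` exactly when all its differences are. -/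
lemma modulus_isBigO_iff : (∃ C : ℝ, ∀ᶠ t in 𝓝[>] (0 : ℝ),
      modulus α β r lam f t ≤ ENNReal.ofReal (C * t ^ a₀)) ↔
    ∃ C t₀ : ℝ, 0 < C ∧ 0 < t₀ ∧ ∀ t ∈ Ioo 0 t₀, DiffBound α β r lam f t (C * t ^ a₀) := by
  constructor
  · rintro ⟨C, hC⟩
    obtain ⟨t₀, ht₀, h⟩ := mem_nhdsGT_iff_exists_Ioo_subset.1 hC
    refine ⟨max C 1, t₀, by positivity, ht₀, fun t ht => ?_⟩
    have ht0 := ht.1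
    refine DiffBound.of_modulus_le (by positivity) ?_
    have h1 : modulus α β r lam f t ≤ ENNReal.ofReal (C * t ^ a₀) := h ht
    refine h1.trans (ENNReal.ofReal_le_ofReal ?_)
    gcongr
    exact le_max_left _ _
  · rintro ⟨C, t₀, hC, ht₀, h⟩
    refine ⟨3 * C, mem_nhdsGT_iff_exists_Ioo_subset.2 ⟨t₀, ht₀, fun t ht => ?_⟩⟩
    have ht0 := ht.1
    have := (h t ht).modulus_le (by positivity)
    rwa [← mul_assoc] at this

lemma endScale_pos (hr : 1 ≤ r) (ht : 0 < t) : 0 < endScale r lam t := by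
  have : (0 : ℝ) < r := by exact_mod_cast hr
  unfold endScale
  positivity

lemma endScale_rpow (hlam1 : lam ≤ 1) (ht : 0 ≤ t) :
    endScale r lam t ^ (1 - lam / 2) = r * t := by
  rw [endScale, ← Real.rpow_mul (by positivity), one_div, inv_mul_cancel₀ (by linarith),
    Real.rpow_one]

lemma endScale_le (hlam0 : 0 ≤ lam) (hlam1 : lam ≤ 1) (hr : 1 ≤ r) (ht : 0 < t)
    (hrt : r * t ≤ 1) : endScale r lam t ≤ r * t := by
  have hr0 : (0 : ℝ) < r := by exact_mod_cast hr
  have h1 : 1 ≤ 1 / (1 - lam / 2) := by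
    rw [le_div_iff₀ (by linarith)]
    linarith
  calc endScale r lam t ≤ ((r : ℝ) * t) ^ (1 : ℝ) :=
        Real.rpow_le_rpow_of_exponent_ge (by positivity) hrt h1
    _ = _ := Real.rpow_one _

lemma endScale_le_of_le (hlam1 : lam ≤ 1) (ht : 0 ≤ t) {u : ℝ} (hu : 0 ≤ u)
    (h : r * t ≤ u ^ (1 - lam / 2)) : endScale r lam t ≤ u := by
  rw [← endScale_rpow hlam1 ht] at h
  exact (Real.rpow_le_rpow_iff (by unfold endScale; positivity) hu (by linarith)).1 h

/-- One-sided smoothness bounds the central differences in the left half and the forward part of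
the modulus. -/
lemma HalfSmooth.exists_diff_le (hr : 1 ≤ r) (hα : 0 < α) (hβ : 0 < β) (ha₀ : 0 < a₀)
    (hlam0 : 0 ≤ lam) (hlam1 : lam ≤ 1) (hS : HalfSmooth r α lam a₀ f) :
    ∃ C t₀ : ℝ, 0 < C ∧ 0 < t₀ ∧ ∀ t ∈ Ioo 0 t₀,
      (∀ h ∈ Ioc 0 t, ∀ x ∈ Icc (endScale r lam t) (1 / 2),
        |weight α β x * centralDiff r f (h * phi x ^ lam) x| ≤ C * t ^ a₀) ∧
      (∀ h ∈ Ioc 0 (endScale r lam t), ∀ x ∈ Icc 0 (12 * endScale r lam t),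
        |weight α β x * forwardDiff r f h x| ≤ C * t ^ a₀) := by
  obtain ⟨C, h₀, hC, hh₀, hS⟩ := hS
  have hr1 : (1 : ℝ) ≤ r := by exact_mod_cast hr
  have hr0 : (0 : ℝ) < r := by linarith
  have hla : 0 ≤ lam * a₀ / 2 := by positivity
  refine ⟨C * 2 ^ (lam * a₀ / 2) * 2 ^ α + C * (r : ℝ) ^ a₀, min (1 / 16) h₀ / r,
    by positivity, by positivity, fun t ht => ?_⟩
  have ht0 := ht.1
  have hrt : r * t ≤ min (1 / 16) h₀ := by
    have := ht.2.le
    rw [le_div_iff₀ hr0] at this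
    linarith
  have hrt1 : r * t ≤ 1 / 16 := hrt.trans (min_le_left _ _)
  have hrt2 : r * t ≤ h₀ := hrt.trans (min_le_right _ _)
  have htrt : t ≤ r * t := le_mul_of_one_le_left ht0.le hr1
  have hE := endScale_le hlam0 hlam1 hr ht0 (by linarith)
  have hE0 := endScale_pos (lam := lam) hr ht0
  have hEθ := endScale_rpow (r := r) hlam1 ht0.le
  have hta : 0 < t ^ a₀ := by positivity
  have hw : ∀ x ∈ Ioo (0 : ℝ) 1, weight α β x ≤ x ^ α := fun x hx => by
    rw [weight]
    have hx0 := hx.1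
    exact mul_le_of_le_one_right (by positivity)
      (Real.rpow_le_one (by linarith [hx.2]) (by linarith) hβ.le)
  refine ⟨fun h hh x hx => ?_, fun h hh x hx => ?_⟩
  · have hx0 : 0 < x := lt_of_lt_of_le hE0 hx.1
    have hxI : x ∈ Ioo (0 : ℝ) 1 := ⟨hx0, by linarith [hx.2]⟩
    have hh0 := hh.1
    have hφ : phi x ^ lam ≤ x ^ (lam / 2) := by
      rw [phi_rpow hxI]
      exact mul_le_of_le_one_right (by positivity)
        (Real.rpow_le_one (by linarith [hx.2]) (by linarith) (by linarith))
    have hφ0 : 0 < phi x ^ lam := Real.rpow_pos_of_pos (phi_pos hxI) _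
    have hx1 : x ^ (lam / 2) ≤ 1 := Real.rpow_le_one hx0.le hxI.2.le (by linarith)
    set s := h * phi x ^ lam with hs
    have hs0 : 0 < s := by positivity
    have hst : s ≤ t := by
      calc s ≤ t * 1 := by
            rw [hs]
            gcongr
            · exact hh.2
            · linarith
        _ = t := mul_one t
    have hrs : r * s ≤ x := by
      calc r * s = r * h * phi x ^ lam := by rw [hs]; ring
        _ ≤ r * t * x ^ (lam / 2) := by
            gcongr
            exact hh.2
        _ ≤ x ^ (1 - lam / 2) * x ^ (lam / 2) := by
            rw [← hEθ]
            gcongr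
            · linarith
            · exact hx.1
        _ = x := by
            rw [← Real.rpow_add hx0]
            simp
    set y := x - r / 2 * s with hy
    have hyx : x / 2 ≤ y := by linarith
    have hy0 : 0 < y := by linarith
    have hyx' : y ≤ x := by
      have : 0 < r / 2 * s := by positivity
      linarith
    have hd := hS y ⟨hy0, by linarith [hx.2]⟩ s ⟨hs0, by linarith⟩
    have e1 : s ^ a₀ ≤ t ^ a₀ * x ^ (lam * a₀ / 2) := by
      calc s ^ a₀ ≤ (t * x ^ (lam / 2)) ^ a₀ := by
            refine Real.rpow_le_rpow hs0.le ?_ ha₀.le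
            rw [hs]
            gcongr
            exact hh.2
        _ = _ := by
            rw [Real.mul_rpow ht0.le (by positivity), ← Real.rpow_mul hx0.le]
            congr 2
            ring
    have e2 : ∀ p : ℝ, 0 ≤ p → (x / 2) ^ (-p) = 2 ^ p * x ^ (-p) := fun p _ => by
      rw [Real.div_rpow hx0.le (by norm_num), Real.rpow_neg (by norm_num : (0 : ℝ) ≤ 2),
        div_inv_eq_mul, mul_comm]
    have e3 : max s y ^ (-(lam * a₀ / 2)) ≤ 2 ^ (lam * a₀ / 2) * x ^ (-(lam * a₀ / 2)) := by
      rw [← e2 _ hla]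
      exact Real.rpow_le_rpow_of_nonpos (by positivity) (hyx.trans (le_max_right _ _)) (by linarith)
    have e4 : y ^ (-α) ≤ 2 ^ α * x ^ (-α) := by
      rw [← e2 _ hα.le]
      exact Real.rpow_le_rpow_of_nonpos (by positivity) hyx (by linarith)
    rw [abs_mul, abs_of_pos (weight_pos hxI), centralDiff_eq_forwardDiff]
    calc _ ≤ x ^ α * (C * (t ^ a₀ * x ^ (lam * a₀ / 2) *
          (2 ^ (lam * a₀ / 2) * x ^ (-(lam * a₀ / 2))) * (2 ^ α * x ^ (-α)))) := by
          refine mul_le_mul (hw x hxI) (hd.trans ?_) (abs_nonneg _) (by positivity)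
          gcongr
      _ = C * 2 ^ (lam * a₀ / 2) * 2 ^ α * t ^ a₀ := by
          rw [Real.rpow_neg hx0.le, Real.rpow_neg hx0.le]
          field_simp
      _ ≤ _ := by
          gcongr
          have : 0 < C * (r : ℝ) ^ a₀ := by positivity
          linarith
  · rcases eq_or_lt_of_le hx.1 with hx0 | hx0
    · rw [← hx0, weight, Real.zero_rpow hα.ne', zero_mul, zero_mul, abs_zero]
      positivity
    have hh0 := hh.1
    have hxI : x ∈ Ioo (0 : ℝ) 1 := ⟨hx0, by linarith [hx.2]⟩
    have hd := hS x ⟨hx0, by linarith [hx.2]⟩ h ⟨hh0, by linarith [hh.2]⟩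
    have e1 : max h x ^ (-(lam * a₀ / 2)) ≤ h ^ (-(lam * a₀ / 2)) :=
      Real.rpow_le_rpow_of_nonpos hh0 (le_max_left _ _) (by linarith)
    have e2 : h ^ a₀ * h ^ (-(lam * a₀ / 2)) ≤ (r : ℝ) ^ a₀ * t ^ a₀ := by
      rw [← Real.mul_rpow hr0.le ht0.le, ← hEθ, ← Real.rpow_mul hE0.le, ← Real.rpow_add hh0,
        show a₀ + -(lam * a₀ / 2) = (1 - lam / 2) * a₀ by ring]
      exact Real.rpow_le_rpow hh0.le hh.2 (mul_nonneg (by linarith) ha₀.le)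
    rw [abs_mul, abs_of_pos (weight_pos hxI)]
    calc _ ≤ x ^ α * (C * (h ^ a₀ * h ^ (-(lam * a₀ / 2)) * x ^ (-α))) := by
          refine mul_le_mul (hw x hxI) (hd.trans ?_) (abs_nonneg _) (by positivity)
          gcongr
      _ = C * (h ^ a₀ * h ^ (-(lam * a₀ / 2))) := by
          rw [Real.rpow_neg hx0.le α]
          field_simp
      _ ≤ C * ((r : ℝ) ^ a₀ * t ^ a₀) := by gcongr
      _ = C * (r : ℝ) ^ a₀ * t ^ a₀ := by ring
      _ ≤ _ := by
          gcongr
          have : 0 < C * 2 ^ (lam * a₀ / 2) * (2 : ℝ) ^ α := by positivity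
          linarith

/-- Central differences with variable step control forward differences away from the end, and the
forward part of the modulus controls them near the end. -/
lemma halfSmooth_of_diffBound (hr : 1 ≤ r) (hα : 0 < α) (hβ : 0 < β) (ha₀ : 0 < a₀)
    (hlam0 : 0 ≤ lam) (hlam1 : lam ≤ 1) {C t₀ : ℝ} (hC : 0 < C) (ht₀ : 0 < t₀)
    (hB : ∀ t ∈ Ioo 0 t₀, DiffBound α β r lam f t (C * t ^ a₀)) : HalfSmooth r α lam a₀ f := by
  have hr1 : (1 : ℝ) ≤ r := by exact_mod_cast hr
  have hr0 : (0 : ℝ) < r := by linarith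
  have hla : 0 ≤ lam * a₀ / 2 := by positivity
  set θ := 1 - lam / 2 with hθ
  have hθ0 : 0 < θ := by linarith
  have hη0 : 0 < min (1 / 72) ((t₀ / 4) ^ 2) := by positivity
  refine ⟨C * 3 ^ a₀ * 8 ^ β + C * (r : ℝ) ^ (θ * a₀) * (9 * r) ^ (lam * a₀ / 2) * 8 ^ β,
    min (1 / 72) ((t₀ / 4) ^ 2) / r, by positivity, by positivity, fun y hy h hh => ?_⟩
  have hy0 := hy.1
  have hh0 := hh.1
  have hrh0 : 0 < r * h := by positivity
  have hrh : r * h ≤ min (1 / 72) ((t₀ / 4) ^ 2) := by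
    have := hh.2
    rw [le_div_iff₀ hr0] at this
    linarith
  have hrh1 : r * h ≤ 1 / 72 := hrh.trans (min_le_left _ _)
  have hrhθ : 3 * (r * h) ^ θ < t₀ := by
    have e1 : (r * h) ^ θ ≤ (r * h) ^ (1 / 2 : ℝ) :=
      Real.rpow_le_rpow_of_exponent_ge hrh0 (by linarith) (by linarith)
    have e2 : (r * h) ^ (1 / 2 : ℝ) ≤ t₀ / 4 := by
      rw [← Real.sqrt_eq_rpow, Real.sqrt_le_left (by positivity)]
      exact hrh.trans (min_le_right _ _)
    linarith
  have h8 : ∀ z : ℝ, z ≤ 7 / 8 → (1 - z) ^ (-β) ≤ 8 ^ β := fun z hz => by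
    calc (1 - z) ^ (-β) ≤ (1 / 8 : ℝ) ^ (-β) :=
          Real.rpow_le_rpow_of_nonpos (by norm_num) (by linarith) (by linarith)
      _ = 8 ^ β := by
          rw [one_div, Real.inv_rpow (by norm_num), Real.rpow_neg (by norm_num), inv_inv]
  have hhy : h ≤ r * h := le_mul_of_one_le_left hh0.le hr1
  rcases le_total (9 * (r * h)) y with hcase | hcase
  · -- the central difference at the midpoint `z`, with `t` chosen so that the step is `h`
    set z := y + r / 2 * h with hz
    have hzy : y ≤ z := by
      have : 0 < r / 2 * h := by positivity
      linarith
    have hz78 : z ≤ 7 / 8 := by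
      have : r / 2 * h = r * h / 2 := by ring
      linarith [hy.2]
    have hz0 : 0 < z := by linarith
    have hzI : z ∈ Ioo (0 : ℝ) 1 := ⟨hz0, by linarith⟩
    have hφ0 : 0 < phi z := phi_pos hzI
    have hφ : phi z ^ (-lam) ≤ 3 * z ^ (-(lam / 2)) := by
      rw [phi_rpow hzI, neg_div, mul_comm]
      have e1 : (1 - z) ^ (-(lam / 2)) ≤ 3 := by
        calc (1 - z) ^ (-(lam / 2)) ≤ (1 / 9 : ℝ) ^ (-(lam / 2)) :=
              Real.rpow_le_rpow_of_nonpos (by norm_num) (by linarith) (by linarith)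
          _ ≤ (1 / 9 : ℝ) ^ (-(1 / 2) : ℝ) :=
              Real.rpow_le_rpow_of_exponent_ge (by norm_num) (by norm_num) (by linarith)
          _ = 3 := by
              rw [one_div, Real.inv_rpow (by norm_num), Real.rpow_neg (by norm_num), inv_inv,
                ← Real.sqrt_eq_rpow, show (9 : ℝ) = 3 ^ 2 by norm_num,
                Real.sqrt_sq (by norm_num)]
      gcongr
    set t := h * phi z ^ (-lam) with ht
    have ht0 : 0 < t := by positivity
    have hrt : r * t ≤ 3 * (r * h) ^ θ := by
      have e1 : z ^ (-(lam / 2)) ≤ (r * h) ^ (-(lam / 2)) :=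
        Real.rpow_le_rpow_of_nonpos hrh0 (by linarith) (by linarith)
      calc r * t = r * h * phi z ^ (-lam) := by rw [ht]; ring
        _ ≤ r * h * (3 * (r * h) ^ (-(lam / 2))) := by
            gcongr
            exact hφ.trans (by gcongr)
        _ = 3 * (r * h) ^ θ := by
            rw [hθ, sub_eq_add_neg, Real.rpow_add hrh0, Real.rpow_one]
            ring
    have htt : t ≤ r * t := le_mul_of_one_le_left ht0.le hr1
    have hE : endScale r lam t ≤ 9 * (r * h) := by
      refine endScale_le_of_le hlam1 ht0.le (by positivity) (hrt.trans ?_)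
      rw [← hθ, Real.mul_rpow (by norm_num) hrh0.le]
      have : (3 : ℝ) ≤ 9 ^ θ := by
        calc (3 : ℝ) = 9 ^ (1 / 2 : ℝ) := by
              rw [← Real.sqrt_eq_rpow, show (9 : ℝ) = 3 ^ 2 by norm_num,
                Real.sqrt_sq (by norm_num)]
          _ ≤ 9 ^ θ := Real.rpow_le_rpow_of_exponent_le (by norm_num) (by linarith)
      gcongr
    have hc := (hB t ⟨ht0, by linarith⟩).1 t ⟨ht0, le_rfl⟩ z ⟨by linarith, by linarith⟩
    have hstep : t * phi z ^ lam = h := by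
      rw [ht, Real.rpow_neg hφ0.le]
      field_simp
    rw [hstep, centralDiff_eq_forwardDiff, hz, add_sub_cancel_right, ← hz, abs_mul,
      abs_of_pos (weight_pos hzI)] at hc
    refine (le_weight_inv_mul hzI hc).trans ?_
    have e1 : t ^ a₀ ≤ h ^ a₀ * (3 ^ a₀ * max h y ^ (-(lam * a₀ / 2))) := by
      rw [max_eq_right (show h ≤ y by linarith)]
      calc t ^ a₀ ≤ (h * (3 * y ^ (-(lam / 2)))) ^ a₀ := by
            refine Real.rpow_le_rpow ht0.le ?_ ha₀.le
            rw [ht]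
            gcongr
            exact hφ.trans (mul_le_mul_of_nonneg_left
              (Real.rpow_le_rpow_of_nonpos hy0 hzy (by linarith)) (by norm_num))
        _ = _ := by
            rw [Real.mul_rpow hh0.le (by positivity), Real.mul_rpow (by norm_num) (by positivity),
              ← Real.rpow_mul hy0.le]
            congr 4
            ring
    have e2 : z ^ (-α) ≤ y ^ (-α) := Real.rpow_le_rpow_of_nonpos hy0 hzy (by linarith)
    have hz1 : 0 ≤ (1 - z) ^ (-β) := Real.rpow_nonneg (by linarith) _
    calc C * t ^ a₀ * (z ^ (-α) * (1 - z) ^ (-β)) ≤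
          C * (h ^ a₀ * (3 ^ a₀ * max h y ^ (-(lam * a₀ / 2)))) * (y ^ (-α) * 8 ^ β) := by
          gcongr
          exact h8 z hz78
      _ = C * 3 ^ a₀ * 8 ^ β * (h ^ a₀ * max h y ^ (-(lam * a₀ / 2)) * y ^ (-α)) := by ring
      _ ≤ _ := by
          gcongr
          have : 0 < C * (r : ℝ) ^ (θ * a₀) * (9 * r) ^ (lam * a₀ / 2) * 8 ^ β := by positivity
          linarith
  · -- the forward difference, with `t` chosen so that `endScale r lam t = r * h`
    set t := (r * h) ^ θ / r with ht
    have ht0 : 0 < t := by positivity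
    have hrt : r * t = (r * h) ^ θ := by
      rw [ht]
      field_simp
    have htt : t ≤ r * t := le_mul_of_one_le_left ht0.le hr1
    have hE : endScale r lam t = r * h := by
      rw [endScale, hrt, ← hθ, ← Real.rpow_mul hrh0.le, mul_one_div_cancel hθ0.ne', Real.rpow_one]
    have hrhθ0 : 0 < (r * h) ^ θ := by positivity
    have hyI : y ∈ Ioo (0 : ℝ) 1 := ⟨hy0, by linarith [hy.2]⟩
    have hc := (hB t ⟨ht0, by linarith⟩).2.1 h ⟨hh0, by rw [hE]; exact hhy⟩ y
      ⟨hy0.le, by rw [hE]; linarith⟩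
    rw [abs_mul, abs_of_pos (weight_pos hyI)] at hc
    refine (le_weight_inv_mul hyI hc).trans ?_
    have hm0 : 0 < max h y := by positivity
    have e1 : h ^ (-(lam * a₀ / 2)) ≤ (9 * r) ^ (lam * a₀ / 2) * max h y ^ (-(lam * a₀ / 2)) := by
      have hm : max h y / (9 * r) ≤ h := by
        rw [div_le_iff₀ (by positivity)]
        exact max_le (by nlinarith) (by linarith)
      calc h ^ (-(lam * a₀ / 2)) ≤ (max h y / (9 * r)) ^ (-(lam * a₀ / 2)) :=
            Real.rpow_le_rpow_of_nonpos (by positivity) hm (by linarith)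
        _ = _ := by
            rw [Real.div_rpow hm0.le (by positivity), Real.rpow_neg (by positivity : 0 ≤ 9 * (r : ℝ)),
              div_inv_eq_mul, mul_comm]
    have e2 : t ^ a₀ ≤ (r : ℝ) ^ (θ * a₀) * (h ^ a₀ * h ^ (-(lam * a₀ / 2))) := by
      calc t ^ a₀ ≤ ((r * h) ^ θ) ^ a₀ := by
            refine Real.rpow_le_rpow ht0.le ?_ ha₀.le
            linarith
        _ = _ := by
            rw [← Real.rpow_mul hrh0.le, Real.mul_rpow hr0.le hh0.le, ← Real.rpow_add hh0, hθ]
            congr 2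
            ring
    have hy1 : 0 ≤ (1 - y) ^ (-β) := Real.rpow_nonneg (by linarith [hyI.2]) _
    calc C * t ^ a₀ * (y ^ (-α) * (1 - y) ^ (-β)) ≤ C * ((r : ℝ) ^ (θ * a₀) * (h ^ a₀ *
          ((9 * r) ^ (lam * a₀ / 2) * max h y ^ (-(lam * a₀ / 2))))) * (y ^ (-α) * 8 ^ β) := by
          gcongr
          · exact e2.trans (by gcongr)
          · exact h8 y (by linarith [hy.2])
      _ = C * (r : ℝ) ^ (θ * a₀) * (9 * r) ^ (lam * a₀ / 2) * 8 ^ β *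
            (h ^ a₀ * max h y ^ (-(lam * a₀ / 2)) * y ^ (-α)) := by ring
      _ ≤ _ := by
          gcongr
          have : 0 < C * 3 ^ a₀ * (8 : ℝ) ^ β := by positivity
          linarith

/-- The order of the modulus of smoothness is equivalent to one-sided smoothness at both ends. -/
theorem modulus_iff (hr : 1 ≤ r) (hα : 0 < α) (hβ : 0 < β) (ha₀ : 0 < a₀)
    (hlam0 : 0 ≤ lam) (hlam1 : lam ≤ 1) :
    (∃ C : ℝ, ∀ᶠ t in 𝓝[>] (0 : ℝ),
      modulus α β r lam f t ≤ ENNReal.ofReal (C * t ^ a₀)) ↔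
      HalfSmooth r α lam a₀ f ∧ HalfSmooth r β lam a₀ (fun t => f (1 - t)) := by
  rw [modulus_isBigO_iff]
  constructor
  · rintro ⟨C, t₀, hC, ht₀, h⟩
    exact ⟨halfSmooth_of_diffBound hr hα hβ ha₀ hlam0 hlam1 hC ht₀ h,
      halfSmooth_of_diffBound hr hβ hα ha₀ hlam0 hlam1 hC ht₀ fun t ht => (h t ht).reflect⟩
  · rintro ⟨h1, h2⟩
    obtain ⟨C₁, t₁, hC₁, ht₁, h1⟩ := h1.exists_diff_le hr hα hβ ha₀ hlam0 hlam1
    obtain ⟨C₂, t₂, hC₂, ht₂, h2⟩ := h2.exists_diff_le hr hβ hα ha₀ hlam0 hlam1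
    refine ⟨max C₁ C₂, min t₁ t₂, by positivity, by positivity, fun t ht => ?_⟩
    have ht0 := ht.1
    obtain ⟨c1, f1⟩ := h1 t ⟨ht0, ht.2.trans_le (min_le_left _ _)⟩
    obtain ⟨c2, f2⟩ := h2 t ⟨ht0, ht.2.trans_le (min_le_right _ _)⟩
    have hm1 : C₁ * t ^ a₀ ≤ max C₁ C₂ * t ^ a₀ := by
      gcongr
      exact le_max_left _ _
    have hm2 : C₂ * t ^ a₀ ≤ max C₁ C₂ * t ^ a₀ := by
      gcongr
      exact le_max_right _ _
    refine ⟨fun h hh x hx => ?_, fun h hh x hx => (f1 h hh x hx).trans hm1, fun h hh x hx => ?_⟩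
    · rcases le_total x (1 / 2) with hx2 | hx2
      · exact (c1 h hh x ⟨hx.1, hx2⟩).trans hm1
      · have := c2 h hh (1 - x) ⟨by linarith [hx.2], by linarith⟩
        rw [abs_mul, weight_reflect, phi_reflect, abs_centralDiff_reflect, ← abs_mul] at this
        exact this.trans hm2
    · have := f2 h hh (1 - x) ⟨by linarith [hx.2], by linarith [hx.1]⟩
      rw [abs_mul, weight_reflect, ← abs_backwardDiff_eq_forwardDiff, ← abs_mul] at this
      exact this.trans hm2

end Modulus

end WeightedBernstein

theorem theorem3 (α β : ℝ) (hα : 0 < α) (hβ : 0 < β) (r : ℕ) (hr : 2 ≤ r)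
    (α₀ : ℝ) (hα₀ : 0 < α₀) (hα₀r : α₀ < r) (lam : ℝ) (hlam0 : 0 ≤ lam) (hlam1 : lam ≤ 1)
    (d : ℕ → ℕ → ℕ) (c : ℕ → ℕ → ℝ) (hdc : WeightedBernstein.IsCombination (r - 1) d c)
    (ψ : ℝ → ℝ) (hψ : WeightedBernstein.IsCutoff r ψ)
    (f : ℝ → ℝ) (hf : WeightedBernstein.MemCw α β f) :
    (∃ C : ℝ, ∃ N : ℕ, ∀ n : ℕ, N ≤ n → ∀ x ∈ Set.Ioo (0 : ℝ) 1,
      WeightedBernstein.weight α β x * |f x - WeightedBernstein.starOp ψ r d c n f x| ≤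
        C * ((n : ℝ) ^ (-(1 / 2) : ℝ) * WeightedBernstein.phi x ^ (-lam) *
          WeightedBernstein.delta n x) ^ α₀) ↔
    (∃ C : ℝ, ∀ᶠ t in nhdsWithin (0 : ℝ) (Set.Ioi 0),
      WeightedBernstein.modulus α β r lam f t ≤ ENNReal.ofReal (C * t ^ α₀)) :=
  (WeightedBernstein.starRate_iff hr hψ hdc hα hβ hα₀ hα₀r hlam0 hlam1 hf).trans
    (WeightedBernstein.modulus_iff (by omega) hα hβ hα₀ hlam0 hlam1).symm
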